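/- Two symmetric bilinear forms $g_1,g_2$ on the tangent spaces along a subset $S$ of a manifold $M$ are called quasi-isometric on $S$ with constant $K\ge 1$ if $\frac1K\le \frac{g_1(v,v)}{g_2(v,v)}\le K$ for all $p\in S$ and all $v\in T_pM\setminus\{0\}$. Let $(M,g)$ be a compact smooth Riemannian manifold without boundary, of dimension $m$, with Riemannian distance $d_g$, let $N\subset M$ be a nonempty compact smooth embedded submanifold without boundary, of dimension $n<m$, and let $h$ be the metric induced by $g$ on $N$. For $\delta>0$ let $T_\delta=\{p\in M: d_g(p,N)<\delta\}$. A smooth orthonormal frame $\nu=(\nu_1,\dots,\nu_{m-n})$ of the normal bundle of $N$ over an open set $U\subset N$ defines the Fermi parametrization $$\Phi_\nu(q,t)=\exp_q\Big(\sum_{j=1}^{m-n}t_j\,\nu_j(q)\Big),\qquad q\in U,\ t\in\mathbb R^{m-n},$$ where $\exp$ is the Riemannian exponential map of $(M,g)$. Call a *Fermi atlas* a finite family $(U_i,V_i,\nu^i)_i$ in which the $V_i$ form an open cover of $N$, each $U_i\subset N$ is open with $\overline{V_i}\subset U_i$, and $\nu^i$ is a smooth orthonormal frame of the normal bundle over $U_i$.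 **Proposition.** Fermi atlases exist. For every Fermi atlas $(U_i,V_i,\nu^i)_i$ and every $\varepsilon_0>0$ there is $\delta>0$ such that: 1. the exponential map restricts to a bijection from $\{(q,v): q\in N,\ v\in T_qM,\ v\perp T_qN,\ |v|<\delta\}$ onto $T_\delta$; 2. for every $i$, the map $\Phi_{\nu^i}$ restricts to a smooth diffeomorphism from $V_i\times\mathbb B^{m-n}(\delta)$ onto an open set $W_i\subset M$, where $\mathbb B^{m-n}(\delta)$ is the open Euclidean ball of radius $\delta$ centred at $0$, and $\bigcup_i W_i=T_\delta$; 3. for every $i$, on $W_i$ the metric $g$ is quasi-isometric with constant $1+\varepsilon_0$ to the product metric $h\oplus g_E$, where $g_E$ is the Euclidean metric of $\mathbb R^{m-n}$ and $h\oplus g_E$ is carried from $V_i\times\mathbb B^{m-n}(\delta)$ to $W_i$ by $\Phi_{\nu^i}$. In particular, if the normal bundle of $N$ has a global smooth orthonormal frame, then the one-patch atlas $U=V=N$ identifies $T_\delta$ with $N\times\mathbb B^{m-n}(\delta)$, and $g$ is quasi-isometric to $h\oplus g_E$ with constant $1+\varepsilon_0$ on all of $T_\delta$. -/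

import Mathlib

open Set Metric Topology Manifold Bundle
open scoped ContDiff

noncomputable section

section Geodesics

variable {E : Type*} [NormedAddCommGroup E] [NormedSpace ℝ E]
  {M : Type*} [TopologicalSpace M] [ChartedSpace E M]

/-- The metric tensor in the chart `e`: `g_y(u, w)`, where `y` is a point of the chart's target and
`u`, `w` are coordinate vectors (identified with tangent vectors of `M` by `d(e⁻¹)_y`). -/
def coordMetric [RiemannianBundle (fun x : M ↦ TangentSpace 𝓘(ℝ, E) x)]
    (e : OpenPartialHomeomorph M E) (y u w : E) : ℝ :=
  inner ℝ (mfderiv 𝓘(ℝ, E) 𝓘(ℝ, E) e.symm y u) (mfderiv 𝓘(ℝ, E) 𝓘(ℝ, E) e.symm y w)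

/-- The Christoffel symbol of the first kind in the chart `e`, as a trilinear form:
`Γ(u, v; w) = ½ (∂_u g(v, w) + ∂_v g(u, w) - ∂_w g(u, v))`. -/
def christoffelFirst [RiemannianBundle (fun x : M ↦ TangentSpace 𝓘(ℝ, E) x)]
    (e : OpenPartialHomeomorph M E) (y u v w : E) : ℝ :=
  (fderiv ℝ (fun z ↦ coordMetric e z v w) y u + fderiv ℝ (fun z ↦ coordMetric e z u w) y v
    - fderiv ℝ (fun z ↦ coordMetric e z u v) y w) / 2

/-- `γ` is a geodesic on the (open) set `s` of times: in every chart of the atlas, its coordinate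
expression `c` satisfies `c'' + Γ(c', c') = 0`. The equation is written with its index lowered,
`g(c'', w) + Γ(c', c'; w) = 0` for all `w`. -/
def IsGeodesicOn [RiemannianBundle (fun x : M ↦ TangentSpace 𝓘(ℝ, E) x)]
    (γ : ℝ → M) (s : Set ℝ) : Prop :=
  ContMDiffOn 𝓘(ℝ, ℝ) 𝓘(ℝ, E) 2 γ s ∧
    ∀ e ∈ atlas E M, ∀ t ∈ s, γ t ∈ e.source → ∀ w : E,
      coordMetric e (e (γ t)) (deriv (deriv (e ∘ γ)) t) w
        + christoffelFirst e (e (γ t)) (deriv (e ∘ γ) t) (deriv (e ∘ γ) t) w = 0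

/-- The point of the tangent bundle given by `γ` and its velocity at time `t`. -/
def velocityLift (γ : ℝ → M) (t : ℝ) : TangentBundle 𝓘(ℝ, E) M :=
  ⟨γ t, mfderiv 𝓘(ℝ, ℝ) 𝓘(ℝ, E) γ t (1 : ℝ)⟩

open Classical in
/-- The Riemannian exponential map `(q, v) ↦ exp_q v`: the value at time `1` of the geodesic that
starts at `q` with velocity `v`. (If there is no such geodesic defined on a neighbourhood of
`[0, 1]`, which does not happen on a compact manifold, the value is `q`.) -/
def riemannianExp [RiemannianBundle (fun x : M ↦ TangentSpace 𝓘(ℝ, E) x)]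
    (X : TangentBundle 𝓘(ℝ, E) M) : M :=
  if h : ∃ γ : ℝ → M, (∃ s : Set ℝ, IsOpen s ∧ Icc 0 1 ⊆ s ∧ IsGeodesicOn (E := E) γ s) ∧
      velocityLift γ 0 = X
  then h.choose 1 else X.proj

/-- Two (families of) bilinear forms `g₁`, `g₂` on the tangent spaces of `M` are quasi-isometric
with constant `K` on the subset `S`: `1 / K ≤ g₁(v, v) / g₂(v, v) ≤ K` for every nonzero tangent
vector `v` at a point of `S`. -/
def QuasiIsometricOn (K : ℝ)
    (g₁ g₂ : ∀ p : M, TangentSpace 𝓘(ℝ, E) p → TangentSpace 𝓘(ℝ, E) p → ℝ) (S : Set M) : Prop :=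
  ∀ p ∈ S, ∀ v : TangentSpace 𝓘(ℝ, E) p, v ≠ 0 →
    1 / K ≤ g₁ p v v / g₂ p v v ∧ g₁ p v v / g₂ p v v ≤ K

end Geodesics

section Fermi

variable {m n : ℕ}
  {M : Type*} [TopologicalSpace M] [ChartedSpace (EuclideanSpace ℝ (Fin m)) M]
  [IsManifold (𝓡 m) ∞ M] [RiemannianBundle (fun x : M ↦ TangentSpace (𝓡 m) x)]
  {N : Type*} [TopologicalSpace N] [ChartedSpace (EuclideanSpace ℝ (Fin n)) N]

/-- The metric of `M`. -/
def ambientMetric (p : M) (v w : TangentSpace (𝓡 m) p) : ℝ := inner ℝ v w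

/-- The metric `h` induced on `N` by `ι : N → M`. -/
def inducedMetric (ι : N → M) (q : N) (v w : TangentSpace (𝓡 n) q) : ℝ :=
  ambientMetric (m := m) (ι q) (mfderiv (𝓡 n) (𝓡 m) ι q v) (mfderiv (𝓡 n) (𝓡 m) ι q w)

variable (m n) in
/-- The set of all normal vectors of `N` of length `< δ`. -/
def normalDiscBundle (ι : N → M) (δ : ℝ) : Set (TangentBundle (𝓡 m) M) :=
  {X | ∃ (q : N) (v : TangentSpace (𝓡 m) (ι q)), X = ⟨ι q, v⟩ ∧
    (∀ w : TangentSpace (𝓡 n) q, inner ℝ (mfderiv (𝓡 n) (𝓡 m) ι q w) v = 0) ∧ ‖v‖ < δ}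

variable (m n) in
/-- `ν` is a smooth orthonormal frame of the normal bundle of `N` over the set `U`. -/
structure IsNormalFrameOn (ι : N → M)
    (ν : Fin (m - n) → ∀ q : N, TangentSpace (𝓡 m) (ι q)) (U : Set N) : Prop where
  smooth : ∀ j, ContMDiffOn (𝓡 n) (𝓡 m).tangent ∞
    (fun q ↦ (⟨ι q, ν j q⟩ : TangentBundle (𝓡 m) M)) U
  orthonormal : ∀ q ∈ U, Orthonormal ℝ (fun j ↦ ν j q)
  normal : ∀ q ∈ U, ∀ (j : Fin (m - n)) (w : TangentSpace (𝓡 n) q),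
    inner ℝ (mfderiv (𝓡 n) (𝓡 m) ι q w) (ν j q) = 0

variable (m n) in
/-- The Fermi parametrization `(q, t) ↦ exp_q (∑ j, t_j ν_j(q))`. Its inverse, followed by any
coordinates of `N` in the first factor, is a system of Fermi coordinates. -/
def fermiMap (ι : N → M) (ν : Fin (m - n) → ∀ q : N, TangentSpace (𝓡 m) (ι q))
    (x : N × EuclideanSpace ℝ (Fin (m - n))) : M :=
  riemannianExp (E := EuclideanSpace ℝ (Fin m)) ⟨ι x.1, ∑ j, x.2 j • ν j x.1⟩

/-- The product metric `h ⊕ g_E` of `N × ℝ^(m-n)`, carried over to `M` by the inverse of the local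
diffeomorphism `Φ`: `(h ⊕ g_E)_p(v, w) = h(v₁, w₁) + ⟪v₂, w₂⟫`, where `(v₁, v₂) = d(Φ⁻¹)_p v` and
`(w₁, w₂) = d(Φ⁻¹)_p w`. -/
def productMetric (ι : N → M)
    (Φ : OpenPartialHomeomorph (N × EuclideanSpace ℝ (Fin (m - n))) M)
    (p : M) (v w : TangentSpace (𝓡 m) p) : ℝ :=
  let D : TangentSpace (𝓡 m) p →
      TangentSpace (𝓡 n) (Φ.symm p).1 × EuclideanSpace ℝ (Fin (m - n)) :=
    mfderiv (𝓡 m) ((𝓡 n).prod (𝓡 (m - n))) Φ.symm p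
  inducedMetric (m := m) (n := n) ι (Φ.symm p).1 (D v).1 (D w).1 + inner ℝ (D v).2 (D w).2

variable (m n) in
/-- A finite system of patches for Fermi coordinates along `N`: an open cover `V i` of `N` and, for
each `i`, a smooth orthonormal normal frame `ν i` over an open set `U i` that contains the closure
of `V i`. -/
structure FermiAtlas (ι : N → M) where
  card : ℕ
  U : Fin card → Set N
  V : Fin card → Set N
  ν : ∀ _ : Fin card, Fin (m - n) → ∀ q : N, TangentSpace (𝓡 m) (ι q)
  isOpen_U : ∀ i, IsOpen (U i)
  isOpen_V : ∀ i, IsOpen (V i)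
  closure_subset : ∀ i, closure (V i) ⊆ U i
  cover : ⋃ i, V i = univ
  frame : ∀ i, IsNormalFrameOn m n ι (ν i) (U i)

end Fermi

end

/-! At `t = 0` the differential of the Fermi parametrization sends `(w, τ)` to `dι w + ∑ τ_j ν_j`.
The two summands are orthogonal and the frame is orthonormal, so along the submanifold the pullback
of `g` is exactly the product metric. By continuity the two metrics stay within the factor `1 + ε₀`
nearby, the inverse function theorem gives local diffeomorphisms, and compactness of `N` gives a
common radius. What needs real work is the smoothness of `exp` near the zero section and the fact
that the image is the whole metric tube.

Smoothness. In a chart geodesics solve `c'' = A(c, c')` with `A` quadratic in the velocity. The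
implicit function theorem in a space of continuous functions yields a smooth family of solutions
near the constant one (`exists_smooth_solution_family`), and rescaling time writes it as `t ↦ X(x, t
v)` (`exists_homogeneous_solution_family`). Since `riemannianExp` is defined by choosing a geodesic,
a uniqueness argument (`IsGeodesicOn.eqOn_of_chart`) is needed to identify it with `X` in the chart
(`riemannianExp_eq`).

Local patches. Besides the metric comparison, the patches of `exists_isFermiPatch` record two
consequences of the Gauss lemma (`IsGeodesicFamily.gauss`) and of constant speed: the radial vector
at `(q, t)` pairs with any tangent vector as `t` does in Euclidean space, and the ray `s ↦ (q, s t)`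
has speed `|t|`.

Uniformity. Normal exponentials from distinct base points stay apart for short vectors, and those
from nearby base points are compared in one patch after a change of frame. Compactness turns this
into injectivity of `exp` on the normal discs of some radius (`FermiAtlas.exists_isFermiPatch`),
after which local patches glue over each `V i`.

The image. Rays have length `|t| < δ`, so they end in the tube (`IsFermiPatch.edist_le`).
Conversely, `|t|` grows along any path at most as fast as its length
(`IsFermiPatch.norm_symm_snd_le`). So a path of length less than `δ` starting on `N` can never leave
the union of the patches (`FermiAtlas.exists_fermiMap_eq`). No minimizing geodesics are used: the
strict inequality for the distance provides a short path. -/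

section FermiCoordinates

set_option maxSynthPendingDepth 3

/-! ### Smoothness of superposition operators on spaces of continuous functions. -/

section Superposition

variable {K : Type*} [TopologicalSpace K] [CompactSpace K]

/-- Pointwise application of a bounded bilinear map to continuous functions on a compact space, as
a bounded bilinear map. -/
noncomputable def ContinuousLinearMap.compContinuousMap₂ (K : Type*) [TopologicalSpace K]
    [CompactSpace K] {F G H : Type*} [NormedAddCommGroup F] [NormedSpace ℝ F]
    [NormedAddCommGroup G] [NormedSpace ℝ G] [NormedAddCommGroup H] [NormedSpace ℝ H]
    (B : H →L[ℝ] F →L[ℝ] G) : C(K, H) →L[ℝ] C(K, F) →L[ℝ] C(K, G) :=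
  LinearMap.mkContinuous₂
    (LinearMap.mk₂ ℝ
      (fun (a : C(K, H)) (h : C(K, F)) ↦ (⟨fun k ↦ B (a k) (h k), by fun_prop⟩ : C(K, G)))
      (fun _ _ _ ↦ by ext; simp) (fun _ _ _ ↦ by ext; simp)
      (fun _ _ _ ↦ by ext; simp) (fun _ _ _ ↦ by ext; simp)) ‖B‖ (by
    intro a h
    rw [ContinuousMap.norm_le _ (by positivity)]
    intro k
    refine (B.le_opNorm₂ (a k) (h k)).trans ?_
    gcongr
    · exact a.norm_coe_le_norm k
    · exact h.norm_coe_le_norm k)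

/-- Superposition with a `C¹` function is differentiable on a space of continuous functions. -/
lemma ContinuousMap.hasFDerivAt_comp {F G : Type*} [NormedAddCommGroup F] [NormedSpace ℝ F]
    [NormedAddCommGroup G] [NormedSpace ℝ G] (g : C(F, G)) (g' : C(F, F →L[ℝ] G))
    (hg : ∀ y, HasFDerivAt g (g' y) y) (u : C(K, F)) :
    HasFDerivAt (fun u : C(K, F) ↦ g.comp u)
      ((ContinuousLinearMap.id ℝ (F →L[ℝ] G)).compContinuousMap₂ K (g'.comp u)) u := by
  rw [hasFDerivAt_iff_isLittleO, Asymptotics.isLittleO_iff]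
  intro ε hε
  -- The derivative `g'` is uniformly continuous at the compact range of `u`, so one `δ` serves all
  -- `k` in the mean value inequality below.
  have hc := (isCompact_range u.continuous).uniformContinuousAt_of_continuousAt g'
    (fun a _ ↦ g'.continuous.continuousAt) (dist_mem_uniformity hε)
  obtain ⟨δ, hδ, H⟩ := Metric.mem_uniformity_dist.1 hc
  filter_upwards [ball_mem_nhds u hδ] with w hw
  rw [ContinuousMap.norm_le _ (by positivity)]
  intro k
  have hwk : dist (w k) (u k) < δ := (ContinuousMap.dist_apply_le_dist k).trans_lt hw
  have key := (convex_ball (u k) δ).norm_image_sub_le_of_norm_hasFDerivWithin_le'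
    (f := g) (f' := g') (φ := g' (u k)) (C := ε) (x := u k) (y := w k)
    (fun x _ ↦ (hg x).hasFDerivWithinAt) (fun x hx ↦ by
      have := H (a := u k) (b := x) (by rw [dist_comm]; exact hx) ⟨k, rfl⟩
      simp only [mem_ofPred_eq] at this
      rw [← dist_eq_norm, dist_comm]; exact this.le) (mem_ball_self hδ) hwk
  exact key.trans (mul_le_mul_of_nonneg_left ((w - u).norm_coe_le_norm k) hε.le)

/-- Superposition with a smooth function is smooth on a space of continuous functions. -/
lemma ContinuousMap.contDiff_comp_nat.{u} {F : Type u} [NormedAddCommGroup F] [NormedSpace ℝ F]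
    (n : ℕ) : ∀ {G : Type u} [NormedAddCommGroup G] [NormedSpace ℝ G] (g : C(F, G)),
    ContDiff ℝ ∞ g → ContDiff ℝ n (fun u : C(K, F) ↦ g.comp u) := by
  -- The codomain stays free in the induction because the step replaces `g` by its derivative. The
  -- derivative of the superposition operator is superposition with `fderiv ℝ g`, followed by a
  -- bounded linear map.
  induction n with
  | zero =>
    intro G _ _ g _
    exact contDiff_zero.2 (ContinuousMap.continuous_postcomp g)
  | succ n ih =>
    intro G _ _ g hg
    have h' : ContDiff ℝ ∞ (fderiv ℝ g) := hg.fderiv_right (by simp)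
    let g' : C(F, F →L[ℝ] G) := ⟨fderiv ℝ g, h'.continuous⟩
    rw [Nat.cast_add, Nat.cast_one, contDiff_succ_iff_hasFDerivAt]
    exact ⟨fun u ↦ (ContinuousLinearMap.id ℝ (F →L[ℝ] G)).compContinuousMap₂ K (g'.comp u),
      ((ContinuousLinearMap.id ℝ (F →L[ℝ] G)).compContinuousMap₂ K).contDiff.comp (ih g' h'),
      ContinuousMap.hasFDerivAt_comp g g'
        fun y ↦ (hg.differentiable (by simp) y).hasFDerivAt⟩

/-- Superposition with a smooth function is smooth on a space of continuous functions. -/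
lemma ContinuousMap.contDiff_comp.{u} {F G : Type u} [NormedAddCommGroup F] [NormedSpace ℝ F]
    [NormedAddCommGroup G] [NormedSpace ℝ G] (g : C(F, G)) (hg : ContDiff ℝ ∞ g) :
    ContDiff ℝ ∞ (fun u : C(K, F) ↦ g.comp u) :=
  contDiff_infty.2 fun n ↦ ContinuousMap.contDiff_comp_nat n g hg

end Superposition

/-! ### Second order equations by the implicit function theorem. -/

section SecondOrder

variable {E : Type*} [NormedAddCommGroup E] [NormedSpace ℝ E]

/-- The primitive vanishing at `0`, as an operator on continuous functions on `[-2, 2]`. -/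
noncomputable def primitiveCLM (E : Type*) [NormedAddCommGroup E] [NormedSpace ℝ E] :
    C(Icc (-2 : ℝ) 2, E) →L[ℝ] C(Icc (-2 : ℝ) 2, E) :=
  LinearMap.mkContinuous
    { toFun := fun a ↦ ⟨fun t ↦ ∫ s in (0 : ℝ)..t, IccExtend (by norm_num) a s, by
        have : Continuous (IccExtend (by norm_num : (-2 : ℝ) ≤ 2) a) := a.continuous.Icc_extend'
        exact (intervalIntegral.continuous_primitive
          (fun u v ↦ this.intervalIntegrable u v) 0).comp continuous_subtype_val⟩
      map_add' := fun a b ↦ by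
        ext t
        have ha : Continuous (IccExtend (by norm_num : (-2 : ℝ) ≤ 2) a) := a.continuous.Icc_extend'
        have hb : Continuous (IccExtend (by norm_num : (-2 : ℝ) ≤ 2) b) := b.continuous.Icc_extend'
        exact intervalIntegral.integral_add (ha.intervalIntegrable _ _) (hb.intervalIntegrable _ _)
      map_smul' := fun c a ↦ by
        ext t
        exact intervalIntegral.integral_smul c _ } 2 (by
    intro a
    rw [ContinuousMap.norm_le _ (by positivity)]
    intro t
    refine (intervalIntegral.norm_integral_le_of_norm_le_const (C := ‖a‖)
      (fun s _ ↦ a.norm_coe_le_norm _)).trans ?_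
    have : |(t : ℝ) - 0| ≤ 2 := by rw [sub_zero, abs_le]; exact t.2
    rw [mul_comm]
    exact mul_le_mul_of_nonneg_right this (norm_nonneg _))

/-- Constant functions, as a continuous linear map. -/
noncomputable def constCLM (E : Type*) [NormedAddCommGroup E] [NormedSpace ℝ E] :
    E →L[ℝ] C(Icc (-2 : ℝ) 2, E) :=
  LinearMap.mkContinuous
    { toFun := fun x ↦ ContinuousMap.const _ x
      map_add' := fun _ _ ↦ rfl
      map_smul' := fun _ _ ↦ rfl } 1 (by
    intro x
    rw [ContinuousMap.norm_le _ (by positivity), one_mul]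
    exact fun _ ↦ le_rfl)

/-- The velocity with initial value `p.1.2` and acceleration `p.2`. -/
noncomputable def velocityCLM (E : Type*) [NormedAddCommGroup E] [NormedSpace ℝ E] :
    (E × E) × C(Icc (-2 : ℝ) 2, E) →L[ℝ] C(Icc (-2 : ℝ) 2, E) :=
  constCLM E ∘L .snd ℝ E E ∘L .fst ℝ _ _ + primitiveCLM E ∘L .snd ℝ _ _

/-- The position with initial value `p.1.1`, initial velocity `p.1.2` and acceleration `p.2`. -/
noncomputable def positionCLM (E : Type*) [NormedAddCommGroup E] [NormedSpace ℝ E] :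
    (E × E) × C(Icc (-2 : ℝ) 2, E) →L[ℝ] C(Icc (-2 : ℝ) 2, E) :=
  constCLM E ∘L .fst ℝ E E ∘L .fst ℝ _ _ + primitiveCLM E ∘L velocityCLM E

/-- Position and velocity, with initial values `p.1` and acceleration `p.2`. -/
noncomputable def phaseCLM (E : Type*) [NormedAddCommGroup E] [NormedSpace ℝ E] :
    (E × E) × C(Icc (-2 : ℝ) 2, E) →L[ℝ] C(Icc (-2 : ℝ) 2, E × E) :=
  (ContinuousLinearMap.inl ℝ E E).compLeftContinuous ℝ (Icc (-2 : ℝ) 2) ∘L positionCLM E +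
    (ContinuousLinearMap.inr ℝ E E).compLeftContinuous ℝ (Icc (-2 : ℝ) 2) ∘L velocityCLM E

lemma phaseCLM_apply (p : (E × E) × C(Icc (-2 : ℝ) 2, E)) (t : Icc (-2 : ℝ) 2) :
    phaseCLM E p t = (positionCLM E p t, velocityCLM E p t) := by
  simp [phaseCLM]

/-- The implicit function of a smooth function is smooth near the base point. -/
lemma ContDiff.eventually_contDiffAt_implicitFunction {E₁ E₂ F : Type*}
    [NormedAddCommGroup E₁] [NormedSpace ℝ E₁] [CompleteSpace E₁]
    [NormedAddCommGroup E₂] [NormedSpace ℝ E₂] [CompleteSpace E₂]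
    [NormedAddCommGroup F] [NormedSpace ℝ F] [CompleteSpace F] {f : E₁ × E₂ → F}
    (hf : ContDiff ℝ ∞ f) {u : E₁ × E₂} (h : (fderiv ℝ f u ∘L .inr ℝ E₁ E₂).IsInvertible) :
    ∀ᶠ x in 𝓝 u.1, ContDiffAt ℝ ∞ (hf.contDiffAt.implicitFunction (by simp) h) x := by
  set α := hf.contDiffAt.implicitFunction (by simp) h with hα_def
  have hα0 : α u.1 = u.2 := hf.contDiffAt.implicitFunction_apply_self (by simp) h
  have hα : ContDiffAt ℝ ∞ α u.1 := hf.contDiffAt.contDiffAt_implicitFunction (by simp) h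
  have hαH : ∀ᶠ x in 𝓝 u.1, f (x, α x) = f u :=
    hf.contDiffAt.eventually_apply_implicitFunction (by simp) h
  have hcont : ∀ᶠ x in 𝓝 u.1, ContinuousAt α x :=
    ((hα.of_le (m := 1) (by simp)).eventually (by simp)).mono fun x hx ↦ hx.continuousAt
  have hinv : ∀ᶠ x in 𝓝 u.1, (fderiv ℝ f (x, α x) ∘L .inr ℝ E₁ E₂).IsInvertible := by
    have hc : ContinuousAt (fun x ↦ fderiv ℝ f (x, α x) ∘L .inr ℝ E₁ E₂) u.1 := by
      refine ContinuousAt.clm_comp ?_ continuousAt_const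
      exact (hf.continuous_fderiv (by simp)).continuousAt.comp
        (continuousAt_id.prodMk hα.continuousAt)
    obtain ⟨e, he⟩ := h
    have hn := e.nhds
    refine (hc.eventually_mem (s := range ((↑) : (E₂ ≃L[ℝ] F) → E₂ →L[ℝ] F)) ?_).mono
      fun x hx ↦ hx
    rw [hα0, ← he]
    exact hn
  -- Smoothness of order `∞` at one point does not by itself spread to a neighbourhood. So the
  -- theorem is applied afresh at `(x, α x)`, and local uniqueness identifies the new implicit
  -- function with `α` near `x`.
  filter_upwards [hαH.eventually_nhds, hcont, hinv] with x h1 h2 h3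
  have hβ := hf.contDiffAt.contDiffAt_implicitFunction (u := (x, α x)) (n := ∞) (by simp) h3
  refine hβ.congr_of_eventuallyEq ?_
  have hiff := hf.contDiffAt.eventually_apply_eq_iff_implicitFunction
    (u := (x, α x)) (n := ∞) (by simp) h3
  have ht : Filter.Tendsto (fun y ↦ (y, α y)) (𝓝 x) (𝓝 (x, α x)) :=
    continuousAt_id.prodMk h2
  filter_upwards [ht.eventually hiff, h1] with y hy hy'
  exact (hy.1 (by rw [hy', h1.self_of_nhds])).symm

/-- A second order equation `c'' = A(c, c')` whose right-hand side vanishes to first order at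
`(x₀, 0)` has a smooth family of solutions on `(-2, 2)` for initial values near `(x₀, 0)`. -/
theorem exists_smooth_solution_family.{u} {E : Type u} [NormedAddCommGroup E] [NormedSpace ℝ E]
    [CompleteSpace E] (A : E × E → E) (hA : ContDiff ℝ ∞ A) (x₀ : E) (h0 : A (x₀, 0) = 0)
    (h1 : fderiv ℝ A (x₀, 0) = 0) {U : Set (E × E)} (hU : U ∈ 𝓝 (x₀, (0 : E))) :
    ∃ (c c' : E × E → ℝ → E) (r : ℝ), 0 < r ∧
      ContDiffOn ℝ ∞ (fun p ↦ c p 1) (ball x₀ r ×ˢ ball 0 r) ∧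
      ∀ p ∈ ball x₀ r ×ˢ ball (0 : E) r, c p 0 = p.1 ∧ c' p 0 = p.2 ∧ ∀ t ∈ Ioo (-2 : ℝ) 2,
        HasDerivAt (c p) (c' p t) t ∧ HasDerivAt (c' p) (A (c p t, c' p t)) t ∧
          (c p t, c' p t) ∈ U := by
  let K := Icc (-2 : ℝ) 2
  have h22 : (-2 : ℝ) ≤ 2 := by norm_num
  let g : C(E × E, E) := ⟨A, hA.continuous⟩
  let g' : C(E × E, E × E →L[ℝ] E) := ⟨fderiv ℝ A, (hA.fderiv_right (m := ∞) (by simp)).continuous⟩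
  -- The unknown is the acceleration: position and velocity depend linearly on it together with the
  -- initial values. A zero of `H` is a solution on `[-2, 2]`.
  let H : (E × E) × C(K, E) → C(K, E) := fun q ↦ q.2 - g.comp (phaseCLM E q)
  let q₀ : (E × E) × C(K, E) := ((x₀, 0), 0)
  have hq₀ : phaseCLM E q₀ = ContinuousMap.const _ (x₀, 0) := by
    have hv : velocityCLM E q₀ = 0 := by
      simp [velocityCLM, q₀]
    have hp : positionCLM E q₀ = ContinuousMap.const _ x₀ := by
      simp only [positionCLM, add_apply, ContinuousLinearMap.comp_apply, hv,
        map_zero, add_zero]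
      rfl
    ext t <;> simp [phaseCLM_apply, hv, hp]
  have hHd : ContDiff ℝ ∞ H :=
    contDiff_snd.sub ((ContinuousMap.contDiff_comp g hA).comp (phaseCLM E).contDiff)
  -- As the derivative of `A` vanishes at `(x₀, 0)`, linearizing at the constant solution leaves
  -- only the acceleration itself, so the partial derivative to be inverted is the identity.
  have hH' : HasFDerivAt H (ContinuousLinearMap.snd ℝ (E × E) C(K, E)) q₀ := by
    have e1 := ContinuousMap.hasFDerivAt_comp g g'
      (fun y ↦ (hA.differentiable (by simp) y).hasFDerivAt) (phaseCLM E q₀)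
    have e2 : g'.comp (phaseCLM E q₀) = 0 := by
      ext1 t
      rw [hq₀]
      exact h1
    rw [e2, ContinuousLinearMap.map_zero] at e1
    have e3 := (ContinuousLinearMap.snd ℝ (E × E) C(K, E)).hasFDerivAt (x := q₀) |>.sub
      (e1.comp q₀ (phaseCLM E).hasFDerivAt)
    refine e3.congr_fderiv ?_
    rw [ContinuousLinearMap.zero_comp, sub_zero]
  have hinv : (fderiv ℝ H q₀ ∘L .inr ℝ (E × E) C(K, E)).IsInvertible := by
    rw [hH'.fderiv, ContinuousLinearMap.snd_comp_inr]
    exact ⟨.refl ℝ _, rfl⟩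
  have hHat : ContDiffAt ℝ ∞ H q₀ := hHd.contDiffAt
  let α := hHat.implicitFunction (by simp) hinv
  have hα0 : α q₀.1 = q₀.2 := hHat.implicitFunction_apply_self (by simp) hinv
  have hα : ContDiffAt ℝ ∞ α q₀.1 := hHat.contDiffAt_implicitFunction (by simp) hinv
  have hαH : ∀ᶠ p in 𝓝 q₀.1, H (p, α p) = H q₀ :=
    hHat.eventually_apply_implicitFunction (by simp) hinv
  have hHq₀ : H q₀ = 0 := by
    ext1 t
    simp only [H, hq₀]
    simp [q₀, g, h0]
  -- everything needed of the initial values holds near `(x₀, 0)`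
  have hcont : ContinuousAt (fun p ↦ phaseCLM E (p, α p)) q₀.1 :=
    (phaseCLM E).continuous.continuousAt.comp (continuousAt_id.prodMk hα.continuousAt)
  obtain ⟨ε, hε, hεU⟩ := Metric.mem_nhds_iff.1 hU
  have hnear : ∀ᶠ p in 𝓝 q₀.1, dist (phaseCLM E (p, α p)) (ContinuousMap.const _ (x₀, 0)) < ε := by
    have := hcont.eventually (ball_mem_nhds _ hε)
    simp only [hα0] at this
    rwa [show (q₀.1, q₀.2) = q₀ from rfl, hq₀] at this
  have hsm : ∀ᶠ p in 𝓝 q₀.1, ContDiffAt ℝ ∞ α p := 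
    hHd.eventually_contDiffAt_implicitFunction hinv
  obtain ⟨r, hr, hrU⟩ := Metric.mem_nhds_iff.1 (hαH.and (hnear.and hsm))
  rw [show q₀.1 = (x₀, 0) from rfl, ← ball_prod_same] at hrU
  have hcIcc : ∀ a : C(K, E), Continuous (IccExtend h22 a) := fun a ↦ a.continuous.Icc_extend'
  refine ⟨fun p t ↦ p.1 + ∫ s in (0 : ℝ)..t, IccExtend h22 (velocityCLM E (p, α p)) s,
    fun p t ↦ p.2 + ∫ s in (0 : ℝ)..t, IccExtend h22 (α p) s, r, hr, ?_, ?_⟩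
  · intro p hp
    have hpα := (hrU hp).2.2
    have : ContDiffAt ℝ ∞ (fun p ↦ ContinuousMap.evalCLM ℝ (⟨1, by simp only [K, mem_Icc]; norm_num⟩ : K)
        (positionCLM E (p, α p))) p :=
      (ContinuousLinearMap.contDiff _).contDiffAt.comp p
        ((positionCLM E).contDiff.contDiffAt.comp p (contDiffAt_id.prodMk hpα))
    exact this.contDiffWithinAt
  · intro p hp
    obtain ⟨h1, h2, -⟩ := hrU hp
    refine ⟨by simp, by simp, fun t ht ↦ ?_⟩
    have htK : t ∈ K := ⟨ht.1.le, ht.2.le⟩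
    have e1 : p.1 + ∫ s in (0 : ℝ)..t, IccExtend h22 (velocityCLM E (p, α p)) s =
      positionCLM E (p, α p) ⟨t, htK⟩ := rfl
    have e2 : p.2 + ∫ s in (0 : ℝ)..t, IccExtend h22 (α p) s =
      velocityCLM E (p, α p) ⟨t, htK⟩ := rfl
    have e3 : (positionCLM E (p, α p) ⟨t, htK⟩, velocityCLM E (p, α p) ⟨t, htK⟩) =
      phaseCLM E (p, α p) ⟨t, htK⟩ := (phaseCLM_apply _ _).symm
    have e4 : α p ⟨t, htK⟩ = A (phaseCLM E (p, α p) ⟨t, htK⟩) := by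
      have := congrArg (fun f : C(K, E) ↦ f ⟨t, htK⟩) (h1.trans hHq₀)
      exact sub_eq_zero.1 this
    have hderiv : ∀ a : C(K, E), HasDerivAt (fun t ↦ ∫ s in (0 : ℝ)..t, IccExtend h22 a s)
        (a ⟨t, htK⟩) t := by
      intro a
      have := (hcIcc a).integral_hasStrictDerivAt 0 t
      rw [IccExtend_of_mem h22 a htK] at this
      exact this.hasDerivAt
    beta_reduce
    refine ⟨?_, ?_, ?_⟩
    · rw [e2]
      exact (hderiv _).const_add _
    · rw [e1, e2, e3, ← e4]
      exact (hderiv _).const_add _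
    · rw [e1, e2, e3]
      exact hεU ((ContinuousMap.dist_apply_le_dist (⟨t, htK⟩ : K)).trans_lt h2)

end SecondOrder

/-! ### Uniqueness for autonomous second order equations. -/

section Uniqueness

/-- Local uniqueness for an autonomous equation with a `C¹` right-hand side. -/
lemma eventuallyEq_of_hasDerivAt {F : Type*} [NormedAddCommGroup F] [NormedSpace ℝ F] {v : F → F}
    {f g : ℝ → F} {t : ℝ} (hv : ContDiffAt ℝ 1 v (f t))
    (hf : ∀ᶠ s in 𝓝 t, HasDerivAt f (v (f s)) s) (hg : ∀ᶠ s in 𝓝 t, HasDerivAt g (v (g s)) s)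
    (h : f t = g t) : f =ᶠ[𝓝 t] g := by
  obtain ⟨K, s, hs, hK⟩ := hv.exists_lipschitzOnWith
  refine ODE_solution_unique_of_eventually (v := fun _ ↦ v) (s := fun _ ↦ s) (K := K)
    (Filter.Eventually.of_forall fun _ ↦ hK) ?_ ?_ h
  · exact hf.and (hf.self_of_nhds.continuousAt.eventually_mem hs)
  · exact hg.and (hg.self_of_nhds.continuousAt.eventually_mem (h ▸ hs))

variable {E : Type*} [NormedAddCommGroup E] [NormedSpace ℝ E]

/-- Local uniqueness for an autonomous second order equation with a `C¹` right-hand side. -/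
lemma eventuallyEq_of_secondOrder {A : E × E → E} {c c' d d' : ℝ → E} {t : ℝ}
    (hA : ContDiffAt ℝ 1 A (c t, c' t))
    (hc : ∀ᶠ s in 𝓝 t, HasDerivAt c (c' s) s ∧ HasDerivAt c' (A (c s, c' s)) s)
    (hd : ∀ᶠ s in 𝓝 t, HasDerivAt d (d' s) s ∧ HasDerivAt d' (A (d s, d' s)) s)
    (h : c t = d t) (h' : c' t = d' t) : c =ᶠ[𝓝 t] d := by
  have := eventuallyEq_of_hasDerivAt (v := fun p : E × E ↦ (p.2, A p))
    (f := fun s ↦ (c s, c' s)) (g := fun s ↦ (d s, d' s)) (t := t)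
    (contDiffAt_snd.prodMk hA) (hc.mono fun s hs ↦ hs.1.prodMk hs.2)
    (hd.mono fun s hs ↦ hs.1.prodMk hs.2) (by simp [h, h'])
  exact this.mono fun s hs ↦ congrArg Prod.fst hs

/-- Uniqueness on an open interval for an autonomous second order equation. -/
lemma eqOn_of_secondOrder {A : E × E → E} (hA : ContDiff ℝ 1 A) {c c' d d' : ℝ → E} {J : Set ℝ}
    (hJo : IsOpen J) (hJ : IsPreconnected J) {t₀ : ℝ} (ht₀ : t₀ ∈ J)
    (hc : ∀ s ∈ J, HasDerivAt c (c' s) s ∧ HasDerivAt c' (A (c s, c' s)) s)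
    (hd : ∀ s ∈ J, HasDerivAt d (d' s) s ∧ HasDerivAt d' (A (d s, d' s)) s)
    (h : c t₀ = d t₀) (h' : c' t₀ = d' t₀) : EqOn c d J := by
  have key : ∀ t ∈ J, c t = d t → c' t = d' t →
      (fun s ↦ (c s, c' s)) =ᶠ[𝓝 t] fun s ↦ (d s, d' s) := by
    intro t ht h h'
    have hJt := hJo.mem_nhds ht
    exact eventuallyEq_of_hasDerivAt (v := fun p : E × E ↦ (p.2, A p))
      (f := fun s ↦ (c s, c' s)) (g := fun s ↦ (d s, d' s)) (t := t)
      (contDiffAt_snd.prodMk hA.contDiffAt)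
      (Filter.mem_of_superset hJt fun s hs ↦ (hc s hs).1.prodMk (hc s hs).2)
      (Filter.mem_of_superset hJt fun s hs ↦ (hd s hs).1.prodMk (hd s hs).2) (by simp [h, h'])
  -- The times at which the two phase curves have the same germ form an open set. It is closed in
  -- `J` because equality passes to the limit and local uniqueness then applies there.
  have hsub : J ⊆ {t | (fun s ↦ (c s, c' s)) =ᶠ[𝓝 t] fun s ↦ (d s, d' s)} := by
    refine hJ.subset_of_closure_inter_subset ?_ ⟨t₀, ht₀, key t₀ ht₀ h h'⟩ ?_
    · exact isOpen_setOfPred_eventually_nhds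
    · rintro t ⟨htc, htJ⟩
      have e : (fun s ↦ (c s, c' s)) t = (fun s ↦ (d s, d' s)) t := by
        have hcc : ContinuousAt (fun s ↦ (c s, c' s)) t :=
          (hc t htJ).1.continuousAt.prodMk (hc t htJ).2.continuousAt
        have hdd : ContinuousAt (fun s ↦ (d s, d' s)) t :=
          (hd t htJ).1.continuousAt.prodMk (hd t htJ).2.continuousAt
        by_contra hne
        have := (hcc.prodMk hdd).eventually_mem
          (isClosed_diagonal.isOpen_compl.mem_nhds (x := (_, _)) hne)
        obtain ⟨s, hs, hs'⟩ := mem_closure_iff_nhds.1 htc _ this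
        exact hs hs'.self_of_nhds
      exact key t htJ (congrArg Prod.fst e) (congrArg Prod.snd e)
  exact fun t ht ↦ congrArg Prod.fst (hsub ht).self_of_nhds

end Uniqueness

/-! ### Right-hand sides quadratic in the velocity. -/

section Homogeneous

/-- A second order equation `c'' = A(c, c')` whose right-hand side is quadratic in the velocity has
solutions of the form `t ↦ X(x, t v)` with `X` smooth. -/
theorem exists_homogeneous_solution_family.{u} {E : Type u} [NormedAddCommGroup E]
    [NormedSpace ℝ E] [CompleteSpace E] (A : E × E → E) (hA : ContDiff ℝ ∞ A)
    (hhom : ∀ x v (τ : ℝ), A (x, τ • v) = τ ^ 2 • A (x, v)) (x₀ : E)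
    {U : Set (E × E)} (hU : U ∈ 𝓝 (x₀, (0 : E))) :
    ∃ (X : E × E → E) (r : ℝ), 0 < r ∧ ContDiffOn ℝ ∞ X (ball x₀ r ×ˢ ball 0 (2 * r)) ∧
      ∀ x ∈ ball x₀ r, ∀ v ∈ ball (0 : E) r, X (x, 0) = x ∧
        HasDerivAt (fun t : ℝ ↦ X (x, t • v)) v 0 ∧ ∀ t ∈ Ioo (-2 : ℝ) 2,
        (X (x, t • v), deriv (fun t : ℝ ↦ X (x, t • v)) t) ∈ U ∧
        deriv (deriv (fun t : ℝ ↦ X (x, t • v))) t =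
          A (X (x, t • v), deriv (fun t : ℝ ↦ X (x, t • v)) t) := by
  have hA0 : ∀ x, A (x, 0) = 0 := fun x ↦ by simpa using hhom x 0 0
  -- Along `s ↦ (x₀ + s a, s b)` homogeneity gives `s² A(x₀ + s a, b)`, whose derivative at `0`
  -- vanishes.
  have hA1 : fderiv ℝ A (x₀, 0) = 0 := by
    refine ContinuousLinearMap.ext fun ⟨a, b⟩ ↦ ?_
    have h1 : HasDerivAt (fun s : ℝ ↦ ((x₀ + s • a, s • b) : E × E)) (a, b) 0 := by
      simpa using ((hasDerivAt_id (0 : ℝ)).smul_const a |>.const_add x₀).prodMk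
        ((hasDerivAt_id (0 : ℝ)).smul_const b)
    have h2 : HasDerivAt (fun s : ℝ ↦ A (x₀ + s • a, s • b)) (fderiv ℝ A (x₀, 0) (a, b)) 0 := by
      have h3 : HasFDerivAt A (fderiv ℝ A (x₀, 0)) ((x₀ + (0 : ℝ) • a, (0 : ℝ) • b) : E × E) := by
        simpa using (hA.differentiable (by simp) (x₀, 0)).hasFDerivAt
      exact h3.comp_hasDerivAt (0 : ℝ) h1
    have h4 : HasDerivAt (fun s : ℝ ↦ s ^ 2 • A (x₀ + s • a, b)) 0 0 := by
      have h5 : DifferentiableAt ℝ (fun s : ℝ ↦ A (x₀ + s • a, b)) 0 :=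
        (hA.differentiable (by simp)).differentiableAt.comp (0 : ℝ)
          (by fun_prop : DifferentiableAt ℝ (fun s : ℝ ↦ ((x₀ + s • a, b) : E × E)) 0)
      simpa using (hasDerivAt_pow 2 (0 : ℝ)).fun_smul h5.hasDerivAt
    simp only [hhom] at h2
    exact h2.unique h4
  obtain ⟨c, c', r₀, hr₀, hsm, hc⟩ := exists_smooth_solution_family A hA x₀ (hA0 x₀) hA1 hU
  -- The curves `s ↦ c(x, τ v)(s)` and `s ↦ c(x, v)(τ s)` solve the same equation with the same
  -- initial data. Comparison at `s = 1` turns time dependence into dependence on the initial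
  -- velocity. The radius is halved so that `τ v` stays admissible for `|τ| < 2`.
  have hscale : ∀ x ∈ ball x₀ r₀, ∀ v ∈ ball (0 : E) (r₀ / 2), ∀ τ ∈ Ioo (-2 : ℝ) 2,
      c (x, τ • v) 1 = c (x, v) τ := by
    intro x hx v hv τ hτ
    rw [mem_ball_zero_iff] at hv
    have hv' : v ∈ ball (0 : E) r₀ := by rw [mem_ball_zero_iff]; linarith
    have hτv : τ • v ∈ ball (0 : E) r₀ := by
      rw [mem_ball_zero_iff, norm_smul, Real.norm_eq_abs]
      have : |τ| ≤ 2 := (abs_lt.2 hτ).le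
      nlinarith [norm_nonneg v, abs_nonneg τ]
    obtain ⟨i1, i2, i3⟩ := hc (x, τ • v) ⟨hx, hτv⟩
    obtain ⟨j1, j2, j3⟩ := hc (x, v) ⟨hx, hv'⟩
    let J : Set ℝ := Ioo (-2) 2 ∩ (fun s ↦ τ * s) ⁻¹' Ioo (-2) 2
    have hJo : IsOpen J := isOpen_Ioo.inter (isOpen_Ioo.preimage (by fun_prop))
    have hJ : IsPreconnected J := by
      refine ((convex_Ioo _ _).inter ?_).isPreconnected
      exact (convex_Ioo (-2 : ℝ) 2).linear_preimage (LinearMap.mulLeft ℝ τ)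
    have := eqOn_of_secondOrder (hA.of_le (by simp)) (c := c (x, τ • v)) (c' := c' (x, τ • v))
      (d := fun s ↦ c (x, v) (τ * s)) (d' := fun s ↦ τ • c' (x, v) (τ * s)) hJo hJ
      (t₀ := 0) (by constructor <;> simp) (fun s hs ↦ ⟨(i3 s hs.1).1, (i3 s hs.1).2.1⟩)
      (fun s hs ↦ by
        have hl : HasDerivAt (fun s ↦ τ * s) τ s := by
          simpa using (hasDerivAt_id s).const_mul τ
        refine ⟨(j3 _ hs.2).1.scomp s hl, ?_⟩
        have := ((j3 _ hs.2).2.1.scomp s hl).const_smul τ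
        rwa [smul_smul, ← pow_two, ← hhom] at this)
      (by simp [i1, j1]) (by simp [i2, j2])
    have h1 := this (x := 1) ⟨by norm_num, by simpa using hτ⟩
    simpa using h1
  refine ⟨fun p ↦ c p 1, r₀ / 2, by positivity, ?_, ?_⟩
  · refine hsm.mono (prod_mono (ball_subset_ball (by linarith)) (ball_subset_ball (by linarith)))
  · intro x hx v hv
    have hx' : x ∈ ball x₀ r₀ := ball_subset_ball (by linarith) hx
    have hv' : v ∈ ball (0 : E) r₀ := ball_subset_ball (by linarith) hv
    obtain ⟨j1, j2, j3⟩ := hc (x, v) ⟨hx', hv'⟩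
    have hloc : ∀ t ∈ Ioo (-2 : ℝ) 2, (fun t : ℝ ↦ c (x, t • v) 1) =ᶠ[𝓝 t] c (x, v) :=
      fun t ht ↦ Filter.mem_of_superset (isOpen_Ioo.mem_nhds ht)
        fun τ hτ ↦ hscale x hx' v hv τ hτ
    have hd : ∀ t ∈ Ioo (-2 : ℝ) 2, deriv (fun t : ℝ ↦ c (x, t • v) 1) t = c' (x, v) t :=
      fun t ht ↦ (hloc t ht).deriv_eq.trans (j3 t ht).1.deriv
    have hd2 : ∀ t ∈ Ioo (-2 : ℝ) 2, deriv (fun t : ℝ ↦ c (x, t • v) 1) =ᶠ[𝓝 t] c' (x, v) :=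
      fun t ht ↦ Filter.mem_of_superset (isOpen_Ioo.mem_nhds ht) fun τ hτ ↦ hd τ hτ
    have h0 : (0 : ℝ) ∈ Ioo (-2 : ℝ) 2 := by simp
    refine ⟨?_, ?_, fun t ht ↦ ⟨?_, ?_⟩⟩
    · have := (hloc 0 h0).eq_of_nhds
      simpa [j1] using this
    · have := (j3 0 h0).1.congr_of_eventuallyEq (hloc 0 h0)
      rwa [j2] at this
    · rw [hd t ht]
      beta_reduce
      rw [hscale x hx' v hv t ht]
      exact (j3 t ht).2.2
    · rw [(hd2 t ht).deriv_eq, hd t ht]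
      beta_reduce
      rw [hscale x hx' v hv t ht]
      exact (j3 t ht).2.1.deriv

end Homogeneous

/-! ### Geodesics of a metric on an open subset of a vector space ("flat" refers to the domain, not
to curvature). -/

section FlatMetric

variable {E : Type*} [NormedAddCommGroup E] [NormedSpace ℝ E]

/-- `G` is a smooth Riemannian metric on the open set `O` of a vector space. -/
structure IsFlatMetricOn (G : E → E →L[ℝ] E →L[ℝ] ℝ) (O : Set E) : Prop where
  isOpen : IsOpen O
  contDiffOn : ContDiffOn ℝ ∞ G O
  symm : ∀ y ∈ O, ∀ u v, G y u v = G y v u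
  pos : ∀ y ∈ O, ∀ u, u ≠ 0 → 0 < G y u u

/-- The Christoffel symbol of the first kind of `G`. -/
noncomputable def flatChristoffel (G : E → E →L[ℝ] E →L[ℝ] ℝ) (y u v w : E) : ℝ :=
  (fderiv ℝ G y u v w + fderiv ℝ G y v u w - fderiv ℝ G y w u v) / 2

/-- The covector `w ↦ Γ(v, v; w)`. -/
noncomputable def christoffelCovector (G : E → E →L[ℝ] E →L[ℝ] ℝ) (p : E × E) : E →L[ℝ] ℝ :=
  fderiv ℝ G p.1 p.2 p.2 - (1 / 2 : ℝ) • ((fderiv ℝ G p.1).flip p.2).flip p.2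

lemma christoffelCovector_apply (G : E → E →L[ℝ] E →L[ℝ] ℝ) (y v w : E) :
    christoffelCovector G (y, v) w = flatChristoffel G y v v w := by
  simp [christoffelCovector, flatChristoffel]
  ring

/-- The acceleration of a geodesic with position `p.1` and velocity `p.2`. -/
noncomputable def geodesicAcceleration (G : E → E →L[ℝ] E →L[ℝ] ℝ) (p : E × E) : E :=
  -(G p.1).inverse (christoffelCovector G p)

/-- The Christoffel covector is quadratic in the velocity and raising the index is linear. This is
the homogeneity behind the rescaling of geodesics. -/
lemma geodesicAcceleration_smul (G : E → E →L[ℝ] E →L[ℝ] ℝ) (x v : E) (τ : ℝ) :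
    geodesicAcceleration G (x, τ • v) = τ ^ 2 • geodesicAcceleration G (x, v) := by
  have : christoffelCovector G (x, τ • v) = τ ^ 2 • christoffelCovector G (x, v) := by
    ext w
    simp [christoffelCovector]
    ring
  simp only [geodesicAcceleration, this, map_smul, smul_neg]

variable {G : E → E →L[ℝ] E →L[ℝ] ℝ} {O : Set E}

namespace IsFlatMetricOn

lemma contDiffOn_fderiv (hG : IsFlatMetricOn G O) : ContDiffOn ℝ ∞ (fderiv ℝ G) O :=
  hG.contDiffOn.fderiv_of_isOpen hG.isOpen (by simp)

variable [FiniteDimensional ℝ E]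

lemma isInvertible (hG : IsFlatMetricOn G O) {y : E} (hy : y ∈ O) : (G y).IsInvertible := by
  have hinj : Function.Injective (G y) := by
    rw [injective_iff_map_eq_zero]
    intro u hu
    by_contra hne
    have := hG.pos y hy u hne
    simp [hu] at this
  have hfin : Module.finrank ℝ E = Module.finrank ℝ (E →L[ℝ] ℝ) := by
    rw [← (LinearMap.toContinuousLinearMap (𝕜 := ℝ) (E := E) (F' := ℝ)).finrank_eq]
    exact (Subspace.dual_finrank_eq (K := ℝ) (V := E)).symm
  refine ⟨(LinearEquiv.ofInjectiveOfFinrankEq (G y : E →ₗ[ℝ] E →L[ℝ] ℝ) hinj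
    hfin).toContinuousLinearEquiv, ?_⟩
  ext u w
  rfl

/-- A positive definite form in finite dimension is invertible, so the equation with lowered index
can be solved for the acceleration. -/
lemma eq_geodesicAcceleration_iff (hG : IsFlatMetricOn G O) {y : E} (hy : y ∈ O) (v a : E) :
    (∀ w, G y a w + flatChristoffel G y v v w = 0) ↔ a = geodesicAcceleration G (y, v) := by
  obtain ⟨e, he⟩ := hG.isInvertible hy
  rw [geodesicAcceleration, ← he, ContinuousLinearMap.inverse_equiv, eq_neg_iff_add_eq_zero]
  simp only [← christoffelCovector_apply]
  constructor
  · intro h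
    apply e.injective
    ext w
    simpa using h w
  · intro h w
    have := congrArg (fun z ↦ e z w) h
    simpa using this

lemma contDiffOn_geodesicAcceleration (hG : IsFlatMetricOn G O) :
    ContDiffOn ℝ ∞ (geodesicAcceleration G) (O ×ˢ univ) := by
  have hfst : ContDiffOn ℝ ∞ (Prod.fst : E × E → E) (O ×ˢ univ) := contDiffOn_fst
  have hsnd : ContDiffOn ℝ ∞ (Prod.snd : E × E → E) (O ×ˢ univ) := contDiffOn_snd
  have hmaps : MapsTo (Prod.fst : E × E → E) (O ×ˢ univ) O := fun p hp ↦ hp.1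
  have hd : ContDiffOn ℝ ∞ (fun p : E × E ↦ fderiv ℝ G p.1) (O ×ˢ univ) :=
    hG.contDiffOn_fderiv.comp hfst hmaps
  have hG' : ContDiffOn ℝ ∞ (fun p : E × E ↦ G p.1) (O ×ˢ univ) :=
    hG.contDiffOn.comp hfst hmaps
  have hcov : ContDiffOn ℝ ∞ (christoffelCovector G) (O ×ˢ univ) := by
    rw [contDiffOn_clm_apply]
    intro w
    have : (fun p ↦ christoffelCovector G p w) = fun p : E × E ↦
        fderiv ℝ G p.1 p.2 p.2 w - (1 / 2 : ℝ) * fderiv ℝ G p.1 w p.2 p.2 := by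
      ext p
      simp [christoffelCovector]
    rw [this]
    exact (((hd.clm_apply hsnd).clm_apply hsnd).clm_apply contDiffOn_const).sub
      (contDiffOn_const.mul (((hd.clm_apply contDiffOn_const).clm_apply hsnd).clm_apply hsnd))
  have hinv : ContDiffOn ℝ ∞ (fun p : E × E ↦ (G p.1).inverse) (O ×ˢ univ) := by
    intro p hp
    exact ContDiffAt.comp_contDiffWithinAt p
      ((hG.isInvertible hp.1).contDiffAt_map_inverse) (hG' p hp)
  exact (hinv.clm_apply hcov).neg

end IsFlatMetricOn

/-- `t ↦ X (x, t v)` is the geodesic in `O` with initial position `x` and initial velocity `v`, for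
`x` in the ball of radius `r` at `x₀` and `v` of norm less than `r`. -/
structure IsGeodesicFamily (G : E → E →L[ℝ] E →L[ℝ] ℝ) (O : Set E) (X : E × E → E) (x₀ : E)
    (r : ℝ) : Prop where
  pos : 0 < r
  contDiffOn : ContDiffOn ℝ ∞ X (ball x₀ r ×ˢ ball 0 (2 * r))
  apply_zero : ∀ x ∈ ball x₀ r, X (x, 0) = x
  hasDerivAt_zero : ∀ x ∈ ball x₀ r, ∀ v ∈ ball (0 : E) r,
    HasDerivAt (fun t : ℝ ↦ X (x, t • v)) v 0
  mem : ∀ x ∈ ball x₀ r, ∀ v ∈ ball (0 : E) r, ∀ t ∈ Ioo (-2 : ℝ) 2, X (x, t • v) ∈ O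
  acceleration : ∀ x ∈ ball x₀ r, ∀ v ∈ ball (0 : E) r, ∀ t ∈ Ioo (-2 : ℝ) 2,
    deriv (deriv (fun t : ℝ ↦ X (x, t • v))) t =
      geodesicAcceleration G (X (x, t • v), deriv (fun t : ℝ ↦ X (x, t • v)) t)

/-- Existence of geodesics of a metric on an open subset of a vector space. -/
theorem IsFlatMetricOn.exists_isGeodesicFamily [FiniteDimensional ℝ E] (hG : IsFlatMetricOn G O)
    {x₀ : E} (hx₀ : x₀ ∈ O) : ∃ (X : E × E → E) (r : ℝ), IsGeodesicFamily G O X x₀ r := by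
  obtain ⟨ε, hε, hεO⟩ := Metric.mem_nhds_iff.1 (hG.isOpen.mem_nhds hx₀)
  -- The existence theorem wants a globally smooth right-hand side, while the acceleration is smooth
  -- only over `O`. The cut-off depends on the position alone, hence preserves homogeneity, and
  -- equals `1` on the ball of radius `ε / 3`, to which the solutions are confined.
  let χ : ContDiffBump x₀ := ⟨ε / 3, ε / 2, by positivity, by linarith⟩
  let A : E × E → E := fun p ↦ χ p.1 • geodesicAcceleration G p
  have hA : ContDiff ℝ ∞ A := by
    rw [contDiff_iff_contDiffAt]
    intro p
    by_cases hp : p.1 ∈ ball x₀ ε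
    · have h1 : ContDiffAt ℝ ∞ (geodesicAcceleration G) p :=
        hG.contDiffOn_geodesicAcceleration.contDiffAt
          ((hG.isOpen.prod isOpen_univ).mem_nhds ⟨hεO hp, mem_univ _⟩)
      exact (χ.contDiff.contDiffAt.comp p contDiffAt_fst).smul h1
    · have : A =ᶠ[𝓝 p] fun _ ↦ 0 := by
        have ho : IsOpen ((Prod.fst : E × E → E) ⁻¹' (closedBall x₀ (ε / 2))ᶜ) :=
          isClosed_closedBall.isOpen_compl.preimage continuous_fst
        have hm : p ∈ (Prod.fst : E × E → E) ⁻¹' (closedBall x₀ (ε / 2))ᶜ := by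
          simp only [mem_preimage, mem_compl_iff, mem_closedBall, not_le]
          rw [mem_ball, not_lt] at hp
          linarith
        filter_upwards [ho.mem_nhds hm] with q hq
        have : χ q.1 = 0 := χ.zero_of_le_dist (by
          simp only [mem_preimage, mem_compl_iff, mem_closedBall, not_le] at hq
          exact hq.le)
        simp [A, this]
      exact contDiffAt_const.congr_of_eventuallyEq this
  have hhom : ∀ x v (τ : ℝ), A (x, τ • v) = τ ^ 2 • A (x, v) := by
    intro x v τ
    simp only [A, geodesicAcceleration_smul]
    rw [smul_comm]
  have hUn : (ball x₀ (ε / 3)) ×ˢ (univ : Set E) ∈ 𝓝 (x₀, (0 : E)) :=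
    prod_mem_nhds (ball_mem_nhds _ (by positivity)) Filter.univ_mem
  obtain ⟨X, r, hr, hX, H⟩ := exists_homogeneous_solution_family A hA hhom x₀ hUn
  refine ⟨X, r, hr, hX, fun x hx ↦ (H x hx 0 (mem_ball_self hr)).1,
    fun x hx v hv ↦ (H x hx v hv).2.1, fun x hx v hv t ht ↦ ?_, fun x hx v hv t ht ↦ ?_⟩
  · exact hεO (ball_subset_ball (by linarith) (((H x hx v hv).2.2 t ht).1.1))
  · obtain ⟨⟨h5, -⟩, h6⟩ := (H x hx v hv).2.2 t ht
    rw [h6]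
    have : χ (X (x, t • v)) = 1 := χ.one_of_mem_closedBall (ball_subset_closedBall h5)
    simp only [A, this, one_smul]

end FlatMetric

/-- Derivative of a family of linear maps applied to a vector, along a curve. -/
lemma HasFDerivAt.hasDerivAt_apply {F F' F'' : Type*} [NormedAddCommGroup F] [NormedSpace ℝ F]
    [NormedAddCommGroup F'] [NormedSpace ℝ F'] [NormedAddCommGroup F''] [NormedSpace ℝ F'']
    {L : F → F' →L[ℝ] F''} {L' : F →L[ℝ] F' →L[ℝ] F''} {p : ℝ → F} {p' : F} {w : ℝ → F'} {w' : F'}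
    {t : ℝ} {q : F} (hL : HasFDerivAt L L' q) (hp : HasDerivAt p p' t) (hq : p t = q)
    (hw : HasDerivAt w w' t) :
    HasDerivAt (fun s ↦ L (p s) (w s)) (L' p' (w t) + L q w') t := by
  subst hq
  exact (hL.comp_hasDerivAt t hp).clm_apply hw

/-! ### Constant speed and the Gauss lemma. -/

section FlatGauss

variable {E : Type*} [NormedAddCommGroup E] [NormedSpace ℝ E]
  {G : E → E →L[ℝ] E →L[ℝ] ℝ} {O : Set E} {X : E × E → E} {x₀ : E} {r : ℝ}

/-- Derivative of an inner product along a curve. -/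
lemma IsFlatMetricOn.hasDerivAt_inner (hG : IsFlatMetricOn G O) {c u w : ℝ → E} {c' u' w' : E}
    {t : ℝ} (hct : c t ∈ O) (hc : HasDerivAt c c' t) (hu : HasDerivAt u u' t)
    (hw : HasDerivAt w w' t) :
    HasDerivAt (fun s ↦ G (c s) (u s) (w s))
      (fderiv ℝ G (c t) c' (u t) (w t) + G (c t) u' (w t) + G (c t) (u t) w') t := by
  have hGd : HasFDerivAt G (fderiv ℝ G (c t)) (c t) :=
    ((hG.contDiffOn.differentiableOn (by simp)).differentiableAt
      (hG.isOpen.mem_nhds hct)).hasFDerivAt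
  have := ((hGd.comp_hasDerivAt t hc).clm_apply hu).clm_apply hw
  simpa using this

namespace IsGeodesicFamily

lemma smul_mem {v : E} (hv : v ∈ ball (0 : E) r) {t : ℝ} (ht : t ∈ Ioo (-2 : ℝ) 2) :
    t • v ∈ ball (0 : E) (2 * r) := by
  rw [mem_ball_zero_iff] at hv ⊢
  rw [norm_smul, Real.norm_eq_abs]
  have := abs_lt.2 ht
  nlinarith [norm_nonneg v, abs_nonneg t]

lemma contDiffAt (hX : IsGeodesicFamily G O X x₀ r) {x v : E} (hx : x ∈ ball x₀ r)
    (hv : v ∈ ball (0 : E) (2 * r)) : ContDiffAt ℝ ∞ X (x, v) :=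
  hX.contDiffOn.contDiffAt ((isOpen_ball.prod isOpen_ball).mem_nhds ⟨hx, hv⟩)

lemma hasFDerivAt (hX : IsGeodesicFamily G O X x₀ r) {x v : E} (hx : x ∈ ball x₀ r)
    (hv : v ∈ ball (0 : E) (2 * r)) : HasFDerivAt X (fderiv ℝ X (x, v)) (x, v) :=
  ((hX.contDiffAt hx hv).differentiableAt (by simp)).hasFDerivAt

lemma hasFDerivAt_fderiv (hX : IsGeodesicFamily G O X x₀ r) {x v : E} (hx : x ∈ ball x₀ r)
    (hv : v ∈ ball (0 : E) (2 * r)) :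
    HasFDerivAt (fderiv ℝ X) (fderiv ℝ (fderiv ℝ X) (x, v)) (x, v) :=
  (((hX.contDiffAt hx hv).fderiv_right (m := 1)
    (by rw [one_add_one_eq_two]; exact ENat.LEInfty.out)).differentiableAt
    (by simp)).hasFDerivAt

lemma hasDerivAt (hX : IsGeodesicFamily G O X x₀ r) {x v : E} (hx : x ∈ ball x₀ r)
    (hv : v ∈ ball (0 : E) r) {t : ℝ} (ht : t ∈ Ioo (-2 : ℝ) 2) :
    HasDerivAt (fun t : ℝ ↦ X (x, t • v)) (fderiv ℝ X (x, t • v) (0, v)) t := by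
  have h1 : HasDerivAt (fun t : ℝ ↦ (x, t • v)) ((0 : E), v) t := by
    simpa using (hasDerivAt_const t x).prodMk ((hasDerivAt_id t).smul_const v)
  exact (hX.hasFDerivAt hx (smul_mem hv ht)).comp_hasDerivAt t h1

lemma hasDerivAt_velocity (hX : IsGeodesicFamily G O X x₀ r) {x v : E} (hx : x ∈ ball x₀ r)
    (hv : v ∈ ball (0 : E) r) {t : ℝ} (ht : t ∈ Ioo (-2 : ℝ) 2) :
    HasDerivAt (fun t : ℝ ↦ fderiv ℝ X (x, t • v) (0, v))
      (geodesicAcceleration G (X (x, t • v), fderiv ℝ X (x, t • v) (0, v))) t := by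
  have h1 : HasDerivAt (fun t : ℝ ↦ (x, t • v)) ((0 : E), v) t := by
    simpa using (hasDerivAt_const t x).prodMk ((hasDerivAt_id t).smul_const v)
  have h2 := (hX.hasFDerivAt_fderiv hx (smul_mem hv ht)).hasDerivAt_apply h1 rfl
    (hasDerivAt_const t ((0 : E), v))
  have h3 : deriv (fun t : ℝ ↦ X (x, t • v)) =ᶠ[𝓝 t] fun t ↦ fderiv ℝ X (x, t • v) (0, v) := by
    filter_upwards [isOpen_Ioo.mem_nhds ht] with s hs using (hX.hasDerivAt hx hv hs).deriv
  have h4 := hX.acceleration x hx v hv t ht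
  rw [h3.deriv_eq, h3.eq_of_nhds] at h4
  rw [← h4]
  exact h2.differentiableAt.hasDerivAt

/-- Geodesics have constant speed. -/
lemma energy [FiniteDimensional ℝ E] (hX : IsGeodesicFamily G O X x₀ r) (hG : IsFlatMetricOn G O) {x v : E}
    (hx : x ∈ ball x₀ r) (hv : v ∈ ball (0 : E) r) {t : ℝ} (ht : t ∈ Ioo (-2 : ℝ) 2) :
    G (X (x, t • v)) (fderiv ℝ X (x, t • v) (0, v)) (fderiv ℝ X (x, t • v) (0, v)) = G x v v := by
  have hd : ∀ s ∈ Ioo (-2 : ℝ) 2, HasDerivAt (fun t : ℝ ↦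
      G (X (x, t • v)) (fderiv ℝ X (x, t • v) (0, v)) (fderiv ℝ X (x, t • v) (0, v))) 0 s := by
    intro s hs
    have hO := hX.mem x hx v hv s hs
    have hv' := hX.hasDerivAt_velocity hx hv hs
    have h1 := hG.hasDerivAt_inner hO (hX.hasDerivAt hx hv hs) hv' hv'
    convert h1 using 1
    -- Tested against the velocity, the geodesic equation says that half the derivative of the
    -- energy vanishes.
    have h2 := (hG.eq_geodesicAcceleration_iff hO (fderiv ℝ X (x, s • v) (0, v)) _).2 rfl
      (fderiv ℝ X (x, s • v) (0, v))
    have h3 := hG.symm _ hO (fderiv ℝ X (x, s • v) (0, v))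
      (geodesicAcceleration G (X (x, s • v), fderiv ℝ X (x, s • v) (0, v)))
    rw [flatChristoffel] at h2
    linarith
  have h0 : (0 : ℝ) ∈ Ioo (-2 : ℝ) 2 := by simp
  have key := (convex_Ioo (-2 : ℝ) 2).is_const_of_fderivWithin_eq_zero (𝕜 := ℝ)
    (fun s hs ↦ (hd s hs).differentiableAt.differentiableWithinAt)
    (fun s hs ↦ by
      rw [fderivWithin_of_isOpen isOpen_Ioo hs, (hd s hs).hasFDerivAt.fderiv]
      ext; simp) ht h0
  have h5 : fderiv ℝ X (x, (0 : ℝ) • v) (0, v) = v :=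
    (hX.hasDerivAt hx hv h0).unique (hX.hasDerivAt_zero x hx v hv)
  simp only [h5] at key
  rw [key, zero_smul, hX.apply_zero x hx]

/-- The derivative of the geodesic family at zero velocity. -/
lemma fderiv_zero (hX : IsGeodesicFamily G O X x₀ r) {x : E} (hx : x ∈ ball x₀ r) (a b : E) :
    fderiv ℝ X (x, 0) (a, b) = a + b := by
  have h2r : (0 : E) ∈ ball (0 : E) (2 * r) := by simpa using hX.pos
  have hX0 := hX.hasFDerivAt hx h2r
  have h1 : fderiv ℝ X (x, 0) (a, 0) = a := by
    have hc : HasFDerivAt (fun y : E ↦ (y, (0 : E))) (ContinuousLinearMap.inl ℝ E E) x :=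
      (ContinuousLinearMap.inl ℝ E E).hasFDerivAt
    have h2 : HasFDerivAt (fun y : E ↦ y) (fderiv ℝ X (x, 0) ∘L ContinuousLinearMap.inl ℝ E E) x :=
      (hX0.comp x hc).congr_of_eventuallyEq (by
        filter_upwards [isOpen_ball.mem_nhds hx] with y hy using (hX.apply_zero y hy).symm)
    simpa using congrArg (fun L : E →L[ℝ] E ↦ L a) (h2.unique (hasFDerivAt_id x))
  have h2 : ∀ b ∈ ball (0 : E) r, fderiv ℝ X (x, 0) (0, b) = b := by
    intro b hb
    have := (hX.hasDerivAt hx hb (t := 0) (by simp)).unique (hX.hasDerivAt_zero x hx b hb)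
    simpa using this
  have h3 : fderiv ℝ X (x, 0) (0, b) = b := by
    -- The identity is known for small `b` only; a linear map that agrees with the identity near `0`
    -- is the identity.
    have h4 : fderiv ℝ X (x, 0) ∘L ContinuousLinearMap.inr ℝ E E = ContinuousLinearMap.id ℝ E := by
      have h5 : HasFDerivAt (fderiv ℝ X (x, 0) ∘L ContinuousLinearMap.inr ℝ E E)
          (ContinuousLinearMap.id ℝ E) 0 :=
        (hasFDerivAt_id (0 : E)).congr_of_eventuallyEq (by
          filter_upwards [ball_mem_nhds (0 : E) hX.pos] with y hy using h2 y hy)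
      exact (ContinuousLinearMap.hasFDerivAt _).unique h5
    exact congrArg (fun L : E →L[ℝ] E ↦ L b) h4
  rw [show ((a, b) : E × E) = (a, 0) + (0, b) by simp, map_add, h1, h3]

/-- The Gauss lemma: the inner product of the endpoint velocity of a geodesic with the endpoint
variation in the direction `(a, b)`. -/
theorem gauss [FiniteDimensional ℝ E] (hX : IsGeodesicFamily G O X x₀ r) (hG : IsFlatMetricOn G O) {x v : E}
    (hx : x ∈ ball x₀ r) (hv : v ∈ ball (0 : E) r) (a b : E) :
    G (X (x, v)) (fderiv ℝ X (x, v) (0, v)) (fderiv ℝ X (x, v) (a, b)) =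
      G x v a + (fderiv ℝ G x a v v / 2 + G x v b) := by
  -- `κ` is half the derivative at `s = 0` of the initial energy `G(x + s a)(v + s b, v + s b)`. The
  -- product of velocity and variation field is affine in `t` with slope `κ`: by the geodesic
  -- equation and the symmetry of second derivatives its derivative is half the variation of the
  -- energy, which is constant in time. Evaluation at `0` and `1` then gives the claim.
  set κ := fderiv ℝ G x a v v / 2 + G x v b with hκ
  have hd : ∀ τ ∈ Ioo (-2 : ℝ) 2, HasDerivAt (fun t : ℝ ↦
      G (X (x, t • v)) (fderiv ℝ X (x, t • v) (0, v)) (fderiv ℝ X (x, t • v) (a, t • b)) - t * κ)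
      0 τ := by
    intro τ hτ
    have hO := hX.mem x hx v hv τ hτ
    have hτv := smul_mem hv hτ
    set D := fderiv ℝ X (x, τ • v) with hD
    set D2 := fderiv ℝ (fderiv ℝ X) (x, τ • v) with hD2
    have hsymm : D2 (0, v) (a, τ • b) = D2 (a, τ • b) (0, v) :=
      ((hX.contDiffAt hx hτv).isSymmSndFDerivAt (by simpa using ENat.LEInfty.out)) _ _
    -- the variation field along the geodesic
    have hY : HasDerivAt (fun t : ℝ ↦ fderiv ℝ X (x, t • v) (a, t • b))
        (D2 (0, v) (a, τ • b) + D (0, b)) τ := by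
      have h1 : HasDerivAt (fun t : ℝ ↦ (x, t • v)) ((0 : E), v) τ := by
        simpa using (hasDerivAt_const τ x).prodMk ((hasDerivAt_id τ).smul_const v)
      have h2 : HasDerivAt (fun t : ℝ ↦ (a, t • b)) ((0 : E), b) τ := by
        simpa using (hasDerivAt_const τ a).prodMk ((hasDerivAt_id τ).smul_const b)
      exact (hX.hasFDerivAt_fderiv hx hτv).hasDerivAt_apply h1 rfl h2
    -- the derivative of the energy in the direction of the variation
    have hvar : fderiv ℝ G (X (x, τ • v)) (D (a, τ • b)) (D (0, v)) (D (0, v)) +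
        2 * G (X (x, τ • v)) (D (0, v)) (D2 (a, τ • b) (0, v) + D (0, b)) = 2 * κ := by
      have h1 : HasDerivAt (fun s : ℝ ↦ (x + s • a, τ • (v + s • b))) (a, τ • b) 0 := by
        have e1 : HasDerivAt (fun s : ℝ ↦ x + s • a) a 0 := by
          simpa using ((hasDerivAt_id (0 : ℝ)).smul_const a).const_add x
        have e2 : HasDerivAt (fun s : ℝ ↦ τ • (v + s • b)) (τ • b) 0 := by
          simpa using (((hasDerivAt_id (0 : ℝ)).smul_const b).const_add v).fun_const_smul τ
        exact e1.prodMk e2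
      have h2 : HasDerivAt (fun s : ℝ ↦ ((0 : E), v + s • b)) (0, b) 0 := by
        have e2 : HasDerivAt (fun s : ℝ ↦ v + s • b) b 0 := by
          simpa using ((hasDerivAt_id (0 : ℝ)).smul_const b).const_add v
        exact (hasDerivAt_const (0 : ℝ) (0 : E)).prodMk e2
      have hp : (x + (0 : ℝ) • a, τ • (v + (0 : ℝ) • b)) = (x, τ • v) := by simp
      have h3 : HasDerivAt (fun s : ℝ ↦ X (x + s • a, τ • (v + s • b))) (D (a, τ • b)) 0 := by
        have := hX.hasFDerivAt hx hτv
        rw [← hp] at this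
        have := this.comp_hasDerivAt (0 : ℝ) h1
        rwa [hp] at this
      have h4 : HasDerivAt (fun s : ℝ ↦ fderiv ℝ X (x + s • a, τ • (v + s • b)) (0, v + s • b))
          (D2 (a, τ • b) (0, v) + D (0, b)) 0 := by
        have := (hX.hasFDerivAt_fderiv hx hτv).hasDerivAt_apply h1 hp h2
        simpa only [zero_smul, add_zero] using this
      have h5 := hG.hasDerivAt_inner (t := 0) (by simpa using hO) h3 h4 h4
      simp only [zero_smul, add_zero] at h5
      have h6 : HasDerivAt (fun s : ℝ ↦ G (x + s • a) (v + s • b) (v + s • b))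
          (fderiv ℝ G x a v v + G x b v + G x v b) 0 := by
        have e1 : HasDerivAt (fun s : ℝ ↦ x + s • a) a 0 := by
          simpa using ((hasDerivAt_id (0 : ℝ)).smul_const a).const_add x
        have e2 : HasDerivAt (fun s : ℝ ↦ v + s • b) b 0 := by
          simpa using ((hasDerivAt_id (0 : ℝ)).smul_const b).const_add v
        have hxO : x ∈ O := by
          have := hX.mem x hx v hv 0 (by simp)
          rwa [zero_smul, hX.apply_zero x hx] at this
        simpa using hG.hasDerivAt_inner (t := 0) (by simpa using hxO) e1 e2 e2
      have hev : ∀ᶠ s in 𝓝 (0 : ℝ), x + s • a ∈ ball x₀ r ∧ v + s • b ∈ ball (0 : E) r := by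
        have c1 : ContinuousAt (fun s : ℝ ↦ x + s • a) 0 := by fun_prop
        have c2 : ContinuousAt (fun s : ℝ ↦ v + s • b) 0 := by fun_prop
        exact (c1.eventually_mem (by simpa using isOpen_ball.mem_nhds hx)).and
          (c2.eventually_mem (by simpa using isOpen_ball.mem_nhds hv))
      -- Constancy of speed for the neighbouring geodesics replaces the energy at time `τ` by the
      -- initial energy.
      have h7 := h5.congr_of_eventuallyEq (f₁ := fun s : ℝ ↦ G (x + s • a) (v + s • b) (v + s • b))
        (by filter_upwards [hev] with s hs using (hX.energy hG hs.1 hs.2 hτ).symm)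
      have h8 := h7.unique h6
      have hxO : x ∈ O := by
        have := hX.mem x hx v hv 0 (by simp)
        rwa [zero_smul, hX.apply_zero x hx] at this
      have s1 := hG.symm x hxO b v
      have s2 := hG.symm _ hO (D (0, v)) (D2 (a, τ • b) (0, v) + D (0, b))
      rw [hκ]
      linarith
    have h1 := (hG.hasDerivAt_inner hO (hX.hasDerivAt hx hv hτ) (hX.hasDerivAt_velocity hx hv hτ)
      hY).sub ((hasDerivAt_id τ).mul_const κ)
    refine h1.congr_deriv ?_
    have h2 := (hG.eq_geodesicAcceleration_iff hO (D (0, v)) _).2 rfl (D (a, τ • b))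
    rw [flatChristoffel] at h2
    rw [← hsymm] at hvar
    linarith
  have key := (convex_Ioo (-2 : ℝ) 2).is_const_of_fderivWithin_eq_zero (𝕜 := ℝ)
    (fun s hs ↦ (hd s hs).differentiableAt.differentiableWithinAt)
    (fun s hs ↦ by
      rw [fderivWithin_of_isOpen isOpen_Ioo hs, (hd s hs).hasFDerivAt.fderiv]
      ext; simp) (x := 1) (y := 0) (by norm_num) (by simp)
  simp only [one_smul, zero_smul, one_mul, zero_mul, sub_zero, hX.fderiv_zero hx, zero_add,
    add_zero, hX.apply_zero x hx] at key
  linarith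

end IsGeodesicFamily

end FlatGauss

/-- Inner products of smooth sections along a map are smooth, for a bundle with a smooth metric. -/
lemma ContMDiffOn.inner_riemannianBundle
    {EB : Type*} [NormedAddCommGroup EB] [NormedSpace ℝ EB]
    {HB : Type*} [TopologicalSpace HB] {IB : ModelWithCorners ℝ EB HB} {n : WithTop ℕ∞}
    {B : Type*} [TopologicalSpace B] [ChartedSpace HB B]
    {F : Type*} [NormedAddCommGroup F] [NormedSpace ℝ F]
    {E : B → Type*} [TopologicalSpace (TotalSpace F E)] [∀ b, TopologicalSpace (E b)]
    [∀ b, AddCommGroup (E b)] [∀ b, Module ℝ (E b)] [∀ b, IsTopologicalAddGroup (E b)]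
    [∀ b, ContinuousConstSMul ℝ (E b)] [FiberBundle F E] [VectorBundle ℝ F E]
    [RiemannianBundle E] [IsContMDiffRiemannianBundle IB n F E]
    {EM : Type*} [NormedAddCommGroup EM] [NormedSpace ℝ EM]
    {HM : Type*} [TopologicalSpace HM] {IM : ModelWithCorners ℝ EM HM}
    {M : Type*} [TopologicalSpace M] [ChartedSpace HM M] {b : M → B} {v w : ∀ x, E (b x)}
    {s : Set M} (hv : ContMDiffOn IM (IB.prod 𝓘(ℝ, F)) n (fun m ↦ (v m : TotalSpace F E)) s)
    (hw : ContMDiffOn IM (IB.prod 𝓘(ℝ, F)) n (fun m ↦ (w m : TotalSpace F E)) s) :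
    ContMDiffOn IM 𝓘(ℝ) n (fun m ↦ inner ℝ (v m) (w m)) s :=
  hv.inner_bundle hw

/-! ### Invariance of the geodesic equation under changes of coordinates. -/

section ChangeOfCoordinates

variable {E : Type*} [NormedAddCommGroup E] [NormedSpace ℝ E]

/-- The derivative of the pullback of a metric by a smooth map. -/
lemma fderiv_pullback_metric {G G' : E → E →L[ℝ] E →L[ℝ] ℝ} {φ : E → E} {y : E}
    (hφ : ContDiffAt ℝ ∞ φ y) (hG' : DifferentiableAt ℝ G' (φ y)) (hG : DifferentiableAt ℝ G y)
    (h : ∀ᶠ z in 𝓝 y, ∀ u w, G z u w = G' (φ z) (fderiv ℝ φ z u) (fderiv ℝ φ z w)) (d u w : E) :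
    fderiv ℝ G y d u w =
      fderiv ℝ G' (φ y) (fderiv ℝ φ y d) (fderiv ℝ φ y u) (fderiv ℝ φ y w) +
        G' (φ y) (fderiv ℝ (fderiv ℝ φ) y d u) (fderiv ℝ φ y w) +
        G' (φ y) (fderiv ℝ φ y u) (fderiv ℝ (fderiv ℝ φ) y d w) := by
  have hl : HasDerivAt (fun s : ℝ ↦ y + s • d) d 0 := by
    simpa using ((hasDerivAt_id (0 : ℝ)).smul_const d).const_add y
  have hy : y + (0 : ℝ) • d = y := by simp
  have h1 : HasDerivAt (fun s : ℝ ↦ G (y + s • d) u w) (fderiv ℝ G y d u w) 0 := by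
    have := (hG.hasFDerivAt.hasDerivAt_apply hl hy (hasDerivAt_const (0 : ℝ) u)).clm_apply
      (hasDerivAt_const (0 : ℝ) w)
    simpa using this
  have hφd : HasFDerivAt φ (fderiv ℝ φ y) y := (hφ.differentiableAt (by simp)).hasFDerivAt
  have hφd2 : HasFDerivAt (fderiv ℝ φ) (fderiv ℝ (fderiv ℝ φ) y) y :=
    ((hφ.fderiv_right (m := 1) (by rw [one_add_one_eq_two]; exact ENat.LEInfty.out)).differentiableAt
      (by simp)).hasFDerivAt
  have hD : ∀ u, HasDerivAt (fun s : ℝ ↦ fderiv ℝ φ (y + s • d) u)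
      (fderiv ℝ (fderiv ℝ φ) y d u) 0 := by
    intro u
    simpa using hφd2.hasDerivAt_apply hl hy (hasDerivAt_const (0 : ℝ) u)
  have hφl : HasDerivAt (fun s : ℝ ↦ φ (y + s • d)) (fderiv ℝ φ y d) 0 := by
    rw [← hy] at hφd
    have := hφd.comp_hasDerivAt (0 : ℝ) hl
    rwa [hy] at this
  have h2 := (hG'.hasFDerivAt.hasDerivAt_apply hφl (by simp) (hD u)).clm_apply (hD w)
  have h3 : (fun s : ℝ ↦ G (y + s • d) u w) =ᶠ[𝓝 0] fun s ↦
      G' (φ (y + s • d)) (fderiv ℝ φ (y + s • d) u) (fderiv ℝ φ (y + s • d) w) := by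
    have hc : Filter.Tendsto (fun s : ℝ ↦ y + s • d) (𝓝 0) (𝓝 y) := by
      simpa [ContinuousAt] using hl.continuousAt
    exact (hc.eventually h).mono fun s hs ↦ hs u w
  have := h1.unique (h2.congr_of_eventuallyEq h3)
  simpa [hy] using this

/-- Invariance of the (lowered) geodesic equation under changes of coordinates. -/
lemma geodesic_equation_pullback {G G' : E → E →L[ℝ] E →L[ℝ] ℝ} {φ : E → E} {y : E}
    (hφ : ContDiffAt ℝ ∞ φ y) (hG' : DifferentiableAt ℝ G' (φ y)) (hG : DifferentiableAt ℝ G y)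
    (hsymm : ∀ u w, G' (φ y) u w = G' (φ y) w u)
    (h : ∀ᶠ z in 𝓝 y, ∀ u w, G z u w = G' (φ z) (fderiv ℝ φ z u) (fderiv ℝ φ z w)) (v a w : E) :
    G' (φ y) (fderiv ℝ (fderiv ℝ φ) y v v + fderiv ℝ φ y a) (fderiv ℝ φ y w) +
        flatChristoffel G' (φ y) (fderiv ℝ φ y v) (fderiv ℝ φ y v) (fderiv ℝ φ y w) =
      G y a w + flatChristoffel G y v v w := by
  have hs : fderiv ℝ (fderiv ℝ φ) y v w = fderiv ℝ (fderiv ℝ φ) y w v :=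
    (hφ.isSymmSndFDerivAt (by simpa using ENat.LEInfty.out)) _ _
  -- The product rule produces second derivatives of `φ`. Their symmetry and that of `G'` cancel all
  -- of them except `G'(D²φ(v, v), Dφ w)`, which belongs to the transformed acceleration.
  simp only [flatChristoffel, fderiv_pullback_metric hφ hG' hG h, h.self_of_nhds a w, map_add,
    add_apply, hs]
  rw [hsymm (fderiv ℝ (fderiv ℝ φ) y w v) (fderiv ℝ φ y v)]
  ring

end ChangeOfCoordinates

/-! ### The Riemannian metric in charts. -/

section ChartMetric

variable {E : Type*} [NormedAddCommGroup E] [NormedSpace ℝ E]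
  {M : Type*} [TopologicalSpace M] [ChartedSpace E M]
  [RiemannianBundle (fun x : M ↦ TangentSpace 𝓘(ℝ, E) x)]

/-- The metric in a chart, as a family of continuous bilinear forms. -/
noncomputable def chartMetric (e : OpenPartialHomeomorph M E) (y : E) : E →L[ℝ] E →L[ℝ] ℝ :=
  (innerSL ℝ : TangentSpace 𝓘(ℝ, E) (e.symm y) →L[ℝ]
      TangentSpace 𝓘(ℝ, E) (e.symm y) →L[ℝ] ℝ).bilinearComp
    (mfderiv 𝓘(ℝ, E) 𝓘(ℝ, E) e.symm y : E →L[ℝ] TangentSpace 𝓘(ℝ, E) (e.symm y))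
    (mfderiv 𝓘(ℝ, E) 𝓘(ℝ, E) e.symm y : E →L[ℝ] TangentSpace 𝓘(ℝ, E) (e.symm y))

lemma chartMetric_apply (e : OpenPartialHomeomorph M E) (y u w : E) :
    chartMetric e y u w = coordMetric e y u w := rfl

variable [IsManifold 𝓘(ℝ, E) ∞ M]

section Atlas

variable {e e' : OpenPartialHomeomorph M E}

omit [RiemannianBundle (fun x : M ↦ TangentSpace 𝓘(ℝ, E) x)]

lemma mfderiv_chart_mfderiv_symm (he : e ∈ atlas E M) {y : E} (hy : y ∈ e.target) (u : E) :
    mfderiv 𝓘(ℝ, E) 𝓘(ℝ, E) e (e.symm y) (mfderiv 𝓘(ℝ, E) 𝓘(ℝ, E) e.symm y u) = u :=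
  congrArg (fun L : E →L[ℝ] E ↦ L u)
    ((mdifferentiable_of_mem_atlas (I := 𝓘(ℝ, E)) he).comp_symm_deriv hy)

lemma mfderiv_symm_mfderiv_chart (he : e ∈ atlas E M) {p : M} (hp : p ∈ e.source)
    (u : TangentSpace 𝓘(ℝ, E) p) :
    mfderiv 𝓘(ℝ, E) 𝓘(ℝ, E) e.symm (e p) (mfderiv 𝓘(ℝ, E) 𝓘(ℝ, E) e p u) = u :=
  congrArg (fun L : TangentSpace 𝓘(ℝ, E) p →L[ℝ] TangentSpace 𝓘(ℝ, E) p ↦ L u)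
    ((mdifferentiable_of_mem_atlas (I := 𝓘(ℝ, E)) he).symm_comp_deriv hp)

lemma contDiffAt_chart_change (he : e ∈ atlas E M) (he' : e' ∈ atlas E M) {y : E}
    (hy : y ∈ e.target) (hy' : e.symm y ∈ e'.source) : ContDiffAt ℝ ∞ (e' ∘ e.symm) y := by
  have h1 := (contMDiffOn_symm_of_mem_maximalAtlas (n := ∞) (I := 𝓘(ℝ, E))
    (IsManifold.subset_maximalAtlas he)).contMDiffAt (e.open_target.mem_nhds hy)
  have h2 := (contMDiffOn_of_mem_maximalAtlas (n := ∞) (I := 𝓘(ℝ, E))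
    (IsManifold.subset_maximalAtlas he')).contMDiffAt (e'.open_source.mem_nhds hy')
  exact (h2.comp y h1).contDiffAt

lemma mfderiv_symm_eq (he : e ∈ atlas E M) (he' : e' ∈ atlas E M) {y : E}
    (hy : y ∈ e.target) (hy' : e.symm y ∈ e'.source) (u : E) :
    (mfderiv 𝓘(ℝ, E) 𝓘(ℝ, E) e.symm y u : E) =
      mfderiv 𝓘(ℝ, E) 𝓘(ℝ, E) e'.symm (e' (e.symm y)) (fderiv ℝ (e' ∘ e.symm) y u) := by
  have h1 := (mdifferentiable_of_mem_atlas (I := 𝓘(ℝ, E)) he).mdifferentiableAt_symm hy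
  have h2 := (mdifferentiable_of_mem_atlas (I := 𝓘(ℝ, E)) he').mdifferentiableAt hy'
  rw [← mfderiv_eq_fderiv, mfderiv_comp y h2 h1]
  exact (mfderiv_symm_mfderiv_chart he' hy' _).symm

end Atlas

variable [IsContMDiffRiemannianBundle 𝓘(ℝ, E) ∞ E (fun x : M ↦ TangentSpace 𝓘(ℝ, E) x)]

/-- A constant vector field on the chart's target is pushed forward to a smooth section of the
tangent bundle along `e.symm`, and a smooth bundle metric is smooth on smooth sections. -/
lemma contDiffOn_coordMetric {e : OpenPartialHomeomorph M E} (he : e ∈ atlas E M) (u w : E) :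
    ContDiffOn ℝ ∞ (fun y ↦ coordMetric e y u w) e.target := by
  have he' : e ∈ IsManifold.maximalAtlas 𝓘(ℝ, E) ∞ M := IsManifold.subset_maximalAtlas he
  have h1 := contMDiffOn_symm_of_mem_maximalAtlas he'
  have h2 : ∀ u : E, ContMDiffOn 𝓘(ℝ, E) 𝓘(ℝ, E).tangent ∞
    (fun y ↦ (⟨e.symm y, mfderiv 𝓘(ℝ, E) 𝓘(ℝ, E) e.symm y u⟩ : TangentBundle 𝓘(ℝ, E) M)) e.target := by
    intro u
    have h3 := h1.contMDiffOn_tangentMapWithin (m := ∞) (by simp) e.open_target.uniqueMDiffOn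
    have h4 : ContMDiff 𝓘(ℝ, E) 𝓘(ℝ, E).tangent ∞ (fun y ↦ (⟨y, u⟩ : TangentBundle 𝓘(ℝ, E) E)) := by
      exact contMDiff_vectorSpace_iff_contDiff.2 contDiff_const
    refine (h3.comp h4.contMDiffOn (fun y hy ↦ hy)).congr fun y hy ↦ ?_
    simp only [Function.comp_apply, tangentMapWithin, mfderivWithin_of_isOpen e.open_target hy]
  exact (ContMDiffOn.inner_riemannianBundle (F := E) (E := fun x : M ↦ TangentSpace 𝓘(ℝ, E) x) (b := e.symm)
    (v := fun y ↦ mfderiv 𝓘(ℝ, E) 𝓘(ℝ, E) e.symm y u) 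
    (w := fun y ↦ mfderiv 𝓘(ℝ, E) 𝓘(ℝ, E) e.symm y w) (h2 u) (h2 w)).contDiffOn

/-- The metric of a Riemannian manifold in a chart is a smooth metric on the chart's target. -/
lemma isFlatMetricOn_chartMetric [FiniteDimensional ℝ E] {e : OpenPartialHomeomorph M E}
    (he : e ∈ atlas E M) : IsFlatMetricOn (chartMetric e) e.target where
  isOpen := e.open_target
  contDiffOn := by
    rw [contDiffOn_clm_apply]
    intro u
    rw [contDiffOn_clm_apply]
    exact fun w ↦ contDiffOn_coordMetric he u w
  symm y _ u v := by
    rw [chartMetric_apply, chartMetric_apply, coordMetric, coordMetric]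
    exact real_inner_comm (F := TangentSpace 𝓘(ℝ, E) (e.symm y)) _ _
  pos y hy u hu := by
    rw [chartMetric_apply, coordMetric]
    refine real_inner_self_pos.2 fun h ↦ hu ?_
    have := mfderiv_chart_mfderiv_symm he hy u
    rw [← this]
    exact (congrArg (mfderiv 𝓘(ℝ, E) 𝓘(ℝ, E) e (e.symm y)) h).trans (map_zero _)

omit [IsContMDiffRiemannianBundle 𝓘(ℝ, E) ∞ E (fun x : M ↦ TangentSpace 𝓘(ℝ, E) x)] in
lemma chartMetric_change {e e' : OpenPartialHomeomorph M E} (he : e ∈ atlas E M)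
    (he' : e' ∈ atlas E M) {y : E} (hy : y ∈ e.target) (hy' : e.symm y ∈ e'.source) (u w : E) :
    chartMetric e y u w = chartMetric e' ((e' ∘ e.symm) y) (fderiv ℝ (e' ∘ e.symm) y u)
      (fderiv ℝ (e' ∘ e.symm) y w) := by
  simp only [chartMetric_apply, coordMetric]
  -- The base points `e'.symm (e' (e.symm y))` and `e.symm y` are only propositionally equal, so the
  -- point is generalized before the inner products are compared.
  have key : ∀ p : M, p = e.symm y → ∀ a b : E,
      @inner ℝ (TangentSpace 𝓘(ℝ, E) (e.symm y)) _ a b =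
        @inner ℝ (TangentSpace 𝓘(ℝ, E) p) _ a b := by
    rintro p rfl a b
    rfl
  have h1 := mfderiv_symm_eq he he' hy hy' u
  have h2 := mfderiv_symm_eq he he' hy hy' w
  refine (key (e'.symm ((e' ∘ e.symm) y)) (e'.left_inv hy') _ _).trans ?_
  rw [h1, h2]
  rfl

lemma christoffelFirst_eq [FiniteDimensional ℝ E] {e : OpenPartialHomeomorph M E}
    (he : e ∈ atlas E M) {y : E} (hy : y ∈ e.target) (u v w : E) :
    christoffelFirst e y u v w = flatChristoffel (chartMetric e) y u v w := by
  have h := (isFlatMetricOn_chartMetric he).contDiffOn.differentiableOn (by simp)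
  have hd := (h.differentiableAt (e.open_target.mem_nhds hy)).hasFDerivAt
  have key : ∀ a b c : E, fderiv ℝ (fun z ↦ coordMetric e z a b) y c =
      fderiv ℝ (chartMetric e) y c a b := by
    intro a b c
    have := ((hd.clm_apply (hasFDerivAt_const a y)).clm_apply (hasFDerivAt_const b y)).fderiv
    have := congrArg (fun L : E →L[ℝ] ℝ ↦ L c) this
    simpa [chartMetric_apply] using this
  simp only [christoffelFirst, flatChristoffel, key]

end ChartMetric

/-! ### Geodesics and the exponential map in charts. -/

section Geodesic

variable {E : Type*} [NormedAddCommGroup E] [NormedSpace ℝ E]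
  {M : Type*} [TopologicalSpace M] [ChartedSpace E M] [IsManifold 𝓘(ℝ, E) ∞ M]
  {e e' : OpenPartialHomeomorph M E}

/-- The two transition maps are inverse to each other near the points in question. Hence every test
vector in the second chart comes from one in the first, as needed to carry over the geodesic
equation with lowered index. -/
lemma fderiv_chart_change_fderiv (he : e ∈ atlas E M) (he' : e' ∈ atlas E M) {y : E}
    (hy : y ∈ e.target) (hy' : e.symm y ∈ e'.source) (w : E) :
    fderiv ℝ (e' ∘ e.symm) y (fderiv ℝ (e ∘ e'.symm) ((e' ∘ e.symm) y) w) = w := by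
  have hz : (e' ∘ e.symm) y ∈ e'.target := e'.map_source hy'
  have hz' : e'.symm ((e' ∘ e.symm) y) = e.symm y := e'.left_inv hy'
  have hy2 : (e ∘ e'.symm) ((e' ∘ e.symm) y) = y := by
    simp only [Function.comp_apply] at hz' ⊢
    rw [hz', e.right_inv hy]
  have hzs : e'.symm ((e' ∘ e.symm) y) ∈ e.source := by rw [hz']; exact e.map_target hy
  have h1 := ((contDiffAt_chart_change he' he hz hzs).differentiableAt (by simp)).hasFDerivAt
  have h2 := ((contDiffAt_chart_change he he' hy hy').differentiableAt (by simp)).hasFDerivAt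
  have h3 : HasFDerivAt (fun z ↦ z) (fderiv ℝ (e' ∘ e.symm) y ∘L
      fderiv ℝ (e ∘ e'.symm) ((e' ∘ e.symm) y)) ((e' ∘ e.symm) y) := by
    refine HasFDerivAt.congr_of_eventuallyEq (HasFDerivAt.comp _ (by rwa [hy2]) h1) ?_
    have h4 := e'.continuousAt_symm hz (e.open_source.mem_nhds hzs)
    filter_upwards [e'.open_target.mem_nhds hz, h4] with z hz1 hz2
    simp only [Function.comp_apply]
    rw [e.left_inv hz2, e'.right_inv hz1]
  exact congrArg (fun L : E →L[ℝ] E ↦ L w) (h3.unique (hasFDerivAt_id _))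

lemma contDiffAt_chart_comp (he : e ∈ atlas E M) {γ : ℝ → M} {s : Set ℝ} (hs : IsOpen s)
    (hγ : ContMDiffOn 𝓘(ℝ, ℝ) 𝓘(ℝ, E) 2 γ s) {t : ℝ} (ht : t ∈ s) (hte : γ t ∈ e.source) :
    ContDiffAt ℝ 2 (e ∘ γ) t :=
  (((contMDiffOn_of_mem_maximalAtlas (n := 2) (I := 𝓘(ℝ, E))
    (IsManifold.subset_maximalAtlas he)).contMDiffAt (e.open_source.mem_nhds hte)).comp t
      (hγ.contMDiffAt (hs.mem_nhds ht))).contDiffAt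

variable [RiemannianBundle (fun x : M ↦ TangentSpace 𝓘(ℝ, E) x)]
  [IsContMDiffRiemannianBundle 𝓘(ℝ, E) ∞ E (fun x : M ↦ TangentSpace 𝓘(ℝ, E) x)]
  [FiniteDimensional ℝ E]

/-- A curve that satisfies the geodesic equation in one chart is a geodesic. -/
lemma isGeodesicOn_symm_comp (he : e ∈ atlas E M) {c c' : ℝ → E} {s : Set ℝ} (hs : IsOpen s)
    (hc2 : ContDiffOn ℝ 2 c s) (hmem : ∀ t ∈ s, c t ∈ e.target)
    (hc : ∀ t ∈ s, HasDerivAt c (c' t) t)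
    (hc' : ∀ t ∈ s, HasDerivAt c' (geodesicAcceleration (chartMetric e) (c t, c' t)) t) :
    IsGeodesicOn (E := E) (e.symm ∘ c) s := by
  refine ⟨((contMDiffOn_symm_of_mem_maximalAtlas (n := 2) (I := 𝓘(ℝ, E))
    (IsManifold.subset_maximalAtlas he))).comp hc2.contMDiffOn hmem, ?_⟩
  intro e' he' t ht hte w
  simp only [Function.comp_apply] at hte
  have hG := isFlatMetricOn_chartMetric he
  have hG' := isFlatMetricOn_chartMetric he'
  have hy := hmem t ht
  have hφ := contDiffAt_chart_change he he' hy hte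
  have hev : ∀ᶠ z in 𝓝 (c t), z ∈ e.target ∧ e.symm z ∈ e'.source :=
    Filter.Eventually.and (e.open_target.mem_nhds hy) (e.continuousAt_symm hy (e'.open_source.mem_nhds hte))
  have hd : deriv (e' ∘ e.symm ∘ c) =ᶠ[𝓝 t] fun s ↦ fderiv ℝ (e' ∘ e.symm) (c s) (c' s) := by
    filter_upwards [hs.mem_nhds ht, (hc t ht).continuousAt.eventually hev] with s hs1 hs2
    exact (((contDiffAt_chart_change he he' hs2.1 hs2.2).differentiableAt
      (by simp)).hasFDerivAt.comp_hasDerivAt s (hc s hs1)).deriv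
  have hφd2 := ((hφ.fderiv_right (m := 1)
    (by rw [one_add_one_eq_two]; exact ENat.LEInfty.out)).differentiableAt (by simp)).hasFDerivAt
  rw [hd.deriv_eq, hd.eq_of_nhds, (hφd2.hasDerivAt_apply (hc t ht) rfl (hc' t ht)).deriv]
  have hz : (e' ∘ e.symm) (c t) ∈ e'.target := e'.map_source hte
  have key := geodesic_equation_pullback (G := chartMetric e) (G' := chartMetric e') hφ
    ((hG'.contDiffOn.differentiableOn (by simp)).differentiableAt (e'.open_target.mem_nhds hz))
    ((hG.contDiffOn.differentiableOn (by simp)).differentiableAt (e.open_target.mem_nhds hy))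
    (hG'.symm _ hz) (hev.mono fun z hz u w ↦ chartMetric_change he he' hz.1 hz.2 u w)
    (c' t) (geodesicAcceleration (chartMetric e) (c t, c' t))
    (fderiv ℝ (e ∘ e'.symm) ((e' ∘ e.symm) (c t)) w)
  rw [fderiv_chart_change_fderiv he he' hy hte,
    (hG.eq_geodesicAcceleration_iff hy _ _).2 rfl, ← christoffelFirst_eq he' hz] at key
  exact key

/-- The coordinate expression of a geodesic satisfies the geodesic equation. -/
lemma IsGeodesicOn.hasDerivAt_deriv (he : e ∈ atlas E M) {γ : ℝ → M} {s : Set ℝ} (hs : IsOpen s)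
    (hγ : IsGeodesicOn (E := E) γ s) {t : ℝ} (ht : t ∈ s) (hte : γ t ∈ e.source) :
    HasDerivAt (e ∘ γ) (deriv (e ∘ γ) t) t ∧ HasDerivAt (deriv (e ∘ γ))
      (geodesicAcceleration (chartMetric e) ((e ∘ γ) t, deriv (e ∘ γ) t)) t := by
  have h := contDiffAt_chart_comp he hs hγ.1 ht hte
  refine ⟨(h.differentiableAt (by simp)).hasDerivAt, ?_⟩
  have hy : e (γ t) ∈ e.target := e.map_source hte
  have h2 : DifferentiableAt ℝ (deriv (e ∘ γ)) t :=
    (h.derivWithin (m := 1) (by rw [one_add_one_eq_two])).differentiableAt (by simp)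
  have h3 : deriv (deriv (e ∘ γ)) t =
      geodesicAcceleration (chartMetric e) ((e ∘ γ) t, deriv (e ∘ γ) t) := by
    refine ((isFlatMetricOn_chartMetric he).eq_geodesicAcceleration_iff hy _ _).1 fun w ↦ ?_
    rw [← christoffelFirst_eq he hy]
    exact hγ.2 e he t ht hte w
  rw [← h3]
  exact h2.hasDerivAt

/-- A geodesic on `[0, 1]` coincides with a solution of the geodesic equation in a chart with the
same initial data. -/
lemma IsGeodesicOn.eqOn_of_chart [T2Space M] (he : e ∈ atlas E M) {γ : ℝ → M} {s s' : Set ℝ}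
    (hs : IsOpen s) (hs1 : Icc 0 1 ⊆ s) (hγ : IsGeodesicOn (E := E) γ s) {c c' : ℝ → E}
    (hs' : IsOpen s') (hs1' : Icc 0 1 ⊆ s') (hmem : ∀ t ∈ s', c t ∈ e.target)
    (hc : ∀ t ∈ s', HasDerivAt c (c' t) t)
    (hc' : ∀ t ∈ s', HasDerivAt c' (geodesicAcceleration (chartMetric e) (c t, c' t)) t)
    (h0 : γ 0 = e.symm (c 0)) (h0' : deriv (e ∘ γ) 0 = c' 0) :
    EqOn γ (e.symm ∘ c) (Icc 0 1) := by
  have hG := isFlatMetricOn_chartMetric he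
  have hγc : ∀ t ∈ Icc (0 : ℝ) 1, ContinuousAt γ t := fun t ht ↦
    (hγ.1.contMDiffAt (hs.mem_nhds (hs1 ht))).continuousAt
  have hcc : ∀ t ∈ Icc (0 : ℝ) 1, ContinuousAt (e.symm ∘ c) t := fun t ht ↦
    (e.continuousAt_symm (hmem t (hs1' ht))).comp (hc t (hs1' ht)).continuousAt
  have loc : ∀ t ∈ Icc (0 : ℝ) 1, γ t = e.symm (c t) → deriv (e ∘ γ) t = c' t →
      γ =ᶠ[𝓝 t] e.symm ∘ c := by
    intro t ht h1 h2
    have hct := hmem t (hs1' ht)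
    have hte : γ t ∈ e.source := by rw [h1]; exact e.map_target hct
    have hev : ∀ᶠ u in 𝓝 t, γ u ∈ e.source := (hγc t ht) (e.open_source.mem_nhds hte)
    have hA : ContDiffAt ℝ 1 (geodesicAcceleration (chartMetric e))
        ((e ∘ γ) t, deriv (e ∘ γ) t) :=
      ((hG.contDiffOn_geodesicAcceleration.contDiffAt
        ((e.open_target.prod isOpen_univ).mem_nhds ⟨e.map_source hte, mem_univ _⟩))).of_le
        (by exact_mod_cast le_top)
    have h3 : e ∘ γ =ᶠ[𝓝 t] c := by
      refine eventuallyEq_of_secondOrder hA (d' := c') ?_ ?_ ?_ h2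
      · filter_upwards [hev, hs.mem_nhds (hs1 ht)] with u hu hus
        exact hγ.hasDerivAt_deriv he hs hus hu
      · filter_upwards [hs'.mem_nhds (hs1' ht)] with u hu using ⟨hc u hu, hc' u hu⟩
      · simp only [Function.comp_apply]
        rw [h1, e.right_inv hct]
    filter_upwards [h3, hev] with u hu hue
    simp only [Function.comp_apply] at hu ⊢
    rw [← hu, e.left_inv hue]
  -- The geodesic `γ` might leave the chart, so agreement is propagated along `[0, 1]` as an open
  -- and closed condition. At a limit of agreement times the Hausdorff property gives equality of
  -- the points, which puts `γ t` in the chart. Continuity then gives equality of the velocities.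
  have key : Icc (0 : ℝ) 1 ⊆ {t | ∀ᶠ u in 𝓝 t, γ u = (e.symm ∘ c) u} := by
    refine isPreconnected_Icc.subset_of_closure_inter_subset isOpen_setOfPred_eventually_nhds
      ⟨0, by simp, loc 0 (by simp) h0 h0'⟩ ?_
    rintro t ⟨htcl, ht⟩
    have hfr : ∃ᶠ u in 𝓝 t, ∀ᶠ u' in 𝓝 u, γ u' = (e.symm ∘ c) u' :=
      mem_closure_iff_frequently.1 htcl
    have h1 : γ t = (e.symm ∘ c) t := by
      by_contra hne
      obtain ⟨u, hu, hu'⟩ := (hfr.and_eventually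
        (((hγc t ht).ne_iff_eventually_ne (hcc t ht)).1 hne)).exists
      exact hu' hu.self_of_nhds
    have hct := hmem t (hs1' ht)
    have hte : γ t ∈ e.source := by rw [h1]; exact e.map_target hct
    refine loc t ht h1 ?_
    have hd1 : ContinuousAt (deriv (e ∘ γ)) t :=
      (hγ.hasDerivAt_deriv he hs (hs1 ht) hte).2.continuousAt
    have hd2 : ContinuousAt c' t := (hc' t (hs1' ht)).continuousAt
    by_contra hne
    obtain ⟨u, hu, hu', hus⟩ := (hfr.and_eventually (((hd1.ne_iff_eventually_ne hd2).1 hne).and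
      (hs'.mem_nhds (hs1' ht)))).exists
    refine hu' ((hc u hus).congr_of_eventuallyEq ?_).deriv
    filter_upwards [hu, (hc u hus).continuousAt (e.open_target.mem_nhds (hmem u hus))] with z hz hz'
    simp only [Function.comp_apply] at hz ⊢
    rw [hz, e.right_inv hz']
  exact fun t ht ↦ (key ht).self_of_nhds

/-- The Riemannian exponential map in a chart. -/
theorem riemannianExp_eq [T2Space M] (he : e ∈ atlas E M) {X : E × E → E} {x₀ : E} {r : ℝ}
    (hX : IsGeodesicFamily (chartMetric e) e.target X x₀ r) {x v : E} (hx : x ∈ ball x₀ r)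
    (hv : v ∈ ball (0 : E) r) :
    riemannianExp (E := E) (⟨e.symm x, mfderiv 𝓘(ℝ, E) 𝓘(ℝ, E) e.symm x v⟩ :
      TangentBundle 𝓘(ℝ, E) M) = e.symm (X (x, v)) := by
  set c : ℝ → E := fun t ↦ X (x, t • v) with hcdef
  set c' : ℝ → E := fun t ↦ fderiv ℝ X (x, t • v) (0, v) with hc'def
  have hc : ∀ t ∈ Ioo (-2 : ℝ) 2, HasDerivAt c (c' t) t := fun t ht ↦ hX.hasDerivAt hx hv ht
  have hc' : ∀ t ∈ Ioo (-2 : ℝ) 2,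
      HasDerivAt c' (geodesicAcceleration (chartMetric e) (c t, c' t)) t :=
    fun t ht ↦ hX.hasDerivAt_velocity hx hv ht
  have hmem : ∀ t ∈ Ioo (-2 : ℝ) 2, c t ∈ e.target := hX.mem x hx v hv
  have hc2 : ContDiffOn ℝ 2 c (Ioo (-2) 2) := by
    intro t ht
    have h1 : ContDiff ℝ 2 fun t : ℝ ↦ (x, t • v) := by fun_prop
    exact (((hX.contDiffAt hx (IsGeodesicFamily.smul_mem hv ht)).of_le
      ENat.LEInfty.out).comp t h1.contDiffAt).contDiffWithinAt
  have hI : Icc (0 : ℝ) 1 ⊆ Ioo (-2) 2 := fun t ht ↦ ⟨by linarith [ht.1], by linarith [ht.2]⟩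
  have h0 : (0 : ℝ) ∈ Ioo (-2 : ℝ) 2 := by simp
  have hc0 : c 0 = x := by simp [hcdef, hX.apply_zero x hx]
  have hc0' : c' 0 = v := (hc 0 h0).unique (hX.hasDerivAt_zero x hx v hv)
  have hgeo := isGeodesicOn_symm_comp he isOpen_Ioo hc2 hmem hc hc'
  have hex : ∃ γ : ℝ → M, (∃ s : Set ℝ, IsOpen s ∧ Icc 0 1 ⊆ s ∧ IsGeodesicOn (E := E) γ s) ∧
      velocityLift γ 0 = (⟨e.symm x, mfderiv 𝓘(ℝ, E) 𝓘(ℝ, E) e.symm x v⟩ :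
        TangentBundle 𝓘(ℝ, E) M) := by
    refine ⟨e.symm ∘ c, ⟨_, isOpen_Ioo, hI, hgeo⟩, ?_⟩
    have hx' : x ∈ e.target := hc0 ▸ hmem 0 h0
    have h1 := (mdifferentiable_of_mem_atlas (I := 𝓘(ℝ, E)) he).mdifferentiableAt_symm
      (hmem 0 h0)
    have h2 : MDifferentiableAt 𝓘(ℝ, ℝ) 𝓘(ℝ, E) c 0 :=
      (hc 0 h0).differentiableAt.mdifferentiableAt
    have h3 : mfderiv 𝓘(ℝ, ℝ) 𝓘(ℝ, E) c 0 (1 : ℝ) = c' 0 := by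
      rw [mfderiv_eq_fderiv]
      exact (hc 0 h0).deriv
    rw [velocityLift, mfderiv_comp _ h1 h2]
    have h4 : ((mfderiv 𝓘(ℝ, E) 𝓘(ℝ, E) e.symm (c 0)).comp (mfderiv 𝓘(ℝ, ℝ) 𝓘(ℝ, E) c 0)) (1 : ℝ)
        = mfderiv 𝓘(ℝ, E) 𝓘(ℝ, E) e.symm (c 0) (c' 0) :=
      congrArg (mfderiv 𝓘(ℝ, E) 𝓘(ℝ, E) e.symm (c 0)) h3
    have key : ∀ y : E, y = x →
        (⟨e.symm y, mfderiv 𝓘(ℝ, E) 𝓘(ℝ, E) e.symm y v⟩ : TangentBundle 𝓘(ℝ, E) M) =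
          ⟨e.symm x, mfderiv 𝓘(ℝ, E) 𝓘(ℝ, E) e.symm x v⟩ := by
      rintro y rfl
      rfl
    rw [h4, hc0']
    exact key (c 0) hc0
  -- The chosen geodesic is arbitrary, but its initial data are prescribed, so uniqueness forces its
  -- value at time `1`.
  rw [riemannianExp, dif_pos hex]
  obtain ⟨⟨s, hs, hs1, hγ⟩, hvel⟩ := hex.choose_spec
  set γ := hex.choose
  have hγ0 : γ 0 = e.symm x := congrArg Bundle.TotalSpace.proj hvel
  have hx' : x ∈ e.target := hc0 ▸ hmem 0 h0
  have hte : γ 0 ∈ e.source := hγ0 ▸ e.map_target hx'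
  have hd : deriv (e ∘ γ) 0 = v := by
    have h1 := congrArg (fun Z : TangentBundle 𝓘(ℝ, E) M ↦
      (mfderiv 𝓘(ℝ, E) 𝓘(ℝ, E) e Z.proj Z.snd : E)) hvel
    have h2 : mfderiv 𝓘(ℝ, E) 𝓘(ℝ, E) e (e.symm x) (mfderiv 𝓘(ℝ, E) 𝓘(ℝ, E) e.symm x v) = v :=
      mfderiv_chart_mfderiv_symm he hx' v
    have h3 : MDifferentiableAt 𝓘(ℝ, ℝ) 𝓘(ℝ, E) γ 0 :=
      (hγ.1.contMDiffAt (hs.mem_nhds (hs1 (by simp)))).mdifferentiableAt (by simp)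
    have h4 := (mdifferentiable_of_mem_atlas (I := 𝓘(ℝ, E)) he).mdifferentiableAt hte
    have h5 := mfderiv_comp (0 : ℝ) h4 h3
    rw [← fderiv_apply_one_eq_deriv, ← mfderiv_eq_fderiv, h5]
    exact h1.trans h2
  have := hγ.eqOn_of_chart he hs hs1 isOpen_Ioo hI hmem hc hc' (by rw [hγ0, hc0])
    (by rw [hd, hc0']) (x := 1) (by simp)
  rw [this]
  simp [hcdef]

end Geodesic

/-- Positive definiteness is an open condition. -/
lemma ContinuousAt.eventually_posDef {T V : Type*} [TopologicalSpace T] [NormedAddCommGroup V]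
    [NormedSpace ℝ V] [FiniteDimensional ℝ V] {B : T → V →L[ℝ] V →L[ℝ] ℝ} {t₀ : T}
    (hB : ContinuousAt B t₀) (h : ∀ v, v ≠ 0 → 0 < B t₀ v v) :
    ∀ᶠ t in 𝓝 t₀, ∀ v, v ≠ 0 → 0 < B t v v := by
  -- Compactness of the unit sphere makes the neighbourhood independent of `v`; quadratic
  -- homogeneity extends the bound to all nonzero vectors.
  have h1 : ∀ᶠ t in 𝓝 t₀, ∀ v ∈ sphere (0 : V) 1, 0 < B t v v := by
    refine (isCompact_sphere (0 : V) 1).eventually_forall_of_forall_eventually fun v hv ↦ ?_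
    have hc : ContinuousAt (fun z : T × V ↦ B z.1 z.2 z.2) (t₀, v) := by
      have h2 : ContinuousAt (fun z : T × V ↦ B z.1) (t₀, v) :=
        ContinuousAt.comp (f := Prod.fst) (x := (t₀, v)) hB continuousAt_fst
      exact (h2.clm_apply continuousAt_snd).clm_apply continuousAt_snd
    exact hc.eventually (lt_mem_nhds (h v (ne_zero_of_mem_unit_sphere (⟨v, hv⟩ : sphere (0 : V) 1))))
  filter_upwards [h1] with t ht v hv
  have h3 : 0 < ‖v‖ := norm_pos_iff.2 hv
  have h4 := ht (‖v‖⁻¹ • v) (by simp [norm_smul, h3.ne'])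
  have h5 : B t v v = ‖v‖ ^ 2 * B t (‖v‖⁻¹ • v) (‖v‖⁻¹ • v) := by
    simp only [map_smul, smul_apply, smul_eq_mul]
    field_simp
  rw [h5]
  positivity

/-! ### The Fermi parametrization in coordinates. -/

section FlatFermi

variable {E F : Type*} [NormedAddCommGroup E] [NormedSpace ℝ E] [NormedAddCommGroup F]
  [NormedSpace ℝ F] {k : ℕ}

/-- `ν` is a smooth orthonormal frame along the parametrized submanifold `y`, and orthogonal
to it, with respect to the metric `G`. -/
structure IsFlatNormalFrame (G : E → E →L[ℝ] E →L[ℝ] ℝ) (Z : Set F) (y : F → E)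
    (ν : Fin k → F → E) : Prop where
  isOpen : IsOpen Z
  contDiffOn : ContDiffOn ℝ ∞ y Z
  contDiffOn_frame : ∀ j, ContDiffOn ℝ ∞ (ν j) Z
  injective : ∀ z ∈ Z, Function.Injective (fderiv ℝ y z)
  orthonormal : ∀ z ∈ Z, ∀ i j, G (y z) (ν i z) (ν j z) = if i = j then 1 else 0
  normal : ∀ z ∈ Z, ∀ w j, G (y z) (fderiv ℝ y z w) (ν j z) = 0

/-- The normal vector with coefficients `p.2` at the point with parameter `p.1`. -/
noncomputable def normalSum (ν : Fin k → F → E) (p : F × EuclideanSpace ℝ (Fin k)) : E :=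
  ∑ j, p.2 j • ν j p.1

omit [NormedAddCommGroup F] [NormedSpace ℝ F] in
lemma normalSum_smul (ν : Fin k → F → E) (z : F) (t : EuclideanSpace ℝ (Fin k)) (s : ℝ) :
    normalSum ν (z, s • t) = s • normalSum ν (z, t) := by
  simp [normalSum, Finset.smul_sum, smul_smul]

/-- The derivative of `normalSum` in the direction of the submanifold. -/
noncomputable def normalVariation (ν : Fin k → F → E) (p : F × EuclideanSpace ℝ (Fin k)) (w : F) :
    E :=
  ∑ j, p.2 j • fderiv ℝ (ν j) p.1 w

variable {G : E → E →L[ℝ] E →L[ℝ] ℝ} {O : Set E} {Z : Set F} {y : F → E} {ν : Fin k → F → E}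
  {X : E × E → E} {x₀ : E} {r : ℝ}

namespace IsFlatNormalFrame

lemma contDiffAt (hν : IsFlatNormalFrame G Z y ν) {z : F} (hz : z ∈ Z) : ContDiffAt ℝ ∞ y z :=
  hν.contDiffOn.contDiffAt (hν.isOpen.mem_nhds hz)

lemma hasFDerivAt (hν : IsFlatNormalFrame G Z y ν) {z : F} (hz : z ∈ Z) :
    HasFDerivAt y (fderiv ℝ y z) z :=
  ((hν.contDiffAt hz).differentiableAt (by simp)).hasFDerivAt

lemma contDiffAt_normalSum (hν : IsFlatNormalFrame G Z y ν) {p : F × EuclideanSpace ℝ (Fin k)}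
    (hz : p.1 ∈ Z) : ContDiffAt ℝ ∞ (normalSum ν) p := by
  refine ContDiffAt.sum fun j _ ↦ ContDiffAt.smul ?_ ?_
  · exact (contDiff_piLp_apply (p := 2) (i := j)).contDiffAt.comp p contDiffAt_snd
  · exact ((hν.contDiffOn_frame j).contDiffAt (hν.isOpen.mem_nhds hz)).comp p contDiffAt_fst

lemma fderiv_normalSum (hν : IsFlatNormalFrame G Z y ν) {p : F × EuclideanSpace ℝ (Fin k)}
    (hz : p.1 ∈ Z) (w : F) (τ : EuclideanSpace ℝ (Fin k)) :
    fderiv ℝ (normalSum ν) p (w, τ) = normalSum ν (p.1, τ) + normalVariation ν p w := by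
  have hl : HasDerivAt (fun s : ℝ ↦ (p.1 + s • w, p.2 + s • τ)) (w, τ) 0 := by
    refine HasDerivAt.prodMk ?_ ?_
    · simpa using ((hasDerivAt_id (0 : ℝ)).smul_const w).const_add p.1
    · simpa using ((hasDerivAt_id (0 : ℝ)).smul_const τ).const_add p.2
  have h0 : (fun s : ℝ ↦ (p.1 + s • w, p.2 + s • τ)) 0 = p := by simp
  have h1 := ((hν.contDiffAt_normalSum hz).differentiableAt (by simp)).hasFDerivAt
  rw [← h0] at h1
  have h2 := h1.comp_hasDerivAt 0 hl
  rw [h0] at h2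
  have h3 : HasDerivAt (fun s : ℝ ↦ ∑ j, (p.2 + s • τ) j • ν j (p.1 + s • w))
      (∑ j, (p.2 j • fderiv ℝ (ν j) p.1 w + τ j • ν j p.1)) 0 := by
    refine HasDerivAt.fun_sum fun j _ ↦ ?_
    have h4 : HasDerivAt (fun s : ℝ ↦ (p.2 + s • τ) j) (τ j) 0 := by
      simpa using ((hasDerivAt_id (0 : ℝ)).mul_const (τ j)).const_add (p.2 j)
    have h5 : HasFDerivAt (ν j) (fderiv ℝ (ν j) p.1) (p.1 + (0 : ℝ) • w) := by
      rw [zero_smul, add_zero]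
      exact (((hν.contDiffOn_frame j).contDiffAt (hν.isOpen.mem_nhds hz)).differentiableAt
        (by simp)).hasFDerivAt
    have h6 : HasDerivAt (fun s : ℝ ↦ p.1 + s • w) w 0 := by
      simpa using ((hasDerivAt_id (0 : ℝ)).smul_const w).const_add p.1
    simpa using h4.fun_smul (h5.comp_hasDerivAt 0 h6)
  rw [h2.unique h3, Finset.sum_add_distrib, add_comm]
  rfl

lemma inner_normalSum (hν : IsFlatNormalFrame G Z y ν) {z : F} (hz : z ∈ Z)
    (s t : EuclideanSpace ℝ (Fin k)) :
    G (y z) (normalSum ν (z, s)) (normalSum ν (z, t)) = inner ℝ s t := by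
  simp only [normalSum, map_sum, map_smul, sum_apply, smul_apply, smul_eq_mul,
    hν.orthonormal z hz, PiLp.inner_apply]
  simp [mul_comm]

lemma inner_fderiv_normalSum (hν : IsFlatNormalFrame G Z y ν) {z : F} (hz : z ∈ Z) (w : F)
    (t : EuclideanSpace ℝ (Fin k)) : G (y z) (fderiv ℝ y z w) (normalSum ν (z, t)) = 0 := by
  simp [normalSum, hν.normal z hz]

/-- The length of a normal vector with fixed coefficients does not vary along the submanifold. -/
lemma inner_normalVariation (hν : IsFlatNormalFrame G Z y ν) (hG : IsFlatMetricOn G O)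
    {p : F × EuclideanSpace ℝ (Fin k)} (hz : p.1 ∈ Z) (hO : y p.1 ∈ O) (w : F) :
    fderiv ℝ G (y p.1) (fderiv ℝ y p.1 w) (normalSum ν p) (normalSum ν p) / 2 +
      G (y p.1) (normalSum ν p) (normalVariation ν p w) = 0 := by
  have h6 : HasDerivAt (fun s : ℝ ↦ p.1 + s • w) w 0 := by
    simpa using ((hasDerivAt_id (0 : ℝ)).smul_const w).const_add p.1
  have h0 : (fun s : ℝ ↦ p.1 + s • w) 0 = p.1 := by simp
  have hy : HasDerivAt (fun s : ℝ ↦ y (p.1 + s • w)) (fderiv ℝ y p.1 w) 0 :=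
    (by simpa using hν.hasFDerivAt hz : HasFDerivAt y (fderiv ℝ y p.1) (p.1 + (0 : ℝ) • w)).comp_hasDerivAt 0 h6
  have hn : HasDerivAt (fun s : ℝ ↦ normalSum ν (p.1 + s • w, p.2)) (normalVariation ν p w) 0 := by
    have h1 := ((hν.contDiffAt_normalSum hz).differentiableAt (by simp)).hasFDerivAt
    have hl : HasDerivAt (fun s : ℝ ↦ (p.1 + s • w, p.2)) (w, 0) 0 := h6.prodMk (hasDerivAt_const _ _)
    have h2 := (by simpa using h1 : HasFDerivAt (normalSum ν) (fderiv ℝ (normalSum ν) p)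
      (p.1 + (0 : ℝ) • w, p.2)).comp_hasDerivAt (0 : ℝ) hl
    rw [hν.fderiv_normalSum hz] at h2
    have h3 : normalSum ν (p.1, (0 : EuclideanSpace ℝ (Fin k))) = 0 := by simp [normalSum]
    rw [h3, zero_add] at h2
    exact h2
  have h2 := hG.hasDerivAt_inner (by simpa using hO) hy hn hn
  have h3 : (fun s : ℝ ↦ G (y (p.1 + s • w)) (normalSum ν (p.1 + s • w, p.2))
      (normalSum ν (p.1 + s • w, p.2))) =ᶠ[𝓝 0] fun _ ↦ inner ℝ p.2 p.2 := by
    have : Filter.Tendsto (fun s : ℝ ↦ p.1 + s • w) (𝓝 0) (𝓝 p.1) := by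
      simpa [ContinuousAt] using h6.continuousAt
    filter_upwards [this (hν.isOpen.mem_nhds hz)] with s hs using hν.inner_normalSum hs _ _
  have h4 := h2.unique ((hasDerivAt_const (0 : ℝ) (inner ℝ p.2 p.2 : ℝ)).congr_of_eventuallyEq h3)
  simp only [zero_smul, add_zero, Prod.mk.eta] at h4
  have h5 := hG.symm _ hO (normalVariation ν p w) (normalSum ν p)
  linarith

end IsFlatNormalFrame

/-- The Fermi parametrization in coordinates. -/
noncomputable def flatFermi (X : E × E → E) (y : F → E) (ν : Fin k → F → E)
    (p : F × EuclideanSpace ℝ (Fin k)) : E :=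
  X (y p.1, normalSum ν p)

section

variable (hG : IsFlatMetricOn G O) (hX : IsGeodesicFamily G O X x₀ r)
  (hν : IsFlatNormalFrame G Z y ν) {p : F × EuclideanSpace ℝ (Fin k)} (hz : p.1 ∈ Z)
  (hy : y p.1 ∈ ball x₀ r) (hn : normalSum ν p ∈ ball (0 : E) r)
include hX hν hz hy hn

omit hν hz hy [NormedAddCommGroup F] [NormedSpace ℝ F] in
lemma normalSum_mem_ball_two : normalSum ν p ∈ ball (0 : E) (2 * r) :=
  ball_subset_ball (by linarith [hX.pos]) hn

lemma contDiffAt_flatFermi : ContDiffAt ℝ ∞ (flatFermi X y ν) p :=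
  (hX.contDiffAt hy (normalSum_mem_ball_two hX hn)).comp p
    (((hν.contDiffAt hz).comp p contDiffAt_fst).prodMk (hν.contDiffAt_normalSum hz))

lemma fderiv_flatFermi (w : F) (τ : EuclideanSpace ℝ (Fin k)) :
    fderiv ℝ (flatFermi X y ν) p (w, τ) = fderiv ℝ X (y p.1, normalSum ν p)
      (fderiv ℝ y p.1 w, normalSum ν (p.1, τ) + normalVariation ν p w) := by
  have h1 : HasFDerivAt (fun p : F × EuclideanSpace ℝ (Fin k) ↦ y p.1)
      (fderiv ℝ y p.1 ∘L ContinuousLinearMap.fst ℝ F (EuclideanSpace ℝ (Fin k))) p :=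
    (hν.hasFDerivAt hz).comp p hasFDerivAt_fst
  have h2 := ((hν.contDiffAt_normalSum hz).differentiableAt (by simp)).hasFDerivAt
  have h3 := (hX.hasFDerivAt hy (normalSum_mem_ball_two hX hn)).comp p (h1.prodMk h2)
  rw [show flatFermi X y ν = X ∘ fun p ↦ (y p.1, normalSum ν p) from rfl, h3.fderiv]
  simp [hν.fderiv_normalSum hz]

include hG in
-- The Gauss lemma expresses the product through the initial data. The term with the tangent
-- direction `w` vanishes by normality, the terms from varying the base point cancel because the
-- length of `∑ t_j ν_j` depends on `t` alone, and orthonormality leaves the Euclidean product.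
lemma inner_fderiv_flatFermi_radial [FiniteDimensional ℝ E] (w : F)
    (τ : EuclideanSpace ℝ (Fin k)) :
    G (flatFermi X y ν p) (fderiv ℝ (flatFermi X y ν) p (0, p.2))
      (fderiv ℝ (flatFermi X y ν) p (w, τ)) = inner ℝ p.2 τ := by
  have hO : y p.1 ∈ O := by
    have := hX.mem _ hy 0 (mem_ball_self hX.pos) 0 (by simp)
    rwa [smul_zero, hX.apply_zero _ hy] at this
  have h1 : normalVariation ν p 0 = 0 := by simp [normalVariation]
  rw [fderiv_flatFermi hX hν hz hy hn, fderiv_flatFermi hX hν hz hy hn, flatFermi, h1, map_zero,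
    add_zero]
  have h2 := hX.gauss hG hy hn (fderiv ℝ y p.1 w) (normalSum ν (p.1, τ) + normalVariation ν p w)
  have h3 := hν.inner_normalVariation hG hz hO w
  have h4 := hν.inner_normalSum hz p.2 τ
  have h5 := hν.inner_fderiv_normalSum hz w p.2
  rw [hG.symm _ hO] at h5
  simp only [Prod.mk.eta] at *
  rw [h2, h5, map_add, h4]
  linarith

include hG in
-- The curve `s ↦ (z, s t)` is mapped to a geodesic, whose speed is constant and equals the length
-- of its initial normal vector.
lemma inner_fderiv_flatFermi_ray [FiniteDimensional ℝ E] {s : ℝ} (hs : s ∈ Icc (0 : ℝ) 1) :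
    G (flatFermi X y ν (p.1, s • p.2)) (fderiv ℝ (flatFermi X y ν) (p.1, s • p.2) (0, p.2))
      (fderiv ℝ (flatFermi X y ν) (p.1, s • p.2) (0, p.2)) = inner ℝ p.2 p.2 := by
  have hs' : s ∈ Ioo (-2 : ℝ) 2 := ⟨by linarith [hs.1], by linarith [hs.2]⟩
  have h1 := hX.energy hG hy hn hs'
  have h2 : normalVariation ν (p.1, s • p.2) 0 = 0 := by simp [normalVariation]
  have h3 : normalSum ν (p.1, s • p.2) = s • normalSum ν p := normalSum_smul ν p.1 p.2 s
  have hn' : normalSum ν (p.1, s • p.2) ∈ ball (0 : E) r := by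
    rw [h3, mem_ball_zero_iff, norm_smul, Real.norm_eq_abs, abs_of_nonneg hs.1]
    rw [mem_ball_zero_iff] at hn
    exact (mul_le_of_le_one_left (norm_nonneg _) hs.2).trans_lt hn
  rw [fderiv_flatFermi hX hν (p := (p.1, s • p.2)) hz hy hn', flatFermi, h2, h3]
  simp only [map_zero, add_zero, Prod.mk.eta]
  rw [h1]
  exact hν.inner_normalSum hz p.2 p.2

end

end FlatFermi

lemma continuousOn_bilinearComp {T V E : Type*} [TopologicalSpace T] [NormedAddCommGroup V]
    [NormedSpace ℝ V] [FiniteDimensional ℝ V] [NormedAddCommGroup E] [NormedSpace ℝ E]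
    {B : T → E →L[ℝ] E →L[ℝ] ℝ} {A : T → V →L[ℝ] E} {s : Set T} (hB : ContinuousOn B s)
    (hA : ContinuousOn A s) : ContinuousOn (fun t ↦ (B t).bilinearComp (A t) (A t)) s := by
  rw [continuousOn_clm_apply]
  intro u
  rw [continuousOn_clm_apply]
  intro w
  exact (hB.clm_apply (hA.clm_apply continuousOn_const)).clm_apply (hA.clm_apply continuousOn_const)

/-! ### Comparison of the pulled back metric with the product metric. -/

section FlatFermiPatch

variable {E F : Type*} [NormedAddCommGroup E] [NormedSpace ℝ E] [NormedAddCommGroup F]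
  [NormedSpace ℝ F] [FiniteDimensional ℝ E] [FiniteDimensional ℝ F] {k : ℕ}
  {G : E → E →L[ℝ] E →L[ℝ] ℝ} {O : Set E} {Z : Set F} {y : F → E} {ν : Fin k → F → E}
  {X : E × E → E} {x₀ : E} {r : ℝ}

/-- The pullback of the metric by the Fermi parametrization. -/
noncomputable def fermiPullback (G : E → E →L[ℝ] E →L[ℝ] ℝ) (X : E × E → E) (y : F → E)
    (ν : Fin k → F → E) (p : F × EuclideanSpace ℝ (Fin k)) :
    F × EuclideanSpace ℝ (Fin k) →L[ℝ] F × EuclideanSpace ℝ (Fin k) →L[ℝ] ℝ :=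
  (G (flatFermi X y ν p)).bilinearComp (fderiv ℝ (flatFermi X y ν) p)
    (fderiv ℝ (flatFermi X y ν) p)

/-- The product of the induced metric and the Euclidean metric. -/
noncomputable def fermiProduct (G : E → E →L[ℝ] E →L[ℝ] ℝ) (y : F → E)
    (p : F × EuclideanSpace ℝ (Fin k)) :
    F × EuclideanSpace ℝ (Fin k) →L[ℝ] F × EuclideanSpace ℝ (Fin k) →L[ℝ] ℝ :=
  (G (y p.1)).bilinearComp
      (fderiv ℝ y p.1 ∘L ContinuousLinearMap.fst ℝ F (EuclideanSpace ℝ (Fin k)))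
      (fderiv ℝ y p.1 ∘L ContinuousLinearMap.fst ℝ F (EuclideanSpace ℝ (Fin k))) +
    (show EuclideanSpace ℝ (Fin k) →L[ℝ] EuclideanSpace ℝ (Fin k) →L[ℝ] ℝ from
      innerSL ℝ).bilinearComp (ContinuousLinearMap.snd ℝ F (EuclideanSpace ℝ (Fin k)))
      (ContinuousLinearMap.snd ℝ F (EuclideanSpace ℝ (Fin k)))

omit [FiniteDimensional ℝ E] [FiniteDimensional ℝ F] in
lemma fermiPullback_apply (p u v : F × EuclideanSpace ℝ (Fin k)) :
    fermiPullback G X y ν p u v = G (flatFermi X y ν p) (fderiv ℝ (flatFermi X y ν) p u)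
      (fderiv ℝ (flatFermi X y ν) p v) := rfl

omit [FiniteDimensional ℝ E] [FiniteDimensional ℝ F] in
lemma fermiProduct_apply (p u v : F × EuclideanSpace ℝ (Fin k)) :
    fermiProduct G y p u v =
      G (y p.1) (fderiv ℝ y p.1 u.1) (fderiv ℝ y p.1 v.1) + inner ℝ u.2 v.2 := rfl

variable (hG : IsFlatMetricOn G O) (hX : IsGeodesicFamily G O X x₀ r)
  (hν : IsFlatNormalFrame G Z y ν)

omit [FiniteDimensional ℝ E] [FiniteDimensional ℝ F] in
include hX in
lemma IsGeodesicFamily.mem_of_mem_ball {x : E} (hx : x ∈ ball x₀ r) : x ∈ O := by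
  have := hX.mem _ hx 0 (mem_ball_self hX.pos) 0 (by simp)
  rwa [smul_zero, hX.apply_zero _ hx] at this

omit [FiniteDimensional ℝ E] [FiniteDimensional ℝ F] in
include hν in
lemma IsFlatNormalFrame.isOpen_flatFermi_domain (x₀ : E) (r : ℝ) :
    IsOpen {p : F × EuclideanSpace ℝ (Fin k) |
      p.1 ∈ Z ∧ y p.1 ∈ ball x₀ r ∧ normalSum ν p ∈ ball 0 r} := by
  rw [isOpen_iff_mem_nhds]
  rintro p ⟨h1, h2, h3⟩
  have hf : Filter.Tendsto (Prod.fst : F × EuclideanSpace ℝ (Fin k) → F) (𝓝 p) (𝓝 p.1) :=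
    continuousAt_fst
  exact Filter.Eventually.and (hf (hν.isOpen.mem_nhds h1)) (Filter.Eventually.and
    (((hν.contDiffAt h1).continuousAt.tendsto.comp hf) (isOpen_ball.mem_nhds h2))
    ((hν.contDiffAt_normalSum h1).continuousAt (isOpen_ball.mem_nhds h3)))

omit [FiniteDimensional ℝ E] [FiniteDimensional ℝ F] in
include hG hX hν in
lemma fermiProduct_pos {p : F × EuclideanSpace ℝ (Fin k)} (hz : p.1 ∈ Z)
    (hy : y p.1 ∈ ball x₀ r) {u : F × EuclideanSpace ℝ (Fin k)} (hu : u ≠ 0) :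
    0 < fermiProduct G y p u u := by
  rw [fermiProduct_apply]
  have hO := hX.mem_of_mem_ball hy
  have h1 : 0 ≤ G (y p.1) (fderiv ℝ y p.1 u.1) (fderiv ℝ y p.1 u.1) := by
    by_cases h : fderiv ℝ y p.1 u.1 = 0
    · simp [h]
    · exact (hG.pos _ hO _ h).le
  by_cases h2 : u.2 = 0
  · have h3 : u.1 ≠ 0 := fun h3 ↦ hu (Prod.ext h3 h2)
    have h4 : fderiv ℝ y p.1 u.1 ≠ 0 := fun h ↦ h3 (hν.injective _ hz (by rw [h, map_zero]))
    rw [h2, inner_self_eq_zero.2 rfl, add_zero]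
    exact hG.pos _ hO _ h4
  · have := real_inner_self_pos.2 h2
    linarith

omit [FiniteDimensional ℝ F] [FiniteDimensional ℝ E] in
include hG hX hν in
/-- On the submanifold, the pullback of the metric is the product metric. -/
lemma fermiPullback_zero {z : F} (hz : z ∈ Z) (hy : y z ∈ ball x₀ r)
    (u : F × EuclideanSpace ℝ (Fin k)) :
    fermiPullback G X y ν (z, 0) u u = fermiProduct G y (z, 0) u u := by
  have h0 : normalSum ν (z, (0 : EuclideanSpace ℝ (Fin k))) = 0 := by simp [normalSum]
  have h1 : normalVariation ν (z, (0 : EuclideanSpace ℝ (Fin k))) u.1 = 0 := by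
    simp [normalVariation]
  have hn : normalSum ν (z, (0 : EuclideanSpace ℝ (Fin k))) ∈ ball (0 : E) r := by
    rw [h0]; exact mem_ball_self hX.pos
  have h2 := fderiv_flatFermi hX hν (p := (z, 0)) hz hy hn u.1 u.2
  rw [h0, h1, add_zero, hX.fderiv_zero hy] at h2
  have h3 : flatFermi X y ν (z, 0) = y z := by
    rw [flatFermi, h0, hX.apply_zero _ hy]
  rw [fermiPullback_apply, fermiProduct_apply, h2, h3]
  have h4 := hν.inner_fderiv_normalSum hz u.1 u.2
  have h5 := hν.inner_normalSum hz u.2 u.2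
  have h6 := hG.symm _ (hX.mem_of_mem_ball hy) (normalSum ν (z, u.2)) (fderiv ℝ y z u.1)
  simp only [map_add, add_apply, h4, h5, h6]
  ring

include hG hX hν in
/-- Near the submanifold, the Fermi parametrization is a diffeomorphism, and the pullback of the
metric is close to the product metric. -/
theorem exists_flatFermi_patch {z₀ : F} (hz₀ : z₀ ∈ Z) (hy₀ : y z₀ ∈ ball x₀ r)
    (hdim : Module.finrank ℝ F + k = Module.finrank ℝ E) {ε : ℝ} (hε : 0 < ε) :
    ∃ (Θ : OpenPartialHomeomorph (F × EuclideanSpace ℝ (Fin k)) E) (Z' : Set F) (δ : ℝ),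
      0 < δ ∧ IsOpen Z' ∧ z₀ ∈ Z' ∧ Z' ⊆ Z ∧ Θ.source = Z' ×ˢ ball 0 δ ∧
      (Θ : F × EuclideanSpace ℝ (Fin k) → E) = flatFermi X y ν ∧
      (∀ p ∈ Θ.source, y p.1 ∈ ball x₀ r ∧ normalSum ν p ∈ ball 0 r) ∧
      ContDiffOn ℝ ∞ Θ.symm Θ.target ∧
      ∀ p ∈ Θ.source, ∀ u, fermiProduct G y p u u ≤ (1 + ε) * fermiPullback G X y ν p u u ∧
        fermiPullback G X y ν p u u ≤ (1 + ε) * fermiProduct G y p u u := by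
  set K := EuclideanSpace ℝ (Fin k)
  set W : Set (F × K) := {p | p.1 ∈ Z ∧ y p.1 ∈ ball x₀ r ∧ normalSum ν p ∈ ball 0 r}
  have hWo : IsOpen W := hν.isOpen_flatFermi_domain x₀ r
  set p₀ : F × K := (z₀, 0)
  have hn0 : normalSum ν p₀ = 0 := by simp [normalSum, p₀]
  have hp₀ : p₀ ∈ W := ⟨hz₀, hy₀, by rw [hn0]; exact mem_ball_self hX.pos⟩
  have hΨ : ∀ p ∈ W, ContDiffAt ℝ ∞ (flatFermi X y ν) p := fun p hp ↦
    contDiffAt_flatFermi hX hν hp.1 hp.2.1 hp.2.2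
  have hΨO : ∀ p ∈ W, flatFermi X y ν p ∈ O := fun p hp ↦ by
    have := hX.mem _ hp.2.1 _ hp.2.2 1 (by constructor <;> norm_num)
    rwa [one_smul] at this
  have hPc : ContinuousAt (fermiPullback G X y ν) p₀ := by
    refine (continuousOn_bilinearComp (s := W) ?_ ?_).continuousAt (hWo.mem_nhds hp₀)
    · exact hG.contDiffOn.continuousOn.comp
        (fun p hp ↦ (hΨ p hp).continuousAt.continuousWithinAt) hΨO
    · exact fun p hp ↦ ((hΨ p hp).fderiv_right (m := 1) (by
        rw [one_add_one_eq_two]; exact ENat.LEInfty.out)).continuousAt.continuousWithinAt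
  have hQc : ContinuousAt (fermiProduct G y (k := k)) p₀ := by
    refine ContinuousAt.add (f := fun p : F × K ↦ (G (y p.1)).bilinearComp
      (fderiv ℝ y p.1 ∘L ContinuousLinearMap.fst ℝ F K)
      (fderiv ℝ y p.1 ∘L ContinuousLinearMap.fst ℝ F K))
      ((continuousOn_bilinearComp (s := W) ?_ ?_).continuousAt (hWo.mem_nhds hp₀))
      continuousAt_const
    · exact hG.contDiffOn.continuousOn.comp
        (fun p hp ↦ ((hν.contDiffAt hp.1).continuousAt.comp continuousAt_fst).continuousWithinAt)
        fun p hp ↦ hX.mem_of_mem_ball hp.2.1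
    · intro p hp
      have h1 : ContinuousAt (fderiv ℝ y) p.1 := ((hν.contDiffAt hp.1).fderiv_right (m := 1) (by
        rw [one_add_one_eq_two]; exact ENat.LEInfty.out)).continuousAt
      have h2 : ContinuousAt (fun p : F × K ↦ fderiv ℝ y p.1) p :=
        ContinuousAt.comp (f := Prod.fst) h1 continuousAt_fst
      exact (h2.clm_comp continuousAt_const).continuousWithinAt
  have hPQ := fermiPullback_zero hG hX hν hz₀ hy₀
  have hQ0 : ∀ u, u ≠ 0 → 0 < fermiProduct G y p₀ u u := fun u hu ↦
    fermiProduct_pos hG hX hν hz₀ hy₀ hu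
  -- At `p₀` both forms coincide, so the difference is `ε` times a positive definite form.
  -- Positivity survives nearby.
  have ev1 : ∀ᶠ p in 𝓝 p₀, ∀ u, u ≠ 0 →
      0 < ((1 + ε) • fermiPullback G X y ν p - fermiProduct G y p) u u := by
    refine ContinuousAt.eventually_posDef ((hPc.const_smul (1 + ε)).sub hQc) fun u hu ↦ ?_
    simp only [sub_apply, smul_apply, smul_eq_mul, p₀, hPQ]
    have := mul_pos hε (hQ0 u hu)
    simp only [p₀] at this
    linarith
  have ev2 : ∀ᶠ p in 𝓝 p₀, ∀ u, u ≠ 0 →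
      0 < ((1 + ε) • fermiProduct G y p - fermiPullback G X y ν p) u u := by
    refine ContinuousAt.eventually_posDef ((hQc.const_smul (1 + ε)).sub hPc) fun u hu ↦ ?_
    simp only [sub_apply, smul_apply, smul_eq_mul, p₀, hPQ]
    have := mul_pos hε (hQ0 u hu)
    simp only [p₀] at this
    linarith
  have hfr : Module.finrank ℝ (F × K) = Module.finrank ℝ E := by
    rw [Module.finrank_prod, finrank_euclideanSpace_fin, hdim]
  -- A definite pullback forces the differential to be injective, hence invertible by equality of
  -- dimensions.
  have hequiv : ∀ p, (∀ u, u ≠ 0 → 0 < fermiPullback G X y ν p u u) →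
      ∃ L : (F × K) ≃L[ℝ] E, (L : F × K →L[ℝ] E) = fderiv ℝ (flatFermi X y ν) p := by
    intro p hp
    have hi : Function.Injective (fderiv ℝ (flatFermi X y ν) p) := by
      rw [injective_iff_map_eq_zero]
      intro u hu
      by_contra hne
      have := hp u hne
      rw [fermiPullback_apply, hu] at this
      simp at this
    exact ⟨(LinearEquiv.ofInjectiveOfFinrankEq
      (fderiv ℝ (flatFermi X y ν) p : F × K →ₗ[ℝ] E) hi hfr).toContinuousLinearEquiv, by ext <;> rfl⟩
  obtain ⟨L₀, hL₀⟩ := hequiv p₀ fun u hu ↦ by rw [hPQ u]; exact hQ0 u hu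
  have hL₀' : HasFDerivAt (flatFermi X y ν) (L₀ : F × K →L[ℝ] E) p₀ := by
    rw [hL₀]; exact ((hΨ p₀ hp₀).differentiableAt (by simp)).hasFDerivAt
  set Θ₀ := (hΨ p₀ hp₀).toOpenPartialHomeomorph (flatFermi X y ν) hL₀' (by simp)
  have hΘ₀ : p₀ ∈ Θ₀.source :=
    (hΨ p₀ hp₀).mem_toOpenPartialHomeomorph_source hL₀' (by simp)
  have ev := (Filter.Eventually.and (hWo.mem_nhds hp₀) (Θ₀.open_source.mem_nhds hΘ₀)).and
    (ev1.and ev2)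
  obtain ⟨A, hA, B, hB, hAB⟩ := mem_nhds_prod_iff.1 ev
  obtain ⟨Z', hZ'A, hZ'o, hz₀'⟩ := _root_.mem_nhds_iff.1 hA
  obtain ⟨δ, hδ, hδB⟩ := Metric.mem_nhds_iff.1 hB
  have hsub : Z' ×ˢ ball (0 : K) δ ⊆ {p | (p ∈ W ∧ p ∈ Θ₀.source) ∧
      (∀ u, u ≠ 0 → 0 < ((1 + ε) • fermiPullback G X y ν p - fermiProduct G y p) u u) ∧
      ∀ u, u ≠ 0 → 0 < ((1 + ε) • fermiProduct G y p - fermiPullback G X y ν p) u u} :=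
    (prod_mono hZ'A hδB).trans hAB
  have hso : IsOpen (Z' ×ˢ ball (0 : K) δ) := hZ'o.prod isOpen_ball
  have hsrc : (Θ₀.restrOpen _ hso).source = Z' ×ˢ ball (0 : K) δ := by
    rw [OpenPartialHomeomorph.restrOpen_source]
    exact inter_eq_right.2 fun p hp ↦ (hsub hp).1.2
  refine ⟨Θ₀.restrOpen _ hso, Z', δ, hδ, hZ'o, hz₀', ?_, hsrc, rfl, ?_, ?_, ?_⟩
  · exact fun z hz ↦ (hsub (show (z, (0 : K)) ∈ Z' ×ˢ ball (0 : K) δ from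
      ⟨hz, mem_ball_self hδ⟩)).1.1.1
  · intro p hp
    rw [hsrc] at hp
    exact (hsub hp).1.1.2
  · intro e he
    have hp := (Θ₀.restrOpen _ hso).map_target he
    rw [hsrc] at hp
    obtain ⟨⟨hpW, -⟩, h1, -⟩ := hsub hp
    -- A smooth inverse needs an invertible differential at every point, not only at `p₀`. The lower
    -- bound of the metric comparison provides it.
    obtain ⟨L, hL⟩ := hequiv _ fun u hu ↦ by
      have h3 := h1 u hu
      have h4 := fermiProduct_pos hG hX hν hpW.1 hpW.2.1 hu
      simp only [sub_apply, smul_apply, smul_eq_mul] at h3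
      by_contra! h5
      nlinarith
    refine (OpenPartialHomeomorph.contDiffAt_symm _ he (f₀' := L) ?_ (hΨ _ hpW)).contDiffWithinAt
    rw [hL]
    exact ((hΨ _ hpW).differentiableAt (by simp)).hasFDerivAt
  · intro p hp u
    rw [hsrc] at hp
    obtain ⟨-, h1, h2⟩ := hsub hp
    by_cases hu : u = 0
    · simp [hu]
    have h3 := h1 u hu
    have h4 := h2 u hu
    simp only [sub_apply, smul_apply, smul_eq_mul] at h3 h4
    constructor <;> linarith

end FlatFermiPatch

/-! ### Differentials of immersions and tangent vectors in charts. -/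

section Immersion

variable {E F : Type*} [NormedAddCommGroup E] [NormedSpace ℝ E] [NormedAddCommGroup F]
  [NormedSpace ℝ F]
  {M : Type*} [TopologicalSpace M] [ChartedSpace E M] [IsManifold 𝓘(ℝ, E) ∞ M]
  {N : Type*} [TopologicalSpace N] [ChartedSpace F N] [IsManifold 𝓘(ℝ, F) ∞ N]

omit [IsManifold 𝓘(ℝ, E) ∞ M] [IsManifold 𝓘(ℝ, F) ∞ N] in
/-- The differential of an immersion is injective. -/
lemma Manifold.IsImmersionAt.mfderiv_injective {ι : N → M} {q : N}
    (h : IsImmersionAt 𝓘(ℝ, F) 𝓘(ℝ, E) ∞ ι q) :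
    Function.Injective (mfderiv 𝓘(ℝ, F) 𝓘(ℝ, E) ι q) := by
  set d := h.domChart
  set c := h.codChart
  have hd := h.domChart_mem_maximalAtlas
  have hc := h.codChart_mem_maximalAtlas
  have hqd : q ∈ d.source := h.mem_domChart_source
  have hqc : ι q ∈ c.source := h.mem_codChart_source
  have hw : ∀ q' ∈ d.source, (h.equiv.symm (c (ι q'))).1 = d q' := by
    intro q' hq'
    have h0 : d q' ∈ (d.extend 𝓘(ℝ, F)).target := by simpa [mfld_simps] using d.map_source hq'
    have h1 := h.writtenInCharts h0
    simp only [mfld_simps] at h1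
    rw [d.left_inv hq'] at h1
    rw [h1]
    simp
  -- In adapted charts the immersion is the inclusion of the first factor, so projecting back gives
  -- a differentiable local left inverse.
  let ρ : M → N := fun p ↦ d.symm (h.equiv.symm (c p)).1
  have hρ : MDifferentiableAt 𝓘(ℝ, E) 𝓘(ℝ, F) ρ (ι q) := by
    have h1 : MDifferentiableAt 𝓘(ℝ, E) 𝓘(ℝ, E) c (ι q) :=
      ((contMDiffOn_of_mem_maximalAtlas hc).contMDiffAt (c.open_source.mem_nhds hqc)).mdifferentiableAt
        (by simp)
    have h2 : MDifferentiableAt 𝓘(ℝ, E) 𝓘(ℝ, F) (fun x : E ↦ (h.equiv.symm x).1) (c (ι q)) :=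
      ((ContinuousLinearMap.fst ℝ F h.complement ∘L
        (h.equiv.symm : E →L[ℝ] F × h.complement)).differentiableAt).mdifferentiableAt
    have h3 : MDifferentiableAt 𝓘(ℝ, F) 𝓘(ℝ, F) d.symm ((h.equiv.symm (c (ι q))).1) := by
      rw [hw q hqd]
      exact ((contMDiffOn_symm_of_mem_maximalAtlas hd).contMDiffAt
        (d.open_target.mem_nhds (d.map_source hqd))).mdifferentiableAt (by simp)
    exact h3.comp (ι q) (h2.comp (ι q) h1)
  have hι : MDifferentiableAt 𝓘(ℝ, F) 𝓘(ℝ, E) ι q := h.contMDiffAt.mdifferentiableAt (by simp)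
  have h4 : ρ ∘ ι =ᶠ[𝓝 q] id := by
    filter_upwards [d.open_source.mem_nhds hqd] with q' hq'
    simp only [Function.comp_apply, ρ, hw q' hq', d.left_inv hq', id]
  have h5 := mfderiv_comp q hρ hι
  rw [h4.mfderiv_eq, mfderiv_id] at h5
  intro u v huv
  have h6 := congrArg (fun L : F →L[ℝ] F ↦ L u) h5
  have h7 := congrArg (fun L : F →L[ℝ] F ↦ L v) h5
  exact (h6.trans (congrArg (mfderiv 𝓘(ℝ, E) 𝓘(ℝ, F) ρ (ι q)) huv)).trans h7.symm

variable [RiemannianBundle (fun x : M ↦ TangentSpace 𝓘(ℝ, E) x)]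
  {e : OpenPartialHomeomorph M E} {f : OpenPartialHomeomorph N F}

omit [IsManifold 𝓘(ℝ, E) ∞ M] in
-- All tangent spaces have the underlying type `E`, but the inner product depends on the base point;
-- this lets base points that are only propositionally equal be exchanged.
lemma inner_tangentSpace_congr {p p' : M} (h : p = p') (a b : E) :
    @inner ℝ (TangentSpace 𝓘(ℝ, E) p) _ a b = @inner ℝ (TangentSpace 𝓘(ℝ, E) p') _ a b := by
  subst h
  rfl

lemma chartMetric_mfderiv (he : e ∈ atlas E M) {p : M} (hp : p ∈ e.source)
    (a b : TangentSpace 𝓘(ℝ, E) p) :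
    chartMetric e (e p) (mfderiv 𝓘(ℝ, E) 𝓘(ℝ, E) e p a) (mfderiv 𝓘(ℝ, E) 𝓘(ℝ, E) e p b) =
      inner ℝ a b := by
  exact (inner_tangentSpace_congr (e.left_inv hp) _ _).trans
    (congrArg₂ (@inner ℝ (TangentSpace 𝓘(ℝ, E) p) _) (mfderiv_symm_mfderiv_chart he hp a)
      (mfderiv_symm_mfderiv_chart he hp b))

omit [RiemannianBundle (fun x : M ↦ TangentSpace 𝓘(ℝ, E) x)] in
lemma tangentBundle_mk_eq (he : e ∈ atlas E M) {p : M} (hp : p ∈ e.source)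
    (a : TangentSpace 𝓘(ℝ, E) p) :
    (⟨p, a⟩ : TangentBundle 𝓘(ℝ, E) M) =
      ⟨e.symm (e p), mfderiv 𝓘(ℝ, E) 𝓘(ℝ, E) e.symm (e p) (mfderiv 𝓘(ℝ, E) 𝓘(ℝ, E) e p a)⟩ := by
  have key : ∀ p' : M, p' = p → ∀ a : E,
      (⟨p, a⟩ : TangentBundle 𝓘(ℝ, E) M) = ⟨p', a⟩ := by
    rintro p' rfl a
    rfl
  have h1 := mfderiv_symm_mfderiv_chart he hp a
  rw [h1]
  exact key _ (e.left_inv hp) a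

end Immersion

/-! ### Coordinate expressions of the embedding and of normal frames. -/

section FermiChart

variable {m n : ℕ}
  {M : Type*} [TopologicalSpace M] [ChartedSpace (EuclideanSpace ℝ (Fin m)) M]
  [IsManifold (𝓡 m) ∞ M] [RiemannianBundle (fun x : M ↦ TangentSpace (𝓡 m) x)]
  {N : Type*} [TopologicalSpace N] [ChartedSpace (EuclideanSpace ℝ (Fin n)) N]
  {ι : N → M} {ν : Fin (m - n) → ∀ q : N, TangentSpace (𝓡 m) (ι q)} {U : Set N}
  {e : OpenPartialHomeomorph M (EuclideanSpace ℝ (Fin m))}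
  {f : OpenPartialHomeomorph N (EuclideanSpace ℝ (Fin n))}

/-- The coordinate expression of a normal frame. -/
noncomputable def coordNormal (e : OpenPartialHomeomorph M (EuclideanSpace ℝ (Fin m)))
    (f : OpenPartialHomeomorph N (EuclideanSpace ℝ (Fin n)))
    (ν : Fin (m - n) → ∀ q : N, TangentSpace (𝓡 m) (ι q)) (j : Fin (m - n))
    (z : EuclideanSpace ℝ (Fin n)) : EuclideanSpace ℝ (Fin m) :=
  mfderiv (𝓡 m) (𝓡 m) e (ι (f.symm z)) (ν j (f.symm z))

/-- The part of the chart `f` of `N` that lies over `U` and is mapped into the chart `e` of `M`. -/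
def fermiDomain (e : OpenPartialHomeomorph M (EuclideanSpace ℝ (Fin m)))
    (f : OpenPartialHomeomorph N (EuclideanSpace ℝ (Fin n))) (ι : N → M) (U : Set N) :
    Set (EuclideanSpace ℝ (Fin n)) :=
  f.target ∩ f.symm ⁻¹' (U ∩ ι ⁻¹' e.source)

variable [IsManifold (𝓡 n) ∞ N]

omit [RiemannianBundle (fun x : M ↦ TangentSpace (𝓡 m) x)] in
lemma fderiv_coord_embedding (he : e ∈ atlas (EuclideanSpace ℝ (Fin m)) M)
    (hf : f ∈ atlas (EuclideanSpace ℝ (Fin n)) N) (hι : ContMDiff (𝓡 n) (𝓡 m) ∞ ι)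
    {z : EuclideanSpace ℝ (Fin n)} (hz : z ∈ fermiDomain e f ι U) (w : EuclideanSpace ℝ (Fin n)) :
    fderiv ℝ (e ∘ ι ∘ f.symm) z w = mfderiv (𝓡 m) (𝓡 m) e (ι (f.symm z))
      (mfderiv (𝓡 n) (𝓡 m) ι (f.symm z) (mfderiv (𝓡 n) (𝓡 n) f.symm z w)) := by
  have h1 := (mdifferentiable_of_mem_atlas (I := 𝓡 n) hf).mdifferentiableAt_symm hz.1
  have h2 : MDifferentiableAt (𝓡 n) (𝓡 m) ι (f.symm z) := (hι _).mdifferentiableAt (by simp)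
  have h3 := (mdifferentiable_of_mem_atlas (I := 𝓡 m) he).mdifferentiableAt hz.2.2
  rw [← mfderiv_eq_fderiv, mfderiv_comp z h3 (h2.comp z h1), mfderiv_comp z h2 h1]
  rfl

omit [RiemannianBundle (fun x : M ↦ TangentSpace (𝓡 m) x)] in
lemma contDiffOn_coord_embedding (he : e ∈ atlas (EuclideanSpace ℝ (Fin m)) M)
    (hf : f ∈ atlas (EuclideanSpace ℝ (Fin n)) N) (hι : ContMDiff (𝓡 n) (𝓡 m) ∞ ι) :
    ContDiffOn ℝ ∞ (e ∘ ι ∘ f.symm) (fermiDomain e f ι U) :=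
  contMDiffOn_iff_contDiffOn.1 ((contMDiffOn_of_mem_maximalAtlas (I := 𝓡 m) (n := ∞)
    (IsManifold.subset_maximalAtlas he)).comp (hι.comp_contMDiffOn
      ((contMDiffOn_symm_of_mem_maximalAtlas (I := 𝓡 n) (n := ∞)
        (IsManifold.subset_maximalAtlas hf)).mono inter_subset_left)) fun _ hz ↦ hz.2.2)

omit [RiemannianBundle (fun x : M ↦ TangentSpace (𝓡 m) x)] in
lemma injective_fderiv_coord_embedding (he : e ∈ atlas (EuclideanSpace ℝ (Fin m)) M)
    (hf : f ∈ atlas (EuclideanSpace ℝ (Fin n)) N) (hι : IsSmoothEmbedding (𝓡 n) (𝓡 m) ∞ ι)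
    {z : EuclideanSpace ℝ (Fin n)} (hz : z ∈ fermiDomain e f ι U) :
    Function.Injective (fderiv ℝ (e ∘ ι ∘ f.symm) z) := by
  intro u v huv
  rw [fderiv_coord_embedding he hf hι.contMDiff hz,
    fderiv_coord_embedding he hf hι.contMDiff hz] at huv
  have h1 := congrArg (mfderiv (𝓡 m) (𝓡 m) e.symm (e (ι (f.symm z)))) huv
  have h2 := (mfderiv_symm_mfderiv_chart he hz.2.2 _).symm.trans
    (h1.trans (mfderiv_symm_mfderiv_chart he hz.2.2 _))
  have h3 := (hι.isImmersion.isImmersionAt (f.symm z)).mfderiv_injective h2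
  have h4 := congrArg (mfderiv (𝓡 n) (𝓡 n) f (f.symm z)) h3
  exact (mfderiv_chart_mfderiv_symm hf hz.1 u).symm.trans
    (h4.trans (mfderiv_chart_mfderiv_symm hf hz.1 v))

/-- The chart metric makes the differential of the chart an isometry, so orthonormality and
normality carry over. Smoothness passes through the tangent map of the chart. -/
lemma isFlatNormalFrame_coordNormal (he : e ∈ atlas (EuclideanSpace ℝ (Fin m)) M)
    (hf : f ∈ atlas (EuclideanSpace ℝ (Fin n)) N) (hι : IsSmoothEmbedding (𝓡 n) (𝓡 m) ∞ ι)
    (hU : IsOpen U) (hν : IsNormalFrameOn m n ι ν U) :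
    IsFlatNormalFrame (chartMetric e) (fermiDomain e f ι U) (e ∘ ι ∘ f.symm)
      (coordNormal e f ν) := by
  have hιs : ContMDiff (𝓡 n) (𝓡 m) ∞ ι := hι.contMDiff
  have hes := contMDiffOn_of_mem_maximalAtlas (I := 𝓡 m) (n := ∞)
    (IsManifold.subset_maximalAtlas he)
  have hfs := contMDiffOn_symm_of_mem_maximalAtlas (I := 𝓡 n) (n := ∞)
    (IsManifold.subset_maximalAtlas hf)
  have hfs' : ContMDiffOn (𝓡 n) (𝓡 n) ∞ f.symm (fermiDomain e f ι U) :=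
    hfs.mono inter_subset_left
  refine ⟨f.isOpen_inter_preimage_symm (hU.inter (e.open_source.preimage hιs.continuous)),
    contDiffOn_coord_embedding he hf hιs, fun j ↦ ?_,
    fun z hz ↦ injective_fderiv_coord_embedding he hf hι hz, fun z hz i j ↦ ?_,
    fun z hz w j ↦ ?_⟩
  · have h1 := hes.contMDiffOn_tangentMapWithin (m := ∞) (by simp) e.open_source.uniqueMDiffOn
    have h2 := h1.comp (s := U ∩ ι ⁻¹' e.source) ((hν.smooth j).mono inter_subset_left)
      (fun q hq ↦ hq.2)
    have h3 := h2.comp hfs' (fun z hz ↦ hz.2)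
    have h4 : ContMDiff (𝓡 m).tangent (𝓡 m) ∞
        (fun Z : TangentBundle (𝓡 m) (EuclideanSpace ℝ (Fin m)) ↦ Z.snd) := by
      exact contMDiff_snd_tangentBundle_modelSpace _ _
    refine contMDiffOn_iff_contDiffOn.1 ((h4.comp_contMDiffOn h3).congr fun z hz ↦ ?_)
    exact congrArg (fun L : EuclideanSpace ℝ (Fin m) →L[ℝ] EuclideanSpace ℝ (Fin m) ↦
      L (ν j (f.symm z))) (mfderivWithin_of_isOpen e.open_source hz.2.2).symm
  · have h1 := orthonormal_iff_ite.1 (hν.orthonormal _ hz.2.1) i j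
    rw [← h1]
    exact chartMetric_mfderiv he hz.2.2 _ _
  · rw [fderiv_coord_embedding he hf hιs hz]
    exact (chartMetric_mfderiv he hz.2.2 _ _).trans (hν.normal _ hz.2.1 j _)

end FermiChart

lemma hasMFDerivAt_prodMk_space {E E' E'' : Type*} [NormedAddCommGroup E] [NormedSpace ℝ E]
    [NormedAddCommGroup E'] [NormedSpace ℝ E'] [NormedAddCommGroup E''] [NormedSpace ℝ E'']
    {H : Type*} [TopologicalSpace H] {I : ModelWithCorners ℝ E H} {M : Type*} [TopologicalSpace M]
    [ChartedSpace H M] {f : M → E'} {g : M → E''} {x : M} {df : TangentSpace I x →L[ℝ] E'}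
    {dg : TangentSpace I x →L[ℝ] E''} (hf : HasMFDerivAt I 𝓘(ℝ, E') f x df)
    (hg : HasMFDerivAt I 𝓘(ℝ, E'') g x dg) :
    HasMFDerivAt I 𝓘(ℝ, E' × E'') (fun y ↦ (f y, g y)) x (df.prod dg) :=
  ⟨hf.1.prodMk hg.1, hf.2.prodMk hg.2⟩

lemma HasFDerivAt.comp_hasMFDerivAt {E V W : Type*} [NormedAddCommGroup E] [NormedSpace ℝ E]
    [NormedAddCommGroup V] [NormedSpace ℝ V] [NormedAddCommGroup W] [NormedSpace ℝ W]
    {H : Type*} [TopologicalSpace H] {I : ModelWithCorners ℝ E H} {M : Type*} [TopologicalSpace M]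
    [ChartedSpace H M] {g : M → V} {x : M} {g' : TangentSpace I x →L[ℝ] V} {f : V → W}
    {f' : V →L[ℝ] W} (hf : HasFDerivAt f f' (g x)) (hg : HasMFDerivAt I 𝓘(ℝ, V) g x g') :
    HasMFDerivAt I 𝓘(ℝ, W) (f ∘ g) x (f' ∘L g') :=
  HasMFDerivAt.comp x hf.hasMFDerivAt hg

/-! ### Fermi patches on the manifold near a point. -/

section FermiPatch

variable {m n : ℕ}
  {M : Type*} [TopologicalSpace M] [ChartedSpace (EuclideanSpace ℝ (Fin m)) M]
  [IsManifold (𝓡 m) ∞ M] [RiemannianBundle (fun x : M ↦ TangentSpace (𝓡 m) x)]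
  {N : Type*} [TopologicalSpace N] [ChartedSpace (EuclideanSpace ℝ (Fin n)) N]
  [IsManifold (𝓡 n) ∞ N]
  {ι : N → M} {ν : Fin (m - n) → ∀ q : N, TangentSpace (𝓡 m) (ι q)} {U : Set N}
  {e : OpenPartialHomeomorph M (EuclideanSpace ℝ (Fin m))}
  {f : OpenPartialHomeomorph N (EuclideanSpace ℝ (Fin n))}

/-- The inner product of the images of `u` and `v` under the differential of the Fermi
parametrization at `p`. -/
noncomputable def fermiGram (ι : N → M) (ν : Fin (m - n) → ∀ q : N, TangentSpace (𝓡 m) (ι q))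
    (p : N × EuclideanSpace ℝ (Fin (m - n)))
    (u v : EuclideanSpace ℝ (Fin n) × EuclideanSpace ℝ (Fin (m - n))) : ℝ :=
  inner ℝ (mfderiv ((𝓡 n).prod (𝓡 (m - n))) (𝓡 m) (fermiMap m n ι ν) p u)
    (mfderiv ((𝓡 n).prod (𝓡 (m - n))) (𝓡 m) (fermiMap m n ι ν) p v)

/-- `Θ` is a diffeomorphism given by the Fermi parametrization on `V × 𝔹(δ)`, for which the Gauss
lemma holds and the metric is close to the product metric. -/
structure IsFermiPatch (ι : N → M) (ν : Fin (m - n) → ∀ q : N, TangentSpace (𝓡 m) (ι q))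
    (V : Set N) (δ ε : ℝ) (Θ : OpenPartialHomeomorph (N × EuclideanSpace ℝ (Fin (m - n))) M) :
    Prop where
  source_eq : Θ.source = V ×ˢ ball 0 δ
  eqOn : EqOn Θ (fermiMap m n ι ν) Θ.source
  contMDiffOn : ContMDiffOn ((𝓡 n).prod (𝓡 (m - n))) (𝓡 m) ∞ Θ Θ.source
  contMDiffOn_symm : ContMDiffOn (𝓡 m) ((𝓡 n).prod (𝓡 (m - n))) ∞ Θ.symm Θ.target
  apply_zero : ∀ q ∈ V, fermiMap m n ι ν (q, 0) = ι q
  radial : ∀ p ∈ Θ.source, ∀ u, fermiGram ι ν p (0, p.2) u = inner ℝ p.2 u.2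
  ray : ∀ p ∈ Θ.source, ∀ s ∈ Icc (0 : ℝ) 1,
    fermiGram ι ν (p.1, s • p.2) (0, p.2) (0, p.2) = inner ℝ p.2 p.2
  ratio : ∀ p ∈ Θ.source, ∀ u,
    inducedMetric (m := m) ι p.1 u.1 u.1 + inner ℝ u.2 u.2 ≤ (1 + ε) * fermiGram ι ν p u u ∧
      fermiGram ι ν p u u ≤ (1 + ε) * (inducedMetric (m := m) ι p.1 u.1 u.1 + inner ℝ u.2 u.2)

omit [RiemannianBundle (fun x : M ↦ TangentSpace (𝓡 m) x)] in
lemma mfderiv_symm_mfderiv_chart_symm (he : e ∈ atlas (EuclideanSpace ℝ (Fin m)) M)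
    {y : EuclideanSpace ℝ (Fin m)} (hy : y ∈ e.target) (u : TangentSpace (𝓡 m) (e.symm y)) :
    mfderiv (𝓡 m) (𝓡 m) e.symm y (mfderiv (𝓡 m) (𝓡 m) e (e.symm y) u) = u := by
  have key : ∀ y', y' = y → ∀ w : EuclideanSpace ℝ (Fin m),
      (mfderiv (𝓡 m) (𝓡 m) e.symm y' w : EuclideanSpace ℝ (Fin m)) =
        mfderiv (𝓡 m) (𝓡 m) e.symm y w := by
    rintro y' rfl w
    rfl
  exact (key _ (e.right_inv hy) _).symm.trans (mfderiv_symm_mfderiv_chart he (e.map_target hy) u)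

variable [T2Space M]
  [IsContMDiffRiemannianBundle (𝓡 m) ∞ (EuclideanSpace ℝ (Fin m))
    (fun x : M ↦ TangentSpace (𝓡 m) x)]
  {X : EuclideanSpace ℝ (Fin m) × EuclideanSpace ℝ (Fin m) → EuclideanSpace ℝ (Fin m)}
  {x₀ : EuclideanSpace ℝ (Fin m)} {r : ℝ}

section Coordinates

variable (he : e ∈ atlas (EuclideanSpace ℝ (Fin m)) M)
    (hf : f ∈ atlas (EuclideanSpace ℝ (Fin n)) N) (hι : IsSmoothEmbedding (𝓡 n) (𝓡 m) ∞ ι)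
    (hU : IsOpen U) (hν : IsNormalFrameOn m n ι ν U)
    (hX : IsGeodesicFamily (chartMetric e) e.target X x₀ r)
    {z : EuclideanSpace ℝ (Fin n)} {t : EuclideanSpace ℝ (Fin (m - n))}
    (hz : z ∈ fermiDomain e f ι U) (hy : e (ι (f.symm z)) ∈ ball x₀ r)
    (hn : normalSum (coordNormal e f ν) (z, t) ∈ ball 0 r)

omit [IsManifold (𝓡 n) ∞ N] [ChartedSpace (EuclideanSpace ℝ (Fin n)) N] in
include he hX hz hy hn in
-- The differential of the chart is linear and carries the normal vector to its coordinate
-- expression, where the exponential map is known.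
lemma fermiMap_eq_flatFermi : fermiMap m n ι ν (f.symm z, t) =
    e.symm (flatFermi X (e ∘ ι ∘ f.symm) (coordNormal e f ν) (z, t)) := by
  have h1 := riemannianExp_eq he hX hy hn
  rw [flatFermi]
  refine Eq.trans ?_ h1
  rw [fermiMap, tangentBundle_mk_eq he hz.2.2]
  have h2 : (mfderiv (𝓡 m) (𝓡 m) e (ι (f.symm z)) (∑ j, t j • ν j (f.symm z)) :
      EuclideanSpace ℝ (Fin m)) = normalSum (coordNormal e f ν) (z, t) := by
    refine (map_sum (mfderiv (𝓡 m) (𝓡 m) e (ι (f.symm z))) _ _).trans ?_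
    exact Finset.sum_congr rfl fun j _ ↦
      map_smul (mfderiv (𝓡 m) (𝓡 m) e (ι (f.symm z))) (t j) (ν j (f.symm z))
  exact congrArg (fun v : EuclideanSpace ℝ (Fin m) ↦
    riemannianExp (E := EuclideanSpace ℝ (Fin m)) (⟨e.symm (e (ι (f.symm z))),
      mfderiv (𝓡 m) (𝓡 m) e.symm (e (ι (f.symm z))) v⟩ : TangentBundle (𝓡 m) M)) h2

include he hf hι hU hν hX hz hy hn in
-- The Fermi parametrization agrees with `e⁻¹ ∘ Ψ ∘ (f × id)` on a whole neighbourhood, so the chain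
-- rule applies; `e⁻¹` then pulls the metric back to the chart metric.
lemma fermiGram_eq_fermiPullback
    (u v : EuclideanSpace ℝ (Fin n) × EuclideanSpace ℝ (Fin (m - n))) :
    fermiGram ι ν (f.symm z, t) u v =
      fermiPullback (chartMetric e) X (e ∘ ι ∘ f.symm) (coordNormal e f ν) (z, t)
        (mfderiv (𝓡 n) (𝓡 n) f (f.symm z) u.1, u.2)
        (mfderiv (𝓡 n) (𝓡 n) f (f.symm z) v.1, v.2) := by
  have hνf := isFlatNormalFrame_coordNormal he hf hι hU hν
  set Ψ := flatFermi X (e ∘ ι ∘ f.symm) (coordNormal e f ν)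
  have hqs : f.symm z ∈ f.source := f.map_target hz.1
  have hO : Ψ (z, t) ∈ e.target := by
    have := hX.mem _ hy _ hn 1 (by constructor <;> norm_num)
    rwa [one_smul] at this
  have h1 : HasMFDerivAt ((𝓡 n).prod (𝓡 (m - n))) (𝓡 n)
      (fun x : N × EuclideanSpace ℝ (Fin (m - n)) ↦ f x.1) (f.symm z, t) _ :=
    HasMFDerivAt.comp (f.symm z, t)
      ((mdifferentiable_of_mem_atlas (I := 𝓡 n) hf).mdifferentiableAt hqs).hasMFDerivAt
      (hasMFDerivAt_fst _)
  have h2 : HasMFDerivAt ((𝓡 n).prod (𝓡 (m - n))) (𝓡 (m - n))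
      (fun x : N × EuclideanSpace ℝ (Fin (m - n)) ↦ x.2) (f.symm z, t) _ := hasMFDerivAt_snd _
  set g : N × EuclideanSpace ℝ (Fin (m - n)) → EuclideanSpace ℝ (Fin n) ×
    EuclideanSpace ℝ (Fin (m - n)) := fun x ↦ (f x.1, x.2)
  have h3 : HasMFDerivAt ((𝓡 n).prod (𝓡 (m - n)))
      𝓘(ℝ, EuclideanSpace ℝ (Fin n) × EuclideanSpace ℝ (Fin (m - n))) g (f.symm z, t) _ :=
    hasMFDerivAt_prodMk_space h1 h2
  have hg : g (f.symm z, t) = (z, t) := by simp only [g, f.right_inv hz.1]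
  have h4 : HasFDerivAt Ψ (fderiv ℝ Ψ (z, t)) (g (f.symm z, t)) := by
    rw [hg]
    exact ((contDiffAt_flatFermi hX hνf (p := (z, t)) hz hy hn).differentiableAt (by simp)).hasFDerivAt
  have h5 : HasMFDerivAt ((𝓡 n).prod (𝓡 (m - n))) (𝓡 m) (Ψ ∘ g) (f.symm z, t) _ :=
    h4.comp_hasMFDerivAt h3
  have h6 : HasMFDerivAt (𝓡 m) (𝓡 m) e.symm ((Ψ ∘ g) (f.symm z, t))
      (mfderiv (𝓡 m) (𝓡 m) e.symm (Ψ (z, t))) := by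
    rw [Function.comp_apply, hg]
    exact ((mdifferentiable_of_mem_atlas (I := 𝓡 m) he).mdifferentiableAt_symm hO).hasMFDerivAt
  have h7 : HasMFDerivAt ((𝓡 n).prod (𝓡 (m - n))) (𝓡 m) (e.symm ∘ Ψ ∘ g) (f.symm z, t) _ :=
    HasMFDerivAt.comp (f.symm z, t) h6 h5
  have hev : fermiMap m n ι ν =ᶠ[𝓝 (f.symm z, t)]
      e.symm ∘ Ψ ∘ g := by
    have hc : ContinuousAt g (f.symm z, t) := h3.continuousAt
    have h8 := hc ((hνf.isOpen_flatFermi_domain x₀ r).mem_nhds (by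
      rw [hg]; exact ⟨hz, hy, hn⟩))
    filter_upwards [h8, continuousAt_fst (f.open_source.mem_nhds hqs)] with x hx hxs
    have h9 := fermiMap_eq_flatFermi he hX hx.1 hx.2.1 hx.2.2
    have h10 : f.symm (f x.1) = x.1 := f.left_inv hxs
    rw [h10] at h9
    exact h9
  have h8 := (h7.congr_of_eventuallyEq hev).mfderiv
  have h9 : fermiMap m n ι ν (f.symm z, t) = e.symm (Ψ (z, t)) :=
    fermiMap_eq_flatFermi he hX hz hy hn
  exact (congrArg₂ (@inner ℝ (TangentSpace (𝓡 m) (fermiMap m n ι ν (f.symm z, t))) _)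
    (DFunLike.congr_fun h8 u) (DFunLike.congr_fun h8 v)).trans
      (inner_tangentSpace_congr (E := EuclideanSpace ℝ (Fin m)) h9 _ _)

include he hf hι hz in
omit [T2Space M] [IsContMDiffRiemannianBundle (𝓡 m) ∞ (EuclideanSpace ℝ (Fin m))
    (fun x : M ↦ TangentSpace (𝓡 m) x)] in
lemma fermiProduct_eq_inducedMetric
    (u : EuclideanSpace ℝ (Fin n) × EuclideanSpace ℝ (Fin (m - n))) :
    fermiProduct (chartMetric e) (e ∘ ι ∘ f.symm) (z, t)
        (mfderiv (𝓡 n) (𝓡 n) f (f.symm z) u.1, u.2) (mfderiv (𝓡 n) (𝓡 n) f (f.symm z) u.1, u.2) =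
      inducedMetric (m := m) ι (f.symm z) u.1 u.1 + inner ℝ u.2 u.2 := by
  rw [fermiProduct_apply]
  have h1 := fderiv_coord_embedding he hf hι.contMDiff hz
    (mfderiv (𝓡 n) (𝓡 n) f (f.symm z) u.1)
  have h2 := mfderiv_symm_mfderiv_chart_symm hf hz.1 u.1
  have h3 := h1.trans (congrArg (fun w : EuclideanSpace ℝ (Fin n) ↦
    (mfderiv (𝓡 m) (𝓡 m) e (ι (f.symm z))
      (mfderiv (𝓡 n) (𝓡 m) ι (f.symm z) w) : EuclideanSpace ℝ (Fin m))) h2)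
  congr 1
  simp only
  rw [h3]
  exact chartMetric_mfderiv he hz.2.2 _ _

end Coordinates

/-- Existence of Fermi coordinates near a point. -/
theorem exists_isFermiPatch (hnm : n ≤ m) (hι : IsSmoothEmbedding (𝓡 n) (𝓡 m) ∞ ι)
    (hU : IsOpen U) (hν : IsNormalFrameOn m n ι ν U) {q₀ : N} (hq₀ : q₀ ∈ U) {ε : ℝ}
    (hε : 0 < ε) :
    ∃ V : Set N, IsOpen V ∧ q₀ ∈ V ∧ V ⊆ U ∧ ∃ (δ : ℝ)
      (Θ : OpenPartialHomeomorph (N × EuclideanSpace ℝ (Fin (m - n))) M),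
      0 < δ ∧ IsFermiPatch ι ν V δ ε Θ := by
  set e := chartAt (EuclideanSpace ℝ (Fin m)) (ι q₀)
  set f := chartAt (EuclideanSpace ℝ (Fin n)) q₀
  have he : e ∈ atlas (EuclideanSpace ℝ (Fin m)) M := chart_mem_atlas _ _
  have hf : f ∈ atlas (EuclideanSpace ℝ (Fin n)) N := chart_mem_atlas _ _
  have hqf : q₀ ∈ f.source := mem_chart_source _ _
  have hqe : ι q₀ ∈ e.source := mem_chart_source _ _
  have hG := isFlatMetricOn_chartMetric he
  obtain ⟨X, r, hX⟩ := hG.exists_isGeodesicFamily (e.map_source hqe)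
  have hνf := isFlatNormalFrame_coordNormal he hf hι hU hν
  have hz₀ : f q₀ ∈ fermiDomain e f ι U :=
    ⟨f.map_source hqf, by
      simp only [mem_preimage, f.left_inv hqf]
      exact ⟨hq₀, hqe⟩⟩
  obtain ⟨Θ₀, Z', δ, hδ, hZ', hz₀', hZ'Z, hsrc, hΘ₀, hdom, hsymm, hratio⟩ :=
    exists_flatFermi_patch hG hX hνf hz₀
      (by simp only [Function.comp_apply, f.left_inv hqf]; exact mem_ball_self hX.pos)
      (by simp only [finrank_euclideanSpace_fin]; omega) hε
  -- Only the base factor is read in a chart of `N`; the normal coordinates are already Euclidean.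
  let g := f.prod (OpenPartialHomeomorph.refl (EuclideanSpace ℝ (Fin (m - n))))
  have hΨO : ∀ p ∈ Θ₀.source, Θ₀ p ∈ e.target := by
    intro p hp
    have := hX.mem _ (hdom p hp).1 _ (hdom p hp).2 1 (by constructor <;> norm_num)
    rw [one_smul] at this
    rw [hΘ₀]
    exact this
  set Θ := (g.trans Θ₀).trans e.symm
  have hΘsrc : Θ.source = (f.source ∩ f ⁻¹' Z') ×ˢ ball 0 δ := by
    ext p
    simp only [Θ, g, OpenPartialHomeomorph.trans_source, OpenPartialHomeomorph.prod_source,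
      OpenPartialHomeomorph.refl_source, mem_inter_iff, mem_preimage, mem_prod, mem_univ, and_true,
      OpenPartialHomeomorph.prod_apply, OpenPartialHomeomorph.refl_apply, id,
      OpenPartialHomeomorph.symm_source, OpenPartialHomeomorph.coe_trans, Function.comp_apply]
    constructor
    · rintro ⟨⟨h1, h2⟩, -⟩
      rw [hsrc] at h2
      exact ⟨⟨h1, h2.1⟩, h2.2⟩
    · rintro ⟨⟨h1, h2⟩, h3⟩
      have h4 : (f p.1, p.2) ∈ Θ₀.source := by rw [hsrc]; exact ⟨h2, h3⟩
      exact ⟨⟨h1, h4⟩, hΨO _ h4⟩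
  have hpar : ∀ p ∈ Θ.source, ∃ z t, p = (f.symm z, t) ∧ (z, t) ∈ Θ₀.source ∧
      z ∈ fermiDomain e f ι U ∧ e (ι (f.symm z)) ∈ ball (e (ι q₀)) r ∧
        normalSum (coordNormal e f ν) (z, t) ∈ ball 0 r := by
    intro p hp
    rw [hΘsrc] at hp
    have h1 : (f p.1, p.2) ∈ Θ₀.source := by rw [hsrc]; exact ⟨hp.1.2, hp.2⟩
    refine ⟨f p.1, p.2, ?_, h1, hZ'Z hp.1.2, (hdom _ h1).1, (hdom _ h1).2⟩
    rw [f.left_inv hp.1.1]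
  have heq : EqOn Θ (fermiMap m n ι ν) Θ.source := by
    intro p hp
    obtain ⟨z, t, rfl, h1, hz, hy, hn⟩ := hpar p hp
    rw [fermiMap_eq_flatFermi he hX hz hy hn, ← hΘ₀]
    show e.symm (Θ₀ (f (f.symm z), t)) = _
    rw [f.right_inv hz.1]
  refine ⟨f.source ∩ f ⁻¹' Z', f.isOpen_inter_preimage hZ', ⟨hqf, hz₀'⟩, fun q hq ↦ ?_, δ, Θ, hδ,
    hΘsrc, heq, ?_, ?_, ?_, ?_, ?_, ?_⟩
  · have := (hZ'Z hq.2).2.1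
    rwa [f.left_inv hq.1] at this
  · have h1 : ContMDiffOn ((𝓡 n).prod (𝓡 (m - n))) (𝓡 n) ∞
        (fun x : N × EuclideanSpace ℝ (Fin (m - n)) ↦ f x.1) Θ.source :=
      (contMDiffOn_of_mem_maximalAtlas (IsManifold.subset_maximalAtlas hf)).comp
        contMDiff_fst.contMDiffOn fun p hp ↦ by rw [hΘsrc] at hp; exact hp.1.1
    have h2' : ContMDiffOn ((𝓡 n).prod (𝓡 (m - n))) (𝓡 (m - n)) ∞
        (fun x : N × EuclideanSpace ℝ (Fin (m - n)) ↦ x.2) Θ.source := contMDiff_snd.contMDiffOn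
    have h2 := h1.prodMk_space h2'
    have h3 : ContMDiffOn 𝓘(ℝ, EuclideanSpace ℝ (Fin n) × EuclideanSpace ℝ (Fin (m - n))) (𝓡 m) ∞
        Θ₀ Θ₀.source := by
      refine ContDiffOn.contMDiffOn fun p hp ↦ ?_
      rw [hΘ₀]
      have hp' := hp
      rw [hsrc] at hp'
      exact (contDiffAt_flatFermi hX hνf (hZ'Z hp'.1) (hdom p hp).1 (hdom p hp).2).contDiffWithinAt
    have hm : ∀ p ∈ Θ.source, (f p.1, p.2) ∈ Θ₀.source := fun p hp ↦ by
      rw [hΘsrc] at hp; rw [hsrc]; exact ⟨hp.1.2, hp.2⟩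
    exact (contMDiffOn_symm_of_mem_maximalAtlas (IsManifold.subset_maximalAtlas he)).comp
      (h3.comp h2 hm) fun p hp ↦ hΨO _ (hm p hp)
  · have h1 : ContMDiffOn (𝓡 m) (𝓡 m) ∞ e Θ.target :=
      (contMDiffOn_of_mem_maximalAtlas (IsManifold.subset_maximalAtlas he)).mono fun p hp ↦ by
        simpa using hp.1
    have h2 := (hsymm.contMDiffOn).comp h1 fun p hp ↦ by
      simpa using hp.2.1
    have h3 : ContMDiffOn (𝓡 m) (𝓡 n) ∞ (fun p ↦ (Θ₀.symm (e p)).1) Θ.target :=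
      contDiff_fst.contMDiff.comp_contMDiffOn h2
    have h4 : ContMDiffOn (𝓡 m) (𝓡 (m - n)) ∞ (fun p ↦ (Θ₀.symm (e p)).2) Θ.target :=
      contDiff_snd.contMDiff.comp_contMDiffOn h2
    refine ContMDiffOn.prodMk ((contMDiffOn_symm_of_mem_maximalAtlas
      (IsManifold.subset_maximalAtlas hf)).comp h3 fun p hp ↦ ?_) h4
    have h5 : Θ₀.symm (e p) ∈ Θ₀.source := Θ₀.map_target (by simpa using hp.2.1)
    rw [hsrc] at h5
    exact (hZ'Z h5.1).1
  · intro q hq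
    have h1 : (q, (0 : EuclideanSpace ℝ (Fin (m - n)))) ∈ Θ.source := by
      rw [hΘsrc]; exact ⟨hq, mem_ball_self hδ⟩
    obtain ⟨z, t, hzt, -, hz, hy, hn⟩ := hpar _ h1
    obtain ⟨rfl, rfl⟩ := Prod.mk.inj hzt
    have h0 : normalSum (coordNormal e f ν) (z, (0 : EuclideanSpace ℝ (Fin (m - n)))) = 0 := by
      simp [normalSum]
    rw [fermiMap_eq_flatFermi he hX hz hy hn, flatFermi, h0]
    exact (congrArg e.symm (hX.apply_zero _ hy)).trans (e.left_inv hz.2.2)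
  · intro p hp u
    obtain ⟨z, t, rfl, h1, hz, hy, hn⟩ := hpar p hp
    rw [fermiGram_eq_fermiPullback he hf hι hU hν hX hz hy hn, fermiPullback_apply]
    have := inner_fderiv_flatFermi_radial hG hX hνf (p := (z, t)) hz hy hn
      (mfderiv (𝓡 n) (𝓡 n) f (f.symm z) u.1) u.2
    have h0 : (mfderiv (𝓡 n) (𝓡 n) f (f.symm z) (0 : EuclideanSpace ℝ (Fin n)) :
      EuclideanSpace ℝ (Fin n)) = 0 := map_zero _
    rw [h0]
    exact this
  · intro p hp s hs
    obtain ⟨z, t, rfl, h1, hz, hy, hn⟩ := hpar p hp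
    have hn' : normalSum (coordNormal e f ν) (z, s • t) ∈ ball 0 r := by
      rw [normalSum_smul, mem_ball_zero_iff, norm_smul, Real.norm_eq_abs, abs_of_nonneg hs.1]
      rw [mem_ball_zero_iff] at hn
      exact (mul_le_of_le_one_left (norm_nonneg _) hs.2).trans_lt hn
    rw [fermiGram_eq_fermiPullback he hf hι hU hν hX hz hy hn', fermiPullback_apply]
    have := inner_fderiv_flatFermi_ray hG hX hνf (p := (z, t)) hz hy hn hs
    have h0 : (mfderiv (𝓡 n) (𝓡 n) f (f.symm z) (0 : EuclideanSpace ℝ (Fin n)) :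
      EuclideanSpace ℝ (Fin n)) = 0 := map_zero _
    rw [h0]
    exact this
  · intro p hp u
    obtain ⟨z, t, rfl, h1, hz, hy, hn⟩ := hpar p hp
    rw [fermiGram_eq_fermiPullback he hf hι hU hν hX hz hy hn,
      ← fermiProduct_eq_inducedMetric he hf hι hz]
    exact hratio _ h1 _

end FermiPatch

/-! ### Local orthonormal frames of the normal bundle and existence of Fermi atlases. -/

lemma contMDiffOn_tangentBundle_vectorSpace {E E' : Type*} [NormedAddCommGroup E] [NormedSpace ℝ E]
    [NormedAddCommGroup E'] [NormedSpace ℝ E'] {H : Type*} [TopologicalSpace H]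
    {I : ModelWithCorners ℝ E' H} {N : Type*} [TopologicalSpace N] [ChartedSpace H N]
    {n : WithTop ℕ∞} {g V : N → E} {s : Set N} (hg : ContMDiffOn I 𝓘(ℝ, E) n g s)
    (hV : ContMDiffOn I 𝓘(ℝ, E) n V s) :
    ContMDiffOn I 𝓘(ℝ, E).tangent n (fun x ↦ (⟨g x, V x⟩ : TangentBundle 𝓘(ℝ, E) E)) s := by
  intro x hx
  apply Bundle.contMDiffWithinAt_totalSpace.2
  refine ⟨hg x hx, ?_⟩
  convert! hV x hx with y
  simp

/-- Smooth dependence of the Gram-Schmidt process on parameters. -/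
theorem exists_contDiffOn_orthonormal {E F : Type*} [NormedAddCommGroup E] [NormedSpace ℝ E]
    [NormedAddCommGroup F] [NormedSpace ℝ F] {B : F → E →L[ℝ] E →L[ℝ] ℝ} {Z : Set F}
    (hZ : IsOpen Z) (hB : ContDiffOn ℝ ∞ B Z) (hsymm : ∀ z ∈ Z, ∀ u v, B z u v = B z v u)
    (hpos : ∀ z ∈ Z, ∀ u, u ≠ 0 → 0 < B z u u) {z₀ : F} (hz₀ : z₀ ∈ Z) (N : ℕ)
    (b : Fin N → F → E) (hb : ∀ i, ContDiffOn ℝ ∞ (b i) Z)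
    (hli : LinearIndependent ℝ fun i ↦ b i z₀) :
    ∃ Z' : Set F, IsOpen Z' ∧ z₀ ∈ Z' ∧ Z' ⊆ Z ∧ ∃ ν : Fin N → F → E,
      (∀ i, ContDiffOn ℝ ∞ (ν i) Z') ∧
      (∀ z ∈ Z', ∀ i j, B z (ν i z) (ν j z) = if i = j then 1 else 0) ∧
      (∀ z ∈ Z', ∀ i j, i < j → B z (b i z) (ν j z) = 0) ∧
      (∀ z ∈ Z', ∀ v, (∀ j, B z (ν j z) v = 0) → ∀ i, B z (b i z) v = 0) ∧
      ∀ z ∈ Z', ∀ j, ν j z ∈ Submodule.span ℝ (range fun i ↦ b i z) := by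
  -- The triangular relations are what the application needs. The transfer of orthogonality is
  -- carried along to prove them for the new vector, and the span clause to see that the new vector
  -- does not vanish at `z₀`.
  induction N with
  | zero =>
    exact ⟨Z, hZ, hz₀, subset_rfl, fun i ↦ i.elim0, fun i ↦ i.elim0, fun _ _ i ↦ i.elim0,
      fun _ _ i ↦ i.elim0, fun _ _ _ _ i ↦ i.elim0, fun _ _ i ↦ i.elim0⟩
  | succ N ih =>
    obtain ⟨hli', hnot⟩ := linearIndependent_finSucc'.1 hli
    obtain ⟨Z₁, hZ₁, hz₁, hZ₁Z, ν, hν, horth, htri, hperp, hspan⟩ :=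
      ih (fun i ↦ b i.castSucc) (fun i ↦ hb _) hli'
    set w : F → E := fun z ↦ b (Fin.last N) z - ∑ j, B z (b (Fin.last N) z) (ν j z) • ν j z
    have hB₁ := hB.mono hZ₁Z
    have hb₁ : ∀ i, ContDiffOn ℝ ∞ (b i) Z₁ := fun i ↦ (hb i).mono hZ₁Z
    have hw : ContDiffOn ℝ ∞ w Z₁ := by
      refine (hb₁ _).sub (ContDiffOn.sum fun j _ ↦ ?_)
      exact ((hB₁.clm_apply (hb₁ _)).clm_apply (hν j)).smul (hν j)
    have hw₀ : w z₀ ≠ 0 := by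
      intro h
      refine hnot ?_
      have h1 : b (Fin.last N) z₀ = ∑ j, B z₀ (b (Fin.last N) z₀) (ν j z₀) • ν j z₀ :=
        sub_eq_zero.1 h
      rw [h1]
      exact Submodule.sum_mem _ fun j _ ↦ Submodule.smul_mem _ _ (hspan z₀ hz₁ j)
    have hwν : ∀ z ∈ Z₁, ∀ j, B z (ν j z) (w z) = 0 := by
      intro z hz j
      simp only [w, map_sub, map_sum, map_smul, smul_eq_mul, horth z hz]
      simp [hsymm z (hZ₁Z hz) (b (Fin.last N) z)]
    -- Linear independence is assumed at `z₀` only, so the domain shrinks to where the projected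
    -- vector can be normalized.
    set Z₂ : Set F := Z₁ ∩ w ⁻¹' {0}ᶜ
    have hZ₂ : IsOpen Z₂ := hw.continuousOn.isOpen_inter_preimage hZ₁ isOpen_compl_singleton
    have hN : ∀ z ∈ Z₂, 0 < B z (w z) (w z) := fun z hz ↦ hpos z (hZ₁Z hz.1) _ hz.2
    set u : F → E := fun z ↦ (√(B z (w z) (w z)))⁻¹ • w z
    have hw₂ : ContDiffOn ℝ ∞ w Z₂ := hw.mono inter_subset_left
    have hu : ContDiffOn ℝ ∞ u Z₂ := by
      have h1 : ContDiffOn ℝ ∞ (fun z ↦ B z (w z) (w z)) Z₂ :=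
        ((hB₁.mono inter_subset_left).clm_apply hw₂).clm_apply hw₂
      exact ((h1.sqrt fun z hz ↦ (hN z hz).ne').inv
        fun z hz ↦ (Real.sqrt_pos.2 (hN z hz)).ne').smul hw₂
    have huu : ∀ z ∈ Z₂, B z (u z) (u z) = 1 := by
      intro z hz
      have h1 := Real.sq_sqrt (hN z hz).le
      have h2 := Real.sqrt_pos.2 (hN z hz)
      simp only [u, map_smul, smul_apply, smul_eq_mul]
      field_simp
      exact h1.symm
    have huν : ∀ z ∈ Z₂, ∀ j, B z (ν j z) (u z) = 0 := fun z hz j ↦ by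
      simp [u, hwν z hz.1 j]
    refine ⟨Z₂, hZ₂, ⟨hz₁, hw₀⟩, inter_subset_left.trans hZ₁Z,
      Fin.snoc (α := fun _ ↦ F → E) ν u, fun i ↦ ?_, fun z hz i j ↦ ?_, fun z hz i j hij ↦ ?_,
      fun z hz v hv i ↦ ?_, fun z hz j ↦ ?_⟩
    · induction i using Fin.lastCases with
      | last => simpa using hu
      | cast i => simpa using (hν i).mono inter_subset_left
    · induction i using Fin.lastCases with
      | last =>
        induction j using Fin.lastCases with
        | last => simpa using huu z hz
        | cast j =>
          have := huν z hz j
          rw [hsymm z (hZ₁Z hz.1)] at this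
          simpa [(Fin.castSucc_lt_last j).ne'] using this
      | cast i =>
        induction j using Fin.lastCases with
        | last => simpa [(Fin.castSucc_lt_last i).ne] using huν z hz i
        | cast j => simpa using horth z hz.1 i j
    · induction i using Fin.lastCases with
      | last => exact absurd hij (Fin.le_last j).not_gt
      | cast i =>
        induction j using Fin.lastCases with
        | last => simpa using hperp z hz.1 (u z) (huν z hz) i
        | cast j => simpa using htri z hz.1 i j (by simpa using hij)
    · have hv' : ∀ j, B z (ν j z) v = 0 := fun j ↦ by simpa using hv j.castSucc
      induction i using Fin.lastCases with
      | cast i => exact hperp z hz.1 v hv' i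
      | last =>
        have h1 : B z (u z) v = 0 := by simpa using hv (Fin.last N)
        have h2 : B z (w z) v = 0 := by
          have h3 := (Real.sqrt_pos.2 (hN z hz)).ne'
          simpa [u, h3] using h1
        have h4 : b (Fin.last N) z =
            w z + ∑ j, B z (b (Fin.last N) z) (ν j z) • ν j z := by simp [w]
        rw [h4, map_add, add_apply, h2, zero_add]
        simp [hv']
    · have hle : Submodule.span ℝ (range fun i : Fin N ↦ b i.castSucc z) ≤
          Submodule.span ℝ (range fun i ↦ b i z) :=
        Submodule.span_mono (by rintro _ ⟨i, rfl⟩; exact ⟨i.castSucc, rfl⟩)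
      induction j using Fin.lastCases with
      | cast j => simpa using hle (hspan z hz.1 j)
      | last =>
        simp only [Fin.snoc_last, u]
        refine Submodule.smul_mem _ _ (Submodule.sub_mem _ (Submodule.subset_span ⟨_, rfl⟩) ?_)
        exact Submodule.sum_mem _ fun j _ ↦ Submodule.smul_mem _ _ (hle (hspan z hz.1 j))

/-- Orthonormal frames of the normal spaces of a parametrized submanifold exist locally. -/
theorem exists_isFlatNormalFrame {E F : Type*} [NormedAddCommGroup E] [NormedSpace ℝ E]
    [NormedAddCommGroup F] [NormedSpace ℝ F] [FiniteDimensional ℝ E] [FiniteDimensional ℝ F] {k : ℕ}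
    {G : E → E →L[ℝ] E →L[ℝ] ℝ} {O : Set E} (hG : IsFlatMetricOn G O) {Z : Set F} {y : F → E}
    (hZ : IsOpen Z) (hy : ContDiffOn ℝ ∞ y Z) (hyO : ∀ z ∈ Z, y z ∈ O)
    (hinj : ∀ z ∈ Z, Function.Injective (fderiv ℝ y z))
    (hdim : Module.finrank ℝ F + k = Module.finrank ℝ E) {z₀ : F} (hz₀ : z₀ ∈ Z) :
    ∃ (Z' : Set F) (ν : Fin k → F → E), z₀ ∈ Z' ∧ Z' ⊆ Z ∧ IsFlatNormalFrame G Z' y ν := by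
  let bF := Module.finBasis ℝ F
  set R := LinearMap.range (fderiv ℝ y z₀ : F →ₗ[ℝ] E)
  obtain ⟨C, hC⟩ := R.exists_isCompl
  have hR : Module.finrank ℝ R = Module.finrank ℝ F :=
    LinearMap.finrank_range_of_inj (hinj z₀ hz₀)
  have hCk : Module.finrank ℝ C = k := by
    have := Submodule.finrank_add_eq_of_isCompl hC
    omega
  let bC := Module.finBasisOfFinrankEq ℝ C hCk
  -- The tangent vectors come first and constant vectors spanning a complement at `z₀` follow.
  -- Triangularity then makes the last `k` orthonormal vectors normal at every nearby point.
  let b : Fin (Module.finrank ℝ F + k) → F → E :=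
    Fin.append (fun i z ↦ fderiv ℝ y z (bF i)) (fun j _ ↦ (bC j : E))
  have hyd : ContDiffOn ℝ ∞ (fderiv ℝ y) Z := hy.fderiv_of_isOpen hZ (by simp)
  have hb : ∀ i, ContDiffOn ℝ ∞ (b i) Z := by
    intro i
    induction i using Fin.addCases with
    | left i =>
      simp only [b, Fin.append_left]
      exact hyd.clm_apply contDiffOn_const
    | right j =>
      simp only [b, Fin.append_right]
      exact contDiffOn_const
  have hli : LinearIndependent ℝ fun i ↦ b i z₀ := by
    have h1 : LinearIndependent ℝ fun i ↦ fderiv ℝ y z₀ (bF i) :=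
      bF.linearIndependent.map' (fderiv ℝ y z₀ : F →ₗ[ℝ] E)
        (LinearMap.ker_eq_bot.2 (hinj z₀ hz₀))
    have h2 : LinearIndependent ℝ fun j ↦ (bC j : E) :=
      bC.linearIndependent.map' C.subtype (Submodule.ker_subtype C)
    have h3 := h1.sum_type h2 (hC.disjoint.mono
      (Submodule.span_le.2 (by rintro _ ⟨i, rfl⟩; exact ⟨_, rfl⟩))
      (Submodule.span_le.2 (by rintro _ ⟨i, rfl⟩; exact (bC i).2)))
    have h4 : (fun i ↦ b i z₀) ∘ finSumFinEquiv =
        Sum.elim (fun i ↦ fderiv ℝ y z₀ (bF i)) fun j ↦ (bC j : E) := by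
      ext i
      rcases i with i | j <;> simp [b]
    rw [← linearIndependent_equiv finSumFinEquiv, h4]
    exact h3
  have hcomp : ContDiffOn ℝ ∞ (fun z ↦ G (y z)) Z := hG.contDiffOn.comp hy hyO
  obtain ⟨Z', hZ', hz', hZ'Z, ν, hν, horth, htri, -, -⟩ :=
    exists_contDiffOn_orthonormal hZ hcomp (fun z hz ↦ hG.symm _ (hyO z hz))
      (fun z hz ↦ hG.pos _ (hyO z hz)) hz₀ _ b hb hli
  refine ⟨Z', fun j ↦ ν (Fin.natAdd _ j), hz', hZ'Z, hZ', hy.mono hZ'Z, fun j ↦ hν _,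
    fun z hz ↦ hinj z (hZ'Z hz), fun z hz i j ↦ ?_, fun z hz w j ↦ ?_⟩
  · simp [horth z hz]
  · have h1 : ∀ i, G (y z) (fderiv ℝ y z (bF i)) (ν (Fin.natAdd _ j) z) = 0 := fun i ↦ by
      have := htri z hz (Fin.castAdd k i) (Fin.natAdd _ j) (by
        rw [Fin.lt_def]; simp only [Fin.val_castAdd, Fin.val_natAdd]; omega)
      simpa [b] using this
    rw [← bF.sum_repr w]
    simp only [map_sum, map_smul, sum_apply, smul_apply, h1, smul_zero, Finset.sum_const_zero]

section FermiAtlas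

variable {m n : ℕ}
  {M : Type*} [TopologicalSpace M] [ChartedSpace (EuclideanSpace ℝ (Fin m)) M]
  [IsManifold (𝓡 m) ∞ M] [RiemannianBundle (fun x : M ↦ TangentSpace (𝓡 m) x)]
  [IsContMDiffRiemannianBundle (𝓡 m) ∞ (EuclideanSpace ℝ (Fin m))
    (fun x : M ↦ TangentSpace (𝓡 m) x)]
  {N : Type*} [TopologicalSpace N] [ChartedSpace (EuclideanSpace ℝ (Fin n)) N]
  [IsManifold (𝓡 n) ∞ N] {ι : N → M}

/-- Smooth orthonormal frames of the normal bundle exist locally. -/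
theorem exists_isNormalFrameOn (hnm : n ≤ m) (hι : IsSmoothEmbedding (𝓡 n) (𝓡 m) ∞ ι) (q₀ : N) :
    ∃ (U : Set N) (ν : Fin (m - n) → ∀ q : N, TangentSpace (𝓡 m) (ι q)),
      IsOpen U ∧ q₀ ∈ U ∧ IsNormalFrameOn m n ι ν U := by
  set e := chartAt (EuclideanSpace ℝ (Fin m)) (ι q₀)
  set f := chartAt (EuclideanSpace ℝ (Fin n)) q₀
  have he : e ∈ atlas (EuclideanSpace ℝ (Fin m)) M := chart_mem_atlas _ _
  have hf : f ∈ atlas (EuclideanSpace ℝ (Fin n)) N := chart_mem_atlas _ _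
  have hqf : q₀ ∈ f.source := mem_chart_source _ _
  have hqe : ι q₀ ∈ e.source := mem_chart_source _ _
  have hes := contMDiffOn_symm_of_mem_maximalAtlas (I := 𝓡 m) (n := ∞)
    (IsManifold.subset_maximalAtlas he)
  have hG := isFlatMetricOn_chartMetric he
  have hz₀ : f q₀ ∈ fermiDomain e f ι univ :=
    ⟨f.map_source hqf, by
      simp only [mem_preimage, f.left_inv hqf]
      exact ⟨mem_univ _, hqe⟩⟩
  have hZ : IsOpen (fermiDomain e f ι univ) :=
    f.isOpen_inter_preimage_symm (isOpen_univ.inter (e.open_source.preimage hι.contMDiff.continuous))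
  obtain ⟨Z, ν, hz₀', hZsub, hν⟩ := exists_isFlatNormalFrame (k := m - n) hG hZ
    (contDiffOn_coord_embedding he hf hι.contMDiff)
    (fun z hz ↦ e.map_source hz.2.2) (fun z hz ↦ injective_fderiv_coord_embedding he hf hι hz)
    (by simp only [finrank_euclideanSpace_fin]; omega) hz₀
  have hU : ∀ q ∈ f.source ∩ f ⁻¹' Z, ι q ∈ e.source := fun q hq ↦ by
    have := (hZsub hq.2).2.2
    rwa [mem_preimage, f.left_inv hq.1] at this
  let ν' : Fin (m - n) → ∀ q : N, TangentSpace (𝓡 m) (ι q) := fun j q ↦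
    (mfderiv (𝓡 m) (𝓡 m) e.symm (e (ι q)) (ν j (f q)) : EuclideanSpace ℝ (Fin m))
  have hν' : ∀ q ∈ f.source ∩ f ⁻¹' Z, ∀ j,
      mfderiv (𝓡 m) (𝓡 m) e (ι q) (ν' j q) = ν j (f q) := by
    intro q hq j
    have key : ∀ p, p = ι q → ∀ w : EuclideanSpace ℝ (Fin m),
        (mfderiv (𝓡 m) (𝓡 m) e p w : EuclideanSpace ℝ (Fin m)) =
          mfderiv (𝓡 m) (𝓡 m) e (ι q) w := by
      rintro p rfl w
      rfl
    exact (key _ (e.left_inv (hU q hq)) _).symm.trans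
      (mfderiv_chart_mfderiv_symm he (e.map_source (hU q hq)) _)
  have hin : ∀ q ∈ f.source ∩ f ⁻¹' Z, ∀ a b : TangentSpace (𝓡 m) (ι q),
      inner ℝ a b = chartMetric e (e (ι q)) (mfderiv (𝓡 m) (𝓡 m) e (ι q) a)
        (mfderiv (𝓡 m) (𝓡 m) e (ι q) b) := fun q hq a b ↦
    (chartMetric_mfderiv he (hU q hq) a b).symm
  refine ⟨f.source ∩ f ⁻¹' Z, ν', f.isOpen_inter_preimage hν.isOpen, ⟨hqf, hz₀'⟩, fun j ↦ ?_,
    fun q hq ↦ ?_, fun q hq j w ↦ ?_⟩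
  · have hfs : ContMDiffOn (𝓡 n) (𝓡 n) ∞ f (f.source ∩ f ⁻¹' Z) :=
      (contMDiffOn_of_mem_maximalAtlas (IsManifold.subset_maximalAtlas hf)).mono inter_subset_left
    have h1 : ContMDiffOn (𝓡 n) (𝓡 m) ∞ (fun q ↦ e (ι q)) (f.source ∩ f ⁻¹' Z) :=
      (contMDiffOn_of_mem_maximalAtlas (IsManifold.subset_maximalAtlas he)).comp
        hι.contMDiff.contMDiffOn hU
    have h2 : ContMDiffOn (𝓡 n) (𝓡 m) ∞ (fun q ↦ ν j (f q)) (f.source ∩ f ⁻¹' Z) :=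
      (hν.contDiffOn_frame j).contMDiffOn.comp hfs fun q hq ↦ hq.2
    have h3 := hes.contMDiffOn_tangentMapWithin (m := ∞) (by simp) e.open_target.uniqueMDiffOn
    refine (h3.comp (contMDiffOn_tangentBundle_vectorSpace h1 h2)
      fun q hq ↦ e.map_source (hU q hq)).congr fun q hq ↦ ?_
    have key : ∀ p, p = ι q → ∀ a : EuclideanSpace ℝ (Fin m),
        (⟨ι q, a⟩ : TangentBundle (𝓡 m) M) = ⟨p, a⟩ := by
      rintro p rfl a
      rfl
    refine (key _ (e.left_inv (hU q hq)) _).trans ?_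
    simp only [Function.comp_apply, tangentMapWithin,
      mfderivWithin_of_isOpen e.open_target (e.map_source (hU q hq))]
    rfl
  · rw [orthonormal_iff_ite]
    intro i j
    refine (hin q hq _ _).trans ?_
    rw [hν' q hq, hν' q hq]
    have := hν.orthonormal (f q) hq.2 i j
    simpa only [Function.comp_apply, f.left_inv hq.1] using this
  · refine (hin q hq _ _).trans ?_
    rw [hν' q hq]
    have h1 := fderiv_coord_embedding he hf hι.contMDiff (hZsub hq.2)
      (mfderiv (𝓡 n) (𝓡 n) f q w)
    have h2 := mfderiv_symm_mfderiv_chart hf hq.1 w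
    have key : ∀ q', q' = q → ∀ w : EuclideanSpace ℝ (Fin n),
        (mfderiv (𝓡 m) (𝓡 m) e (ι q') (mfderiv (𝓡 n) (𝓡 m) ι q' w) : EuclideanSpace ℝ (Fin m)) =
          mfderiv (𝓡 m) (𝓡 m) e (ι q) (mfderiv (𝓡 n) (𝓡 m) ι q w) := by
      rintro q' rfl w
      rfl
    have h3 := h1.trans ((key _ (f.left_inv hq.1) _).trans (congrArg
      (fun w : EuclideanSpace ℝ (Fin n) ↦ (mfderiv (𝓡 m) (𝓡 m) e (ι q)
        (mfderiv (𝓡 n) (𝓡 m) ι q w) : EuclideanSpace ℝ (Fin m))) h2))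
    have h4 := hν.normal (f q) hq.2 (mfderiv (𝓡 n) (𝓡 n) f q w) j
    rw [h3] at h4
    simp only [Function.comp_apply, f.left_inv hq.1] at h4
    exact h4

/-- Fermi atlases exist. -/
theorem nonempty_fermiAtlas [CompactSpace N] [RegularSpace N] (hnm : n ≤ m)
    (hι : IsSmoothEmbedding (𝓡 n) (𝓡 m) ∞ ι) : Nonempty (FermiAtlas m n ι) := by
  choose U ν hU hq hν using fun q ↦ exists_isNormalFrameOn hnm hι q
  have hV : ∀ q, ∃ V : Set N, IsOpen V ∧ q ∈ V ∧ closure V ⊆ U q := fun q ↦ by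
    obtain ⟨V, hV, hVo, hVU⟩ :=
      exists_mem_nhds_isClosed_subset ((hU q).mem_nhds (hq q))
    exact ⟨interior V, isOpen_interior, mem_interior_iff_mem_nhds.2 hV,
      (closure_minimal interior_subset hVo).trans hVU⟩
  choose V hVo hqV hVU using hV
  obtain ⟨T, hT⟩ := isCompact_univ.elim_finite_subcover V hVo fun q _ ↦ mem_iUnion.2 ⟨q, hqV q⟩
  exact ⟨{
    card := T.card
    U := fun i ↦ U (T.equivFin.symm i)
    V := fun i ↦ V (T.equivFin.symm i)
    ν := fun i ↦ ν (T.equivFin.symm i)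
    isOpen_U := fun i ↦ hU _
    isOpen_V := fun i ↦ hVo _
    closure_subset := fun i ↦ hVU _
    cover := by
      refine eq_univ_of_univ_subset fun q hq ↦ ?_
      obtain ⟨q', hq', hqq'⟩ := mem_iUnion₂.1 (hT hq)
      refine mem_iUnion.2 ⟨T.equivFin ⟨q', hq'⟩, ?_⟩
      simpa using hqq'
    frame := fun i ↦ hν _ }⟩

end FermiAtlas

/-! ### Consequences of the patch estimates. -/

namespace IsFermiPatch

variable {m n : ℕ}
  {M : Type*} [TopologicalSpace M] [ChartedSpace (EuclideanSpace ℝ (Fin m)) M]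
  [RiemannianBundle (fun x : M ↦ TangentSpace (𝓡 m) x)]
  {N : Type*} [TopologicalSpace N] [ChartedSpace (EuclideanSpace ℝ (Fin n)) N]
  {ι : N → M} {ν : Fin (m - n) → ∀ q : N, TangentSpace (𝓡 m) (ι q)} {V : Set N} {δ ε : ℝ}
  {Θ : OpenPartialHomeomorph (N × EuclideanSpace ℝ (Fin (m - n))) M}

lemma mono (h : IsFermiPatch ι ν V δ ε Θ) {V' : Set N} {δ' : ℝ} (hV' : IsOpen V') (hV : V' ⊆ V)
    (hδ : δ' ≤ δ) : ∃ Θ', IsFermiPatch ι ν V' δ' ε Θ' := by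
  have hso : IsOpen (V' ×ˢ ball (0 : EuclideanSpace ℝ (Fin (m - n))) δ') := hV'.prod isOpen_ball
  have hsub : V' ×ˢ ball (0 : EuclideanSpace ℝ (Fin (m - n))) δ' ⊆ Θ.source := by
    rw [h.source_eq]
    exact prod_mono hV (ball_subset_ball hδ)
  have hsrc : (Θ.restrOpen _ hso).source = V' ×ˢ ball 0 δ' := by
    rw [OpenPartialHomeomorph.restrOpen_source]
    exact inter_eq_right.2 hsub
  refine ⟨Θ.restrOpen _ hso, hsrc, ?_, ?_, ?_, fun q hq ↦ h.apply_zero q (hV hq), ?_, ?_, ?_⟩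
  · rw [hsrc]; exact h.eqOn.mono hsub
  · rw [hsrc]; exact h.contMDiffOn.mono hsub
  · refine h.contMDiffOn_symm.mono fun p hp ↦ ?_
    exact hp.1
  · rw [hsrc]; exact fun p hp ↦ h.radial p (hsub hp)
  · rw [hsrc]; exact fun p hp ↦ h.ray p (hsub hp)
  · rw [hsrc]; exact fun p hp ↦ h.ratio p (hsub hp)

lemma contMDiffAt (h : IsFermiPatch ι ν V δ ε Θ) {p : N × EuclideanSpace ℝ (Fin (m - n))}
    (hp : p ∈ Θ.source) :
    ContMDiffAt ((𝓡 n).prod (𝓡 (m - n))) (𝓡 m) ∞ (fermiMap m n ι ν) p :=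
  (h.contMDiffOn.contMDiffAt (Θ.open_source.mem_nhds hp)).congr_of_eventuallyEq
    (Filter.eventuallyEq_of_mem (Θ.open_source.mem_nhds hp) h.eqOn.symm)

lemma mfderiv_fermiMap_symm (h : IsFermiPatch ι ν V δ ε Θ) {x : M} (hx : x ∈ Θ.target)
    (v : TangentSpace (𝓡 m) x) :
    (mfderiv ((𝓡 n).prod (𝓡 (m - n))) (𝓡 m) (fermiMap m n ι ν) (Θ.symm x)
      (mfderiv (𝓡 m) ((𝓡 n).prod (𝓡 (m - n))) Θ.symm x v) : EuclideanSpace ℝ (Fin m)) = v := by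
  have h1 : MDifferentiableAt (𝓡 m) ((𝓡 n).prod (𝓡 (m - n))) Θ.symm x :=
    (h.contMDiffOn_symm.contMDiffAt (Θ.open_target.mem_nhds hx)).mdifferentiableAt (by simp)
  have h2 := (h.contMDiffAt (Θ.map_target hx)).mdifferentiableAt (by simp)
  have h3 : fermiMap m n ι ν ∘ Θ.symm =ᶠ[𝓝 x] id := by
    filter_upwards [Θ.open_target.mem_nhds hx] with y hy
    rw [Function.comp_apply, ← h.eqOn (Θ.map_target hy), Θ.right_inv hy, id]
  have h4 := mfderiv_comp x h2 h1
  rw [h3.mfderiv_eq, mfderiv_id] at h4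
  exact (DFunLike.congr_fun h4 v).symm

lemma fermiGram_mfderiv_symm (h : IsFermiPatch ι ν V δ ε Θ) {x : M} (hx : x ∈ Θ.target)
    (v w : TangentSpace (𝓡 m) x) :
    fermiGram ι ν (Θ.symm x) (mfderiv (𝓡 m) ((𝓡 n).prod (𝓡 (m - n))) Θ.symm x v)
      (mfderiv (𝓡 m) ((𝓡 n).prod (𝓡 (m - n))) Θ.symm x w) = inner ℝ v w := by
  have h1 : fermiMap m n ι ν (Θ.symm x) = x := by
    rw [← h.eqOn (Θ.map_target hx), Θ.right_inv hx]
  exact (congrArg₂ (@inner ℝ (TangentSpace (𝓡 m) (fermiMap m n ι ν (Θ.symm x))) _)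
    (h.mfderiv_fermiMap_symm hx v) (h.mfderiv_fermiMap_symm hx w)).trans
      (inner_tangentSpace_congr (E := EuclideanSpace ℝ (Fin m)) h1 _ _)

lemma quasiIsometricOn (h : IsFermiPatch ι ν V δ ε Θ) (hε : 0 < ε) :
    QuasiIsometricOn (1 + ε) ambientMetric (productMetric ι Θ) Θ.target := by
  intro x hx v hv
  have h1 := h.ratio _ (Θ.map_target hx) (mfderiv (𝓡 m) ((𝓡 n).prod (𝓡 (m - n))) Θ.symm x v)
  rw [h.fermiGram_mfderiv_symm hx] at h1
  have h2 : 0 < ambientMetric x v v := real_inner_self_pos.2 hv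
  have h3 : productMetric ι Θ x v v ≤ (1 + ε) * ambientMetric x v v := h1.1
  have h4 : ambientMetric x v v ≤ (1 + ε) * productMetric ι Θ x v v := h1.2
  have h5 : 0 < productMetric ι Θ x v v := by
    by_contra! hneg
    nlinarith
  constructor
  · rw [div_le_div_iff₀ (by linarith) h5]
    linarith
  · rw [div_le_iff₀ h5]
    exact h4

/-- By the Gauss lemma the left side is the product of `v` with the radial vector, which has length
`|t|`; Cauchy–Schwarz gives the bound. It expresses that `|t|` is 1-Lipschitz along curves. -/
lemma abs_inner_le (h : IsFermiPatch ι ν V δ ε Θ) {x : M} (hx : x ∈ Θ.target)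
    (v : TangentSpace (𝓡 m) x) :
    |inner ℝ (Θ.symm x).2 (show EuclideanSpace ℝ (Fin n) × EuclideanSpace ℝ (Fin (m - n)) from
      mfderiv (𝓡 m) ((𝓡 n).prod (𝓡 (m - n))) Θ.symm x v).2| ≤ ‖(Θ.symm x).2‖ * ‖v‖ := by
  have hp := Θ.map_target hx
  rw [← h.radial _ hp]
  have h1 := h.radial _ hp (0, (Θ.symm x).2)
  have h2 := h.fermiGram_mfderiv_symm hx v v
  refine (abs_real_inner_le_norm _ _).trans (le_of_eq ?_)
  congr 1
  · rw [← sq_eq_sq₀ (norm_nonneg _) (norm_nonneg _), ← real_inner_self_eq_norm_sq,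
      ← real_inner_self_eq_norm_sq]
    exact h1
  · rw [← sq_eq_sq₀ (norm_nonneg _) (norm_nonneg _), ← real_inner_self_eq_norm_sq,
      ← real_inner_self_eq_norm_sq]
    exact h2

lemma hasDerivAt_symm_snd (h : IsFermiPatch ι ν V δ ε Θ) {γ : ℝ → M} {s : ℝ}
    (hγ : MDifferentiableAt 𝓘(ℝ, ℝ) (𝓡 m) γ s) (hs : γ s ∈ Θ.target) :
    HasDerivAt (fun s ↦ (Θ.symm (γ s)).2)
      (show EuclideanSpace ℝ (Fin n) × EuclideanSpace ℝ (Fin (m - n)) from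
        mfderiv (𝓡 m) ((𝓡 n).prod (𝓡 (m - n))) Θ.symm (γ s)
          (mfderiv 𝓘(ℝ, ℝ) (𝓡 m) γ s (1 : ℝ))).2 s := by
  have h1 : MDifferentiableAt (𝓡 m) ((𝓡 n).prod (𝓡 (m - n))) Θ.symm (γ s) :=
    (h.contMDiffOn_symm.contMDiffAt (Θ.open_target.mem_nhds hs)).mdifferentiableAt (by simp)
  have h2 : HasMFDerivAt ((𝓡 n).prod (𝓡 (m - n))) (𝓡 (m - n))
      (Prod.snd : N × EuclideanSpace ℝ (Fin (m - n)) → _) (Θ.symm (γ s)) _ := hasMFDerivAt_snd _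
  have h3 := HasMFDerivAt.comp s h2 (HasMFDerivAt.comp s h1.hasMFDerivAt hγ.hasMFDerivAt)
  have h4 : HasFDerivAt (fun s ↦ (Θ.symm (γ s)).2)
      (_ : ℝ →L[ℝ] EuclideanSpace ℝ (Fin (m - n))) s := hasMFDerivAt_iff_hasFDerivAt.1 h3
  exact h4.hasDerivAt

end IsFermiPatch

/-! ### Normal vectors in an orthonormal frame. -/

lemma Orthonormal.exists_eq_sum_of_orthogonal {T F : Type*} [NormedAddCommGroup T]
    [InnerProductSpace ℝ T] [FiniteDimensional ℝ T] [AddCommGroup F] [Module ℝ F] {L : F →ₗ[ℝ] T}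
    (hL : Function.Injective L) {k : ℕ} {ν : Fin k → T} (hν : Orthonormal ℝ ν)
    (hn : ∀ w j, inner ℝ (L w) (ν j) = 0)
    (hdim : Module.finrank ℝ F + k = Module.finrank ℝ T) {v : T} (hv : ∀ w, inner ℝ (L w) v = 0) :
    ∃ t : EuclideanSpace ℝ (Fin k), v = ∑ j, t j • ν j := by
  set S := LinearMap.range L
  have hS : Module.finrank ℝ S = Module.finrank ℝ F := LinearMap.finrank_range_of_inj hL
  have h1 := S.finrank_add_finrank_orthogonal
  have h2 : Module.finrank ℝ (Submodule.span ℝ (range ν)) = k := by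
    rw [finrank_span_eq_card hν.linearIndependent, Fintype.card_fin]
  have h3 : Submodule.span ℝ (range ν) ≤ Sᗮ := by
    rw [Submodule.span_le]
    rintro _ ⟨j, rfl⟩
    refine (Submodule.mem_orthogonal S _).2 ?_
    rintro _ ⟨w, rfl⟩
    exact hn w j
  -- Both the span of the frame and the orthogonal complement have dimension `k`.
  have h4 := Submodule.eq_of_le_of_finrank_eq h3 (by omega)
  have h5 : v ∈ Sᗮ := by
    refine (Submodule.mem_orthogonal S _).2 ?_
    rintro _ ⟨w, rfl⟩
    exact hv w
  rw [← h4, Submodule.mem_span_range_iff_exists_fun] at h5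
  obtain ⟨c, hc⟩ := h5
  exact ⟨WithLp.toLp 2 c, hc.symm⟩

lemma Orthonormal.norm_sum_eq {T : Type*} [NormedAddCommGroup T] [InnerProductSpace ℝ T] {k : ℕ}
    {ν : Fin k → T} (hν : Orthonormal ℝ ν) (t : EuclideanSpace ℝ (Fin k)) :
    ‖∑ j, t j • ν j‖ = ‖t‖ := by
  rw [← sq_eq_sq₀ (norm_nonneg _) (norm_nonneg _), ← real_inner_self_eq_norm_sq,
    ← real_inner_self_eq_norm_sq, hν.inner_sum, PiLp.inner_apply]
  simp [sq]

section NormalFrame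

variable {m n : ℕ}
  {M : Type*} [TopologicalSpace M] [ChartedSpace (EuclideanSpace ℝ (Fin m)) M]
  [IsManifold (𝓡 m) ∞ M] [RiemannianBundle (fun x : M ↦ TangentSpace (𝓡 m) x)]
  {N : Type*} [TopologicalSpace N] [ChartedSpace (EuclideanSpace ℝ (Fin n)) N]
  {ι : N → M} {ν : Fin (m - n) → ∀ q : N, TangentSpace (𝓡 m) (ι q)}
  {U : Set N}

lemma IsNormalFrameOn.exists_eq_sum (hnm : n ≤ m) (hι : IsSmoothEmbedding (𝓡 n) (𝓡 m) ∞ ι)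
    (hν : IsNormalFrameOn m n ι ν U) {q : N} (hq : q ∈ U) {v : TangentSpace (𝓡 m) (ι q)}
    (hv : ∀ w : TangentSpace (𝓡 n) q, inner ℝ (mfderiv (𝓡 n) (𝓡 m) ι q w) v = 0) :
    ∃ t : EuclideanSpace ℝ (Fin (m - n)), v = ∑ j, t j • ν j q := by
  have hT : Module.finrank ℝ (TangentSpace (𝓡 m) (ι q)) = m :=
    finrank_euclideanSpace_fin (𝕜 := ℝ) (n := m)
  have hF : Module.finrank ℝ (TangentSpace (𝓡 n) q) = n :=
    finrank_euclideanSpace_fin (𝕜 := ℝ) (n := n)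
  have : FiniteDimensional ℝ (TangentSpace (𝓡 m) (ι q)) :=
    inferInstanceAs (FiniteDimensional ℝ (EuclideanSpace ℝ (Fin m)))
  exact (hν.orthonormal q hq).exists_eq_sum_of_orthogonal
    (L := (mfderiv (𝓡 n) (𝓡 m) ι q).toLinearMap)
    (hι.isImmersion.isImmersionAt q).mfderiv_injective (fun w j ↦ hν.normal q hq j w)
    (by omega) hv

lemma IsNormalFrameOn.norm_sum (hν : IsNormalFrameOn m n ι ν U) {q : N} (hq : q ∈ U)
    (t : EuclideanSpace ℝ (Fin (m - n))) : ‖∑ j, t j • ν j q‖ = ‖t‖ :=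
  (hν.orthonormal q hq).norm_sum_eq t

lemma IsNormalFrameOn.inner_sum_eq_zero (hν : IsNormalFrameOn m n ι ν U) {q : N} (hq : q ∈ U)
    (t : EuclideanSpace ℝ (Fin (m - n))) (w : TangentSpace (𝓡 n) q) :
    inner ℝ (mfderiv (𝓡 n) (𝓡 m) ι q w) (∑ j, t j • ν j q) = 0 := by
  rw [_root_.inner_sum]
  refine Finset.sum_eq_zero fun j _ ↦ ?_
  rw [inner_smul_right, hν.normal q hq j w, mul_zero]

/-- Passage from one normal frame to another. -/
lemma IsNormalFrameOn.exists_sum_eq_sum (hnm : n ≤ m) (hι : IsSmoothEmbedding (𝓡 n) (𝓡 m) ∞ ι)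
    {ν' : Fin (m - n) → ∀ q : N, TangentSpace (𝓡 m) (ι q)} {U' : Set N}
    (hν : IsNormalFrameOn m n ι ν U) (hν' : IsNormalFrameOn m n ι ν' U') {q : N} (hq : q ∈ U)
    (hq' : q ∈ U') (t : EuclideanSpace ℝ (Fin (m - n))) :
    ∃ t' : EuclideanSpace ℝ (Fin (m - n)), ‖t'‖ = ‖t‖ ∧
      ∑ j, t j • ν j q = ∑ j, t' j • ν' j q ∧
      fermiMap m n ι ν (q, t) = fermiMap m n ι ν' (q, t') := by
  obtain ⟨t', ht'⟩ := hν'.exists_eq_sum hnm hι hq' (hν.inner_sum_eq_zero hq t)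
  refine ⟨t', ?_, ht', ?_⟩
  · rw [← hν'.norm_sum hq', ← ht', hν.norm_sum hq]
  · simp only [fermiMap, ht']

end NormalFrame

/-! ### Radial rays bound the distance to the submanifold. -/

section Distance

variable {m n : ℕ}
  {M : Type*} [EMetricSpace M] [ChartedSpace (EuclideanSpace ℝ (Fin m)) M]
  [RiemannianBundle (fun x : M ↦ TangentSpace (𝓡 m) x)]
  [IsRiemannianManifold (𝓡 m) M]
  {N : Type*} [TopologicalSpace N] [ChartedSpace (EuclideanSpace ℝ (Fin n)) N]
  {ι : N → M} {ν : Fin (m - n) → ∀ q : N, TangentSpace (𝓡 m) (ι q)} {V : Set N} {δ ε : ℝ}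
  {Θ : OpenPartialHomeomorph (N × EuclideanSpace ℝ (Fin (m - n))) M}

/-- The ray from `(q, 0)` to `(q, t)` has constant speed `|t|` on `[0, 1]`, hence length `|t|`. -/
lemma IsFermiPatch.edist_le (h : IsFermiPatch ι ν V δ ε Θ) {q : N}
    {t : EuclideanSpace ℝ (Fin (m - n))} (hq : q ∈ V) (ht : ‖t‖ < δ) :
    edist (ι q) (fermiMap m n ι ν (q, t)) ≤ ENNReal.ofReal ‖t‖ := by
  have hp : (q, t) ∈ Θ.source := by
    rw [h.source_eq]; exact ⟨hq, mem_ball_zero_iff.2 ht⟩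
  have hmem : ∀ s ∈ Icc (0 : ℝ) 1, (q, s • t) ∈ Θ.source := by
    intro s hs
    rw [h.source_eq]
    refine ⟨hq, ?_⟩
    rw [mem_ball_zero_iff, norm_smul, Real.norm_eq_abs, abs_of_nonneg hs.1]
    exact (mul_le_of_le_one_left (norm_nonneg _) hs.2).trans_lt ht
  set c : ℝ → N × EuclideanSpace ℝ (Fin (m - n)) := fun s ↦ (q, s • t)
  have hc : ContMDiff 𝓘(ℝ, ℝ) ((𝓡 n).prod (𝓡 (m - n))) 1 c := by
    refine contMDiff_const.prodMk (ContDiff.contMDiff ?_)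
    fun_prop
  have hγ : ContMDiffOn 𝓘(ℝ, ℝ) (𝓡 m) 1 (fermiMap m n ι ν ∘ c) (Icc 0 1) := fun s hs ↦
    (((h.contMDiffAt (hmem s hs)).of_le (by exact_mod_cast le_top)).comp s
      (hc s)).contMDiffWithinAt
  have hv : ∀ s ∈ Icc (0 : ℝ) 1,
      ‖mfderiv 𝓘(ℝ, ℝ) (𝓡 m) (fermiMap m n ι ν ∘ c) s (1 : ℝ)‖ₑ = ENNReal.ofReal ‖t‖ := by
    intro s hs
    have h1 := (h.contMDiffAt (hmem s hs)).mdifferentiableAt (by simp)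
    have h2 : HasMFDerivAt 𝓘(ℝ, ℝ) (𝓡 (m - n)) (fun s : ℝ ↦ s • t) s
        (ContinuousLinearMap.toSpanSingleton ℝ t) := by
      have h := ((hasDerivAt_id s).smul_const t).hasFDerivAt
      rw [one_smul] at h
      exact h.hasMFDerivAt
    have h3 : HasMFDerivAt 𝓘(ℝ, ℝ) ((𝓡 n).prod (𝓡 (m - n))) c s _ :=
      (hasMFDerivAt_const (I := 𝓘(ℝ, ℝ)) (I' := 𝓡 n) q s).prodMk h2
    have h4 := (HasMFDerivAt.comp s h1.hasMFDerivAt h3).mfderiv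
    have h5 : mfderiv 𝓘(ℝ, ℝ) (𝓡 m) (fermiMap m n ι ν ∘ c) s (1 : ℝ) =
        mfderiv ((𝓡 n).prod (𝓡 (m - n))) (𝓡 m) (fermiMap m n ι ν) (q, s • t)
          ((0 : EuclideanSpace ℝ (Fin n)), t) := by
      refine (DFunLike.congr_fun h4 (1 : ℝ)).trans ?_
      refine congrArg (fun w : EuclideanSpace ℝ (Fin (m - n)) ↦
        (mfderiv ((𝓡 n).prod (𝓡 (m - n))) (𝓡 m) (fermiMap m n ι ν) (q, s • t)
          ((0 : EuclideanSpace ℝ (Fin n)), w) : EuclideanSpace ℝ (Fin m))) (one_smul ℝ t)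
    have h6 := h.ray _ hp s hs
    rw [fermiGram, real_inner_self_eq_norm_sq, real_inner_self_eq_norm_sq,
      sq_eq_sq₀ (norm_nonneg _) (norm_nonneg _)] at h6
    rw [← ofReal_norm, h5]
    exact congrArg ENNReal.ofReal h6
  rw [IsRiemannianManifold.out (I := 𝓡 m) (ι q) (fermiMap m n ι ν (q, t))]
  refine (riemannianEDist_le_pathELength hγ (by simp [c, h.apply_zero q hq]) (by simp [c])
    zero_le_one).trans ?_
  rw [pathELength_eq_lintegral_mfderiv_Icc]
  refine (MeasureTheory.setLIntegral_congr_fun measurableSet_Icc hv).le.trans ?_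
  simp

end Distance

/-! ### Gluing local patches. -/

section Glue

variable {m n : ℕ}
  {M : Type*} [TopologicalSpace M] [ChartedSpace (EuclideanSpace ℝ (Fin m)) M]
  [RiemannianBundle (fun x : M ↦ TangentSpace (𝓡 m) x)]
  {N : Type*} [TopologicalSpace N] [ChartedSpace (EuclideanSpace ℝ (Fin n)) N]
  {ι : N → M} {ν : Fin (m - n) → ∀ q : N, TangentSpace (𝓡 m) (ι q)} {V : Set N} {δ ε : ℝ}

/-- Local Fermi patches on which the Fermi parametrization is jointly injective can be glued. -/
lemma exists_isFermiPatch_of_injOn [Nonempty N] (hV : IsOpen V)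
    (hinj : InjOn (fermiMap m n ι ν) (V ×ˢ ball 0 δ))
    (hloc : ∀ q ∈ V, ∃ V', IsOpen V' ∧ q ∈ V' ∧ ∃ Θ, IsFermiPatch ι ν V' δ ε Θ) :
    ∃ Θ, IsFermiPatch ι ν V δ ε Θ := by
  have hloc' : ∀ p ∈ V ×ˢ ball (0 : EuclideanSpace ℝ (Fin (m - n))) δ,
      ∃ V' ⊆ V, p.1 ∈ V' ∧ ∃ Θ, IsFermiPatch ι ν V' δ ε Θ ∧ p ∈ Θ.source ∧
        Θ.source ⊆ V ×ˢ ball (0 : EuclideanSpace ℝ (Fin (m - n))) δ := by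
    intro p hp
    obtain ⟨V', hV', hqV', Θ, hΘ⟩ := hloc p.1 hp.1
    obtain ⟨Θ', hΘ'⟩ := hΘ.mono (hV.inter hV') inter_subset_right le_rfl
    refine ⟨V ∩ V', inter_subset_left, ⟨hp.1, hqV'⟩, Θ', hΘ', ?_, ?_⟩
    · rw [hΘ'.source_eq]; exact ⟨⟨hp.1, hqV'⟩, hp.2⟩
    · rw [hΘ'.source_eq]; exact prod_mono inter_subset_left Subset.rfl
  have hW : IsOpen (V ×ˢ ball (0 : EuclideanSpace ℝ (Fin (m - n))) δ) := hV.prod isOpen_ball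
  have hsmooth : ContMDiffOn ((𝓡 n).prod (𝓡 (m - n))) (𝓡 m) ∞ (fermiMap m n ι ν)
      (V ×ˢ ball 0 δ) := by
    intro p hp
    obtain ⟨V', -, -, Θ, hΘ, hpΘ, -⟩ := hloc' p hp
    exact (hΘ.contMDiffAt hpΘ).contMDiffWithinAt
  let e := hinj.toPartialEquiv
  -- Openness is local and each patch is a homeomorphism between open sets; only injectivity has to
  -- be assumed globally.
  have hopen : IsOpenMap (e.source.domRestrict e) := by
    refine IsOpenMap.of_nhds_le fun p ↦ ?_
    obtain ⟨V', -, -, Θ, hΘ, hpΘ, -⟩ := hloc' p.1 p.2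
    have h1 : Filter.map (fermiMap m n ι ν) (𝓝 p.1) = 𝓝 (fermiMap m n ι ν p.1) := by
      rw [← hΘ.eqOn hpΘ, ← Θ.map_nhds_eq hpΘ]
      exact Filter.map_congr (Filter.eventuallyEq_of_mem (Θ.open_source.mem_nhds hpΘ)
        hΘ.eqOn.symm)
    have h2 : Filter.map (Subtype.val : e.source → _) (𝓝 p) = 𝓝 p.1 :=
      hW.isOpenEmbedding_subtypeVal.map_nhds_eq p
    have h3 : Filter.map (e.source.domRestrict e) (𝓝 p) =
        Filter.map (fermiMap m n ι ν) (Filter.map (Subtype.val : e.source → _) (𝓝 p)) :=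
      Filter.map_map.symm
    rw [h3, h2, h1]
    exact le_rfl
  let Θ := OpenPartialHomeomorph.ofContinuousOpenRestrict e hsmooth.continuousOn hopen hW
  have hsrc : Θ.source = V ×ˢ ball 0 δ := rfl
  have hΘf : ∀ p, Θ p = fermiMap m n ι ν p := fun _ ↦ rfl
  refine ⟨Θ, hsrc, fun _ _ ↦ rfl, hsmooth, ?_, ?_, ?_, ?_, ?_⟩
  · intro x hx
    have hp := Θ.map_target hx
    rw [hsrc] at hp
    obtain ⟨V', -, -, Θ', hΘ', hpΘ', hsub⟩ := hloc' _ hp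
    have hx' : Θ' (Θ.symm x) = x := by
      rw [hΘ'.eqOn hpΘ', ← hΘf, Θ.right_inv hx]
    have hxt : x ∈ Θ'.target := hx' ▸ Θ'.map_source hpΘ'
    refine ((hΘ'.contMDiffOn_symm.contMDiffAt (Θ'.open_target.mem_nhds hxt)).congr_of_eventuallyEq
      ?_).contMDiffWithinAt
    -- Global injectivity makes the glued inverse agree with the local one near `x`, so it inherits
    -- smoothness.
    filter_upwards [Θ'.open_target.mem_nhds hxt, Θ.open_target.mem_nhds hx] with y hy hyΘ
    refine hinj (Θ.map_target hyΘ) (hsub (Θ'.map_target hy)) ?_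
    rw [← hΘf, Θ.right_inv hyΘ, ← hΘ'.eqOn (Θ'.map_target hy), Θ'.right_inv hy]
  · intro q hq
    obtain ⟨V', -, hqV', Θ, hΘ⟩ := hloc q hq
    exact hΘ.apply_zero q hqV'
  · intro p hp
    obtain ⟨V', -, -, Θ, hΘ, hpΘ, -⟩ := hloc' p hp
    exact hΘ.radial p hpΘ
  · intro p hp
    obtain ⟨V', -, -, Θ, hΘ, hpΘ, -⟩ := hloc' p hp
    exact hΘ.ray p hpΘ
  · intro p hp
    obtain ⟨V', -, -, Θ, hΘ, hpΘ, -⟩ := hloc' p hp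
    exact hΘ.ratio p hpΘ

end Glue

/-! ### Uniform radii by compactness. -/

section Uniform

variable {m n : ℕ}
  {M : Type*} [TopologicalSpace M] [T2Space M] [ChartedSpace (EuclideanSpace ℝ (Fin m)) M]
  [IsManifold (𝓡 m) ∞ M] [RiemannianBundle (fun x : M ↦ TangentSpace (𝓡 m) x)]
  [IsContMDiffRiemannianBundle (𝓡 m) ∞ (EuclideanSpace ℝ (Fin m))
    (fun x : M ↦ TangentSpace (𝓡 m) x)]
  {N : Type*} [TopologicalSpace N] [ChartedSpace (EuclideanSpace ℝ (Fin n)) N]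
  [IsManifold (𝓡 n) ∞ N] {ι : N → M}
  {ν ν' : Fin (m - n) → ∀ q : N, TangentSpace (𝓡 m) (ι q)} {U U' K K' : Set N} {ε : ℝ}

/-- The Fermi patches around the points of a compact set can be given a common radius. -/
lemma eventually_exists_isFermiPatch (hnm : n ≤ m) (hι : IsSmoothEmbedding (𝓡 n) (𝓡 m) ∞ ι)
    (hU : IsOpen U) (hν : IsNormalFrameOn m n ι ν U) (hK : IsCompact K) (hKU : K ⊆ U)
    (hε : 0 < ε) :
    ∀ᶠ δ : ℝ in 𝓝[>] 0, ∀ q ∈ K, ∃ V, IsOpen V ∧ q ∈ V ∧ V ⊆ U ∧ ∃ Θ,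
      IsFermiPatch ι ν V δ ε Θ := by
  refine hK.induction_on (p := fun K ↦ ∀ᶠ δ : ℝ in 𝓝[>] 0, ∀ q ∈ K, ∃ V, IsOpen V ∧ q ∈ V ∧
    V ⊆ U ∧ ∃ Θ, IsFermiPatch ι ν V δ ε Θ) (by simp) ?_ ?_ ?_
  · intro s t hst ht
    filter_upwards [ht] with δ hδ q hq using hδ q (hst hq)
  · intro s t hs ht
    filter_upwards [hs, ht] with δ h1 h2 q hq
    exact hq.elim (h1 q) (h2 q)
  · intro q₀ hq₀
    obtain ⟨V, hV, hqV, hVU, δ, Θ, hδ, hΘ⟩ := exists_isFermiPatch hnm hι hU hν (hKU hq₀) hε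
    refine ⟨V, mem_nhdsWithin_of_mem_nhds (hV.mem_nhds hqV), ?_⟩
    filter_upwards [Ioc_mem_nhdsGT hδ] with δ' hδ' q hq
    exact ⟨V, hV, hq, hVU, hΘ.mono hV Subset.rfl hδ'.2⟩

/-- At a common base point, the second vector is rewritten in the first frame and both lie in one
injective patch. At distinct base points, the images are separated because `ι` is injective and `M`
is Hausdorff. The conclusion compares vectors, not coordinates, since the frames may differ. -/
lemma eventually_eq_of_fermiMap_eq (hnm : n ≤ m) (hι : IsSmoothEmbedding (𝓡 n) (𝓡 m) ∞ ι)
    (hU : IsOpen U) (hν : IsNormalFrameOn m n ι ν U) (hU' : IsOpen U')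
    (hν' : IsNormalFrameOn m n ι ν' U') {q₀ q₀' : N} (hq₀ : q₀ ∈ U) (hq₀' : q₀' ∈ U') :
    ∀ᶠ z : (EuclideanSpace ℝ (Fin (m - n)) × EuclideanSpace ℝ (Fin (m - n))) × N × N in
      𝓝 (0, q₀, q₀'), fermiMap m n ι ν (z.2.1, z.1.1) = fermiMap m n ι ν' (z.2.2, z.1.2) →
        (⟨ι z.2.1, ∑ j, z.1.1 j • ν j z.2.1⟩ : TangentBundle (𝓡 m) M) =
          ⟨ι z.2.2, ∑ j, z.1.2 j • ν' j z.2.2⟩ := by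
  -- The metric comparison plays no role here, so any positive constant would do in place of `1`.
  obtain ⟨V, hV, hqV, hVU, δ, Θ, hδ, hΘ⟩ := exists_isFermiPatch hnm hι hU hν hq₀ one_pos
  obtain ⟨V', hV', hqV', hVU', δ', Θ', hδ', hΘ'⟩ :=
    exists_isFermiPatch hnm hι hU' hν' hq₀' one_pos
  have hmem : (q₀, (0 : EuclideanSpace ℝ (Fin (m - n)))) ∈ Θ.source := by
    rw [hΘ.source_eq]; exact ⟨hqV, mem_ball_self hδ⟩
  have hmem' : (q₀', (0 : EuclideanSpace ℝ (Fin (m - n)))) ∈ Θ'.source := by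
    rw [hΘ'.source_eq]; exact ⟨hqV', mem_ball_self hδ'⟩
  have hc1 : Filter.Tendsto (fun z : (EuclideanSpace ℝ (Fin (m - n)) ×
      EuclideanSpace ℝ (Fin (m - n))) × N × N ↦ (z.2.1, z.1.1)) (𝓝 (0, q₀, q₀')) (𝓝 (q₀, 0)) :=
    Continuous.tendsto (by fun_prop) _
  have hc2 : Filter.Tendsto (fun z : (EuclideanSpace ℝ (Fin (m - n)) ×
      EuclideanSpace ℝ (Fin (m - n))) × N × N ↦ (z.2.2, z.1.2)) (𝓝 (0, q₀, q₀')) (𝓝 (q₀', 0)) :=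
    Continuous.tendsto (by fun_prop) _
  by_cases hqq : q₀ = q₀'
  · subst hqq
    have hs1 := hc1.eventually (Θ.open_source.mem_nhds hmem)
    have hs2 := hc2.eventually (Θ.open_source.mem_nhds hmem)
    have hs3 := hc2.eventually (Θ'.open_source.mem_nhds hmem')
    filter_upwards [hs1, hs2, hs3] with z h1 h2 h3 heq
    change (_, _) ∈ Θ.source at h1
    change (_, _) ∈ Θ.source at h2
    change (_, _) ∈ Θ'.source at h3
    have h4 : z.2.2 ∈ V ∧ z.1.2 ∈ ball 0 δ := by rwa [hΘ.source_eq] at h2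
    have h5 : z.2.2 ∈ V' ∧ z.1.2 ∈ ball 0 δ' := by rwa [hΘ'.source_eq] at h3
    obtain ⟨t, ht, hsum, hmap⟩ := hν'.exists_sum_eq_sum hnm hι hν (hVU' h5.1) (hVU h4.1) z.1.2
    have h6 : (z.2.2, t) ∈ Θ.source := by
      rw [hΘ.source_eq]
      refine ⟨h4.1, ?_⟩
      rw [mem_ball_zero_iff, ht]
      exact mem_ball_zero_iff.1 h4.2
    have h7 := Θ.injOn h1 h6 (by rw [hΘ.eqOn h1, hΘ.eqOn h6, heq, hmap])
    rw [hsum]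
    exact congrArg (fun p : N × EuclideanSpace ℝ (Fin (m - n)) ↦
      (⟨ι p.1, ∑ j, p.2 j • ν j p.1⟩ : TangentBundle (𝓡 m) M)) h7
  · have hne : fermiMap m n ι ν (q₀, 0) ≠ fermiMap m n ι ν' (q₀', 0) := by
      rw [hΘ.apply_zero q₀ hqV, hΘ'.apply_zero q₀' hqV']
      exact fun h ↦ hqq (hι.isEmbedding.injective h)
    have ht1 := (hΘ.contMDiffAt hmem).continuousAt.tendsto.comp hc1
    have ht2 := (hΘ'.contMDiffAt hmem').continuousAt.tendsto.comp hc2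
    filter_upwards [(ht1.prodMk_nhds ht2).eventually
      (isClosed_diagonal.isOpen_compl.mem_nhds hne)] with z hz heq
    exact absurd heq hz

lemma eventually_forall_eq_of_fermiMap_eq (hnm : n ≤ m)
    (hι : IsSmoothEmbedding (𝓡 n) (𝓡 m) ∞ ι) (hU : IsOpen U) (hν : IsNormalFrameOn m n ι ν U)
    (hU' : IsOpen U') (hν' : IsNormalFrameOn m n ι ν' U') (hK : IsCompact K) (hKU : K ⊆ U)
    (hK' : IsCompact K') (hKU' : K' ⊆ U') :
    ∀ᶠ δ : ℝ in 𝓝[>] 0, ∀ q ∈ K, ∀ q' ∈ K', ∀ t t' : EuclideanSpace ℝ (Fin (m - n)),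
      ‖t‖ < δ → ‖t'‖ < δ → fermiMap m n ι ν (q, t) = fermiMap m n ι ν' (q', t') →
        (⟨ι q, ∑ j, t j • ν j q⟩ : TangentBundle (𝓡 m) M) = ⟨ι q', ∑ j, t' j • ν' j q'⟩ := by
  have h := (hK.prod hK').eventually_forall_of_forall_eventually
    (x₀ := (0 : EuclideanSpace ℝ (Fin (m - n)) × EuclideanSpace ℝ (Fin (m - n))))
    (P := fun t q ↦ fermiMap m n ι ν (q.1, t.1) = fermiMap m n ι ν' (q.2, t.2) →
        (⟨ι q.1, ∑ j, t.1 j • ν j q.1⟩ : TangentBundle (𝓡 m) M) =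
          ⟨ι q.2, ∑ j, t.2 j • ν' j q.2⟩)
    fun q hq ↦ eventually_eq_of_fermiMap_eq hnm hι hU hν hU' hν' (hKU hq.1) (hKU' hq.2)
  obtain ⟨δ, hδ, hball⟩ := Metric.eventually_nhds_iff_ball.1 h
  filter_upwards [Ioc_mem_nhdsGT hδ] with δ' hδ' q hq q' hq' t t' ht ht'
  refine hball (t, t') ?_ (q, q') ⟨hq, hq'⟩
  rw [mem_ball_zero_iff]
  exact (max_lt ht ht').trans_le hδ'.2

end Uniform

lemma IsContMDiffRiemannianBundle.isContinuousRiemannianBundle {EB : Type*}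
    [NormedAddCommGroup EB] [NormedSpace ℝ EB] {HB : Type*} [TopologicalSpace HB]
    {IB : ModelWithCorners ℝ EB HB} {k : WithTop ℕ∞} {B : Type*} [TopologicalSpace B]
    [ChartedSpace HB B] {F : Type*} [NormedAddCommGroup F] [NormedSpace ℝ F] {E : B → Type*}
    [TopologicalSpace (TotalSpace F E)] [∀ x, NormedAddCommGroup (E x)]
    [∀ x, InnerProductSpace ℝ (E x)] [FiberBundle F E] [VectorBundle ℝ F E]
    [h : IsContMDiffRiemannianBundle IB k F E] : IsContinuousRiemannianBundle F E := by
  obtain ⟨g, hg, h⟩ := h.exists_contMDiff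
  exact ⟨g, hg.continuous, h⟩

/-! ### Length of a path as an integral of its speed. -/

section Speed

variable {m : ℕ}
  {M : Type*} [TopologicalSpace M] [ChartedSpace (EuclideanSpace ℝ (Fin m)) M]
  [IsManifold (𝓡 m) ∞ M] [RiemannianBundle (fun x : M ↦ TangentSpace (𝓡 m) x)]
  [IsContMDiffRiemannianBundle (𝓡 m) ∞ (EuclideanSpace ℝ (Fin m))
    (fun x : M ↦ TangentSpace (𝓡 m) x)]

lemma ContMDiff.continuous_norm_mfderiv {γ : ℝ → M} (hγ : ContMDiff 𝓘(ℝ, ℝ) (𝓡 m) 1 γ) :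
    Continuous fun s ↦ ‖mfderiv 𝓘(ℝ, ℝ) (𝓡 m) γ s (1 : ℝ)‖ := by
  have h1 : Continuous (fun s : ℝ ↦ (⟨s, (1 : ℝ)⟩ : TangentBundle 𝓘(ℝ, ℝ) ℝ)) := by
    have := (contMDiffOn_tangentBundle_vectorSpace (I := 𝓘(ℝ, ℝ)) (n := 1) (g := fun s : ℝ ↦ s)
      (V := fun _ ↦ (1 : ℝ)) (s := univ) contMDiffOn_id contMDiffOn_const).continuousOn
    exact continuousOn_univ.1 this
  have h2 : Continuous (fun s ↦ (⟨γ s, mfderiv 𝓘(ℝ, ℝ) (𝓡 m) γ s (1 : ℝ)⟩ :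
      TangentBundle (𝓡 m) M)) := (hγ.continuous_tangentMap le_rfl).comp h1
  have := IsContMDiffRiemannianBundle.isContinuousRiemannianBundle (IB := 𝓡 m) (k := ∞)
    (F := EuclideanSpace ℝ (Fin m)) (E := fun x : M ↦ TangentSpace (𝓡 m) x)
  have h3 := Real.continuous_sqrt.comp (h2.inner_bundle h2)
  refine h3.congr fun s ↦ ?_
  rw [Function.comp_apply, real_inner_self_eq_norm_sq, Real.sqrt_sq (norm_nonneg _)]

lemma ContMDiff.integral_norm_mfderiv_lt {γ : ℝ → M} (hγ : ContMDiff 𝓘(ℝ, ℝ) (𝓡 m) 1 γ)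
    {r : ℝ} (hlen : pathELength (𝓡 m) γ 0 1 < ENNReal.ofReal r) :
    ∫ s in (0 : ℝ)..1, ‖mfderiv 𝓘(ℝ, ℝ) (𝓡 m) γ s (1 : ℝ)‖ < r := by
  have hc := hγ.continuous_norm_mfderiv
  rw [pathELength_eq_lintegral_mfderiv_Icc] at hlen
  simp_rw [← ofReal_norm] at hlen
  have h1 := MeasureTheory.ofReal_integral_eq_lintegral_ofReal
    (hc.integrableOn_Icc (μ := MeasureTheory.volume) (a := 0) (b := 1))
    (Filter.Eventually.of_forall fun _ ↦ norm_nonneg _)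
  replace hlen := h1.le.trans_lt hlen
  rw [intervalIntegral.integral_of_le zero_le_one, ← MeasureTheory.integral_Icc_eq_integral_Ioc]
  exact (ENNReal.ofReal_lt_ofReal_iff').1 hlen |>.1

end Speed

/-! ### Short paths from the submanifold stay in the tube. -/

section PathLifting

variable {m n : ℕ}
  {M : Type*} [TopologicalSpace M] [ChartedSpace (EuclideanSpace ℝ (Fin m)) M]
  [IsManifold (𝓡 m) ∞ M] [RiemannianBundle (fun x : M ↦ TangentSpace (𝓡 m) x)]
  [IsContMDiffRiemannianBundle (𝓡 m) ∞ (EuclideanSpace ℝ (Fin m))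
    (fun x : M ↦ TangentSpace (𝓡 m) x)]
  {N : Type*} [TopologicalSpace N] [ChartedSpace (EuclideanSpace ℝ (Fin n)) N]
  {ι : N → M} {ν : Fin (m - n) → ∀ q : N, TangentSpace (𝓡 m) (ι q)} {V : Set N} {δ ε : ℝ}
  {Θ : OpenPartialHomeomorph (N × EuclideanSpace ℝ (Fin (m - n))) M}

/-- The distance coordinate of a Fermi patch grows at most as fast as the length of a path. -/
lemma IsFermiPatch.norm_symm_snd_le (h : IsFermiPatch ι ν V δ ε Θ) {γ : ℝ → M}
    (hγ : ContMDiff 𝓘(ℝ, ℝ) (𝓡 m) 1 γ) {a b : ℝ} (hab : a ≤ b)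
    (hmem : ∀ s ∈ Icc a b, γ s ∈ Θ.target) :
    ‖(Θ.symm (γ b)).2‖ ≤
      ‖(Θ.symm (γ a)).2‖ + ∫ s in a..b, ‖mfderiv 𝓘(ℝ, ℝ) (𝓡 m) γ s (1 : ℝ)‖ := by
  have hc := hγ.continuous_norm_mfderiv
  set v : ℝ → ℝ := fun s ↦ ‖mfderiv 𝓘(ℝ, ℝ) (𝓡 m) γ s (1 : ℝ)‖
  set t : ℝ → EuclideanSpace ℝ (Fin (m - n)) := fun s ↦ (Θ.symm (γ s)).2
  -- The norm is not differentiable where `t` vanishes, so `√(|t|² + η²)` is estimated instead. Its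
  -- derivative is at most the speed of the path by the Gauss bound, and `η → 0` at the end.
  have key : ∀ η : ℝ, 0 < η → ‖t b‖ ≤ Real.sqrt (‖t a‖ ^ 2 + η ^ 2) + ∫ s in a..b, v s := by
    intro η hη
    have hpos : ∀ s, 0 < ‖t s‖ ^ 2 + η ^ 2 := fun s ↦ by positivity
    have hder : ∀ s ∈ Icc a b, ∃ d ≤ 0, HasDerivAt
        (fun s ↦ Real.sqrt (‖t s‖ ^ 2 + η ^ 2) - ∫ x in a..s, v x) d s := by
      intro s hs
      have h1 := (h.hasDerivAt_symm_snd (hγ.mdifferentiableAt one_ne_zero) (hmem s hs)).norm_sq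
      have h2 := (h1.add_const (η ^ 2)).sqrt (hpos s).ne'
      have h3 := intervalIntegral.integral_hasDerivAt_right
        (hc.intervalIntegrable a s) (hc.stronglyMeasurableAtFilter _ _) hc.continuousAt
      refine ⟨_, ?_, h2.sub h3⟩
      have h4 := (le_abs_self _).trans
        (h.abs_inner_le (hmem s hs) (mfderiv 𝓘(ℝ, ℝ) (𝓡 m) γ s (1 : ℝ)))
      have h5 : ‖t s‖ ≤ Real.sqrt (‖t s‖ ^ 2 + η ^ 2) :=
        Real.le_sqrt_of_sq_le (by nlinarith [sq_nonneg η])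
      rw [sub_nonpos, mul_div_mul_left _ _ two_ne_zero, div_le_iff₀ (Real.sqrt_pos.2 (hpos s)),
        mul_comm]
      exact h4.trans (mul_le_mul_of_nonneg_right h5 (norm_nonneg _))
    have hanti : AntitoneOn (fun s ↦ Real.sqrt (‖t s‖ ^ 2 + η ^ 2) - ∫ x in a..s, v x)
        (Icc a b) := by
      refine antitoneOn_of_deriv_nonpos (convex_Icc a b) ?_ ?_ ?_
      · intro s hs
        obtain ⟨d, -, hd⟩ := hder s hs
        exact hd.continuousAt.continuousWithinAt
      · intro s hs
        obtain ⟨d, -, hd⟩ := hder s (interior_subset hs)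
        exact hd.differentiableAt.differentiableWithinAt
      · intro s hs
        obtain ⟨d, hd0, hd⟩ := hder s (interior_subset hs)
        rwa [hd.deriv]
    have h6 := hanti (left_mem_Icc.2 hab) (right_mem_Icc.2 hab) hab
    simp only [intervalIntegral.integral_same, sub_zero] at h6
    have h7 : ‖t b‖ ≤ Real.sqrt (‖t b‖ ^ 2 + η ^ 2) :=
      Real.le_sqrt_of_sq_le (by nlinarith [sq_nonneg η])
    linarith
  have hlim : Filter.Tendsto (fun η : ℝ ↦ Real.sqrt (‖t a‖ ^ 2 + η ^ 2) + ∫ s in a..b, v s)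
      (𝓝[>] 0) (𝓝 (‖t a‖ + ∫ s in a..b, v s)) := by
    have : Continuous (fun η : ℝ ↦ Real.sqrt (‖t a‖ ^ 2 + η ^ 2) + ∫ s in a..b, v s) := by
      fun_prop
    have h0 := (this.tendsto 0).mono_left (nhdsWithin_le_nhds (s := Ioi 0))
    simpa [Real.sqrt_sq (norm_nonneg _)] using h0
  exact ge_of_tendsto hlim (Filter.eventually_of_mem self_mem_nhdsWithin key)

variable [CompactSpace N] [T2Space M]

/-- A path that starts on the submanifold and is shorter than the radius of the Fermi patches stays
in the image of the disc bundle. -/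
lemma FermiAtlas.exists_fermiMap_eq (hnm : n ≤ m) (hι : IsSmoothEmbedding (𝓡 n) (𝓡 m) ∞ ι)
    (A : FermiAtlas m n ι)
    (hloc : ∀ i, ∀ q ∈ closure (A.V i), ∃ V, IsOpen V ∧ q ∈ V ∧ V ⊆ A.U i ∧ ∃ Θ,
      IsFermiPatch ι (A.ν i) V δ ε Θ) {γ : ℝ → M} (hγ : ContMDiff 𝓘(ℝ, ℝ) (𝓡 m) 1 γ)
    {q₀ : N} (hγ0 : γ 0 = ι q₀)
    (hlen : ∫ s in (0 : ℝ)..1, ‖mfderiv 𝓘(ℝ, ℝ) (𝓡 m) γ s (1 : ℝ)‖ < δ) :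
    ∃ i, ∃ q ∈ A.V i, ∃ t, ‖t‖ < δ ∧ fermiMap m n ι (A.ν i) (q, t) = γ 1 := by
  have : T2Space N := hι.isEmbedding.t2Space
  have hc := hγ.continuous_norm_mfderiv
  set v : ℝ → ℝ := fun s ↦ ‖mfderiv 𝓘(ℝ, ℝ) (𝓡 m) γ s (1 : ℝ)‖
  set ℓ : ℝ → ℝ := fun s ↦ ∫ x in (0 : ℝ)..s, v x with hℓ
  have hv0 : ∀ s, 0 ≤ v s := fun s ↦ norm_nonneg _
  have hadd : ∀ a b, ℓ a + ∫ x in a..b, v x = ℓ b := fun a b ↦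
    intervalIntegral.integral_add_adjacent_intervals (hc.intervalIntegrable _ _)
      (hc.intervalIntegrable _ _)
  have hmono : ∀ a b, a ≤ b → ℓ a ≤ ℓ b := fun a b hab ↦ by
    rw [← hadd a b]
    exact le_add_of_nonneg_right (intervalIntegral.integral_nonneg hab fun s _ ↦ hv0 s)
  have hℓc : Continuous ℓ := intervalIntegral.continuous_primitive
    (fun a b ↦ hc.intervalIntegrable a b) 0
  have hcover : ∀ q, ∃ i, q ∈ A.V i := fun q ↦ mem_iUnion.1 (A.cover ▸ mem_univ q)
  have hℓ0 : ℓ 0 = 0 := intervalIntegral.integral_same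
  have hδ : 0 < δ := (hℓ0.symm.le.trans (hmono 0 1 zero_le_one)).trans_lt hlen
  have hframe : ∀ i, ∀ q ∈ A.U i, ∀ t, ∃ j, q ∈ A.V j ∧ ∃ t', ‖t'‖ = ‖t‖ ∧
      fermiMap m n ι (A.ν i) (q, t) = fermiMap m n ι (A.ν j) (q, t') := by
    intro i q hq t
    obtain ⟨j, hj⟩ := hcover q
    obtain ⟨t', ht', -, h⟩ := (A.frame i).exists_sum_eq_sum hnm hι (A.frame j) hq
      (A.closure_subset j (subset_closure hj)) t
    exact ⟨j, hj, t', ht', h⟩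
  -- The bound by the length travelled so far is the invariant that keeps the lift away from the
  -- boundary of the patches, since `ℓ 1 < δ`. Closures of the `V i` are used so that `S ∩ [0, 1]`
  -- is a finite union of projections of compact sets, hence closed.
  let S : Set ℝ := {s | ∃ i, ∃ q ∈ closure (A.V i), ∃ t, ‖t‖ ≤ ℓ s ∧
    fermiMap m n ι (A.ν i) (q, t) = γ s}
  have hcont : ∀ i, ContinuousOn (fermiMap m n ι (A.ν i))
      (closure (A.V i) ×ˢ closedBall 0 (ℓ 1)) := by
    intro i p hp
    obtain ⟨V, -, hqV, -, Θ, hΘ⟩ := hloc i p.1 hp.1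
    refine (hΘ.contMDiffAt (p := p) ?_).continuousAt.continuousWithinAt
    rw [hΘ.source_eq]
    exact ⟨hqV, mem_ball_zero_iff.2 ((mem_closedBall_zero_iff.1 hp.2).trans_lt hlen)⟩
  have hclosed : IsClosed (S ∩ Icc 0 1) := by
    let C : Fin A.card → Set ((N × EuclideanSpace ℝ (Fin (m - n))) × ℝ) := fun i ↦
      (closure (A.V i) ×ˢ closedBall 0 (ℓ 1)) ×ˢ Icc 0 1
    have hCK : ∀ i, IsCompact (C i) := fun i ↦
      (isClosed_closure.isCompact.prod (isCompact_closedBall _ _)).prod isCompact_Icc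
    have hCC : ∀ i, IsCompact (C i ∩ {x | fermiMap m n ι (A.ν i) x.1 = γ x.2 ∧
        ‖x.1.2‖ ≤ ℓ x.2}) := by
      intro i
      have h1 : ContinuousOn (fun x : (N × EuclideanSpace ℝ (Fin (m - n))) × ℝ ↦
          (fermiMap m n ι (A.ν i) x.1, γ x.2)) (C i) :=
        ((hcont i).comp continuousOn_fst fun x hx ↦ hx.1).prodMk
          (hγ.continuous.comp_continuousOn continuousOn_snd)
      have h2 := h1.preimage_isClosed_of_isClosed (hCK i).isClosed isClosed_diagonal
      have h3 : IsClosed {x : (N × EuclideanSpace ℝ (Fin (m - n))) × ℝ | ‖x.1.2‖ ≤ ℓ x.2} :=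
        isClosed_le (by fun_prop) (by fun_prop)
      exact (hCK i).of_isClosed_subset (by convert! h2.inter h3 using 1; rw [inter_assoc]; rfl)
        inter_subset_left
    have hS : S ∩ Icc 0 1 = ⋃ i, Prod.snd '' (C i ∩ {x | fermiMap m n ι (A.ν i) x.1 = γ x.2 ∧
        ‖x.1.2‖ ≤ ℓ x.2}) := by
      ext s
      simp only [mem_iUnion, mem_image]
      constructor
      · rintro ⟨⟨i, q, hq, t, ht, heq⟩, hs⟩
        exact ⟨i, ((q, t), s), ⟨⟨⟨hq, mem_closedBall_zero_iff.2
          (ht.trans (hmono s 1 hs.2))⟩, hs⟩, heq, ht⟩, rfl⟩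
      · rintro ⟨i, ⟨⟨q, t⟩, s⟩, ⟨⟨⟨hq, -⟩, hs⟩, heq, ht⟩, rfl⟩
        exact ⟨⟨i, q, hq, t, ht, heq⟩, hs⟩
    rw [hS]
    exact isClosed_iUnion_of_finite fun i ↦ ((hCC i).image continuous_snd).isClosed
  have hstart : (0 : ℝ) ∈ S := by
    obtain ⟨i, hi⟩ := hcover q₀
    obtain ⟨V, -, hqV, -, Θ, hΘ⟩ := hloc i q₀ (subset_closure hi)
    exact ⟨i, q₀, subset_closure hi, 0, by simp [hℓ0], by rw [hΘ.apply_zero q₀ hqV, hγ0]⟩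
  -- Just after `s` the path stays in one patch, where `|t|` grows no faster than the length. The
  -- new foot point may have left `closure (V i)`, so the frame is changed to one whose `V j`
  -- contains it; this preserves `|t|`.
  have hopen : ∀ s ∈ S ∩ Ico 0 1, S ∈ 𝓝[>] s := by
    rintro s ⟨⟨i, q, hq, t, ht, heq⟩, hs⟩
    obtain ⟨V, -, hqV, hVU, Θ, hΘ⟩ := hloc i q hq
    have hp : (q, t) ∈ Θ.source := by
      rw [hΘ.source_eq]
      exact ⟨hqV, mem_ball_zero_iff.2 ((ht.trans (hmono s 1 hs.2.le)).trans_lt hlen)⟩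
    have hsymm : Θ.symm (γ s) = (q, t) := by
      rw [← heq, ← hΘ.eqOn hp, Θ.left_inv hp]
    have hmem : γ s ∈ Θ.target := by
      rw [← heq, ← hΘ.eqOn hp]; exact Θ.map_source hp
    obtain ⟨u, hsu, hu⟩ := (mem_nhdsGE_iff_exists_Ico_subset).1
      (mem_nhdsWithin_of_mem_nhds (hγ.continuous.continuousAt.preimage_mem_nhds
        (Θ.open_target.mem_nhds hmem)) : γ ⁻¹' Θ.target ∈ 𝓝[≥] s)
    refine Filter.mem_of_superset (Ioo_mem_nhdsGT hsu) fun b hb ↦ ?_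
    have hb' : ∀ x ∈ Icc s b, γ x ∈ Θ.target := fun x hx ↦ hu ⟨hx.1, hx.2.trans_lt hb.2⟩
    have hbt := hb' b (right_mem_Icc.2 hb.1.le)
    have hle := hΘ.norm_symm_snd_le hγ hb.1.le hb'
    have hsrc := Θ.map_target hbt
    have hqU : (Θ.symm (γ b)).1 ∈ A.U i := by
      rw [hΘ.source_eq] at hsrc
      exact hVU hsrc.1
    obtain ⟨j, hj, t', ht', hmap⟩ := hframe i _ hqU (Θ.symm (γ b)).2
    refine ⟨j, _, subset_closure hj, t', ?_, ?_⟩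
    · rw [ht', ← hadd s b]
      rw [hsymm] at hle
      exact hle.trans (add_le_add_left ht _)
    · rw [← hmap]
      exact (hΘ.eqOn hsrc).symm.trans (Θ.right_inv hbt)
  obtain ⟨i, q, hq, t, ht, heq⟩ := hclosed.Icc_subset_of_forall_mem_nhdsWithin hstart hopen
    (right_mem_Icc.2 zero_le_one)
  obtain ⟨j, hj, t', ht', hmap⟩ := hframe i q (A.closure_subset i hq) t
  exact ⟨j, q, hj, t', ht'.trans_lt (ht.trans_lt hlen), hmap ▸ heq⟩

end PathLifting

/-! ### A common radius for a whole Fermi atlas. -/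

namespace FermiAtlas

variable {m n : ℕ}
  {M : Type*} [EMetricSpace M] [ChartedSpace (EuclideanSpace ℝ (Fin m)) M]
  [IsManifold (𝓡 m) ∞ M] [RiemannianBundle (fun x : M ↦ TangentSpace (𝓡 m) x)]
  {N : Type*} [TopologicalSpace N] [ChartedSpace (EuclideanSpace ℝ (Fin n)) N]
  {ι : N → M}

/-- Each frame maps Euclidean space isometrically onto the normal spaces, so the normal disc bundle
is covered by the coordinate discs of the atlas. -/
lemma mem_normalDiscBundle_iff (A : FermiAtlas m n ι) (hnm : n ≤ m)
    (hι : IsSmoothEmbedding (𝓡 n) (𝓡 m) ∞ ι) {δ : ℝ} {X : TangentBundle (𝓡 m) M} :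
    X ∈ normalDiscBundle m n ι δ ↔ ∃ i, ∃ q ∈ A.V i, ∃ t : EuclideanSpace ℝ (Fin (m - n)),
      ‖t‖ < δ ∧ X = ⟨ι q, ∑ j, t j • A.ν i j q⟩ := by
  have hU : ∀ i, ∀ q ∈ A.V i, q ∈ A.U i := fun i q hq ↦ A.closure_subset i (subset_closure hq)
  constructor
  · rintro ⟨q, v, rfl, hv, hδ⟩
    obtain ⟨i, hi⟩ := mem_iUnion.1 (A.cover ▸ mem_univ q)
    obtain ⟨t, rfl⟩ := (A.frame i).exists_eq_sum hnm hι (hU i q hi) hv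
    exact ⟨i, q, hi, t, by rwa [(A.frame i).norm_sum (hU i q hi)] at hδ, rfl⟩
  · rintro ⟨i, q, hi, t, ht, rfl⟩
    exact ⟨q, _, rfl, (A.frame i).inner_sum_eq_zero (hU i q hi) t,
      by rwa [(A.frame i).norm_sum (hU i q hi)]⟩

variable [IsContMDiffRiemannianBundle (𝓡 m) ∞ (EuclideanSpace ℝ (Fin m))
    (fun x : M ↦ TangentSpace (𝓡 m) x)] [CompactSpace N]

/-- Over the sets `V i` of a Fermi atlas, the Fermi parametrizations are Fermi patches of a common
radius, and the exponential map is injective on the normal discs of that radius. -/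
lemma exists_isFermiPatch [Nonempty N] [IsManifold (𝓡 n) ∞ N] (A : FermiAtlas m n ι)
    (hnm : n ≤ m) (hι : IsSmoothEmbedding (𝓡 n) (𝓡 m) ∞ ι) {ε : ℝ} (hε : 0 < ε) :
    ∃ δ : ℝ, 0 < δ ∧
      (∀ i, ∀ q ∈ closure (A.V i), ∃ V, IsOpen V ∧ q ∈ V ∧ V ⊆ A.U i ∧ ∃ Θ,
        IsFermiPatch ι (A.ν i) V δ ε Θ) ∧
      InjOn (riemannianExp (E := EuclideanSpace ℝ (Fin m))) (normalDiscBundle m n ι δ) ∧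
      ∀ i, ∃ Θ, IsFermiPatch ι (A.ν i) (A.V i) δ ε Θ := by
  have hK : ∀ i, IsCompact (closure (A.V i)) := fun i ↦ isClosed_closure.isCompact
  have h1 := Filter.eventually_all.2 fun i ↦ eventually_exists_isFermiPatch hnm hι (A.isOpen_U i)
    (A.frame i) (hK i) (A.closure_subset i) hε
  have h2 := Filter.eventually_all.2 fun i ↦ Filter.eventually_all.2 fun j ↦
    eventually_forall_eq_of_fermiMap_eq hnm hι (A.isOpen_U i) (A.frame i) (A.isOpen_U j)
      (A.frame j) (hK i) (A.closure_subset i) (hK j) (A.closure_subset j)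
  -- There are finitely many patches and pairs of patches, so one `δ` meets all the conditions.
  obtain ⟨δ, ⟨hloc, heq⟩, hδ⟩ := ((h1.and h2).and self_mem_nhdsWithin).exists
  refine ⟨δ, hδ, hloc, ?_, fun i ↦ ?_⟩
  · intro X hX Y hY hXY
    obtain ⟨i, q, hq, t, ht, rfl⟩ := (A.mem_normalDiscBundle_iff hnm hι).1 hX
    obtain ⟨j, q', hq', t', ht', rfl⟩ := (A.mem_normalDiscBundle_iff hnm hι).1 hY
    exact heq i j q (subset_closure hq) q' (subset_closure hq') t t' ht ht' hXY
  · refine exists_isFermiPatch_of_injOn (A.isOpen_V i) ?_ fun q hq ↦ ?_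
    · rintro ⟨q, t⟩ ⟨hq, ht⟩ ⟨q', t'⟩ ⟨hq', ht'⟩ h
      have hX := heq i i q (subset_closure hq) q' (subset_closure hq') t t'
        (mem_ball_zero_iff.1 ht) (mem_ball_zero_iff.1 ht') h
      -- Equal vectors have equal base points; a single local patch over that point then determines
      -- the coordinates.
      obtain rfl : q = q' := hι.isEmbedding.injective (congrArg TotalSpace.proj hX)
      obtain ⟨V, -, hqV, -, Θ, hΘ⟩ := hloc i q (subset_closure hq)
      have hs : (q, t) ∈ Θ.source := by rw [hΘ.source_eq]; exact ⟨hqV, ht⟩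
      have hs' : (q, t') ∈ Θ.source := by rw [hΘ.source_eq]; exact ⟨hqV, ht'⟩
      exact Θ.injOn hs hs' (by rw [hΘ.eqOn hs, hΘ.eqOn hs', h])
    · obtain ⟨V, hV, hqV, -, hΘ⟩ := hloc i q (subset_closure hq)
      exact ⟨V, hV, hqV, hΘ⟩

end FermiAtlas

end FermiCoordinates

theorem mainTheorem6 {m n : ℕ} (hnm : n < m)
    {M : Type*} [EMetricSpace M] [CompactSpace M] [ChartedSpace (EuclideanSpace ℝ (Fin m)) M]
    [IsManifold (𝓡 m) ∞ M] [RiemannianBundle (fun x : M ↦ TangentSpace (𝓡 m) x)]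
    [IsContMDiffRiemannianBundle (𝓡 m) ∞ (EuclideanSpace ℝ (Fin m))
      (fun x : M ↦ TangentSpace (𝓡 m) x)]
    [IsRiemannianManifold (𝓡 m) M]
    {N : Type*} [TopologicalSpace N] [CompactSpace N] [Nonempty N]
    [ChartedSpace (EuclideanSpace ℝ (Fin n)) N] [IsManifold (𝓡 n) ∞ N]
    (ι : N → M) (hι : IsSmoothEmbedding (𝓡 n) (𝓡 m) ∞ ι) :
    Nonempty (FermiAtlas m n ι) ∧
    ∀ (A : FermiAtlas m n ι) (ε₀ : ℝ), 0 < ε₀ → ∃ δ : ℝ, 0 < δ ∧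
      BijOn (riemannianExp (E := EuclideanSpace ℝ (Fin m))) (normalDiscBundle m n ι δ)
        (thickening δ (range ι)) ∧
      ∃ Φ : Fin A.card → OpenPartialHomeomorph (N × EuclideanSpace ℝ (Fin (m - n))) M,
        (∀ i, (Φ i).source = A.V i ×ˢ ball 0 δ ∧
          EqOn (Φ i) (fermiMap m n ι (A.ν i)) (Φ i).source ∧
          ContMDiffOn ((𝓡 n).prod (𝓡 (m - n))) (𝓡 m) ∞ (Φ i) (Φ i).source ∧
          ContMDiffOn (𝓡 m) ((𝓡 n).prod (𝓡 (m - n))) ∞ (Φ i).symm (Φ i).target) ∧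
        ⋃ i, (Φ i).target = thickening δ (range ι) ∧
        ∀ i, QuasiIsometricOn (1 + ε₀) ambientMetric (productMetric ι (Φ i)) (Φ i).target := by
  -- With compactness this makes `N` regular, as the shrinking of patches in the existence of
  -- atlases requires.
  have : T2Space N := hι.isEmbedding.t2Space
  refine ⟨nonempty_fermiAtlas hnm.le hι, fun A ε₀ hε ↦ ?_⟩
  obtain ⟨δ, hδ, hloc, hinj, hpatch⟩ := A.exists_isFermiPatch hnm.le hι hε
  choose Φ hΦ using hpatch
  have hsrc : ∀ i, ∀ q ∈ A.V i, ∀ t : EuclideanSpace ℝ (Fin (m - n)), ‖t‖ < δ →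
      (q, t) ∈ (Φ i).source := fun i q hq t ht ↦ by
    rw [(hΦ i).source_eq]
    exact ⟨hq, mem_ball_zero_iff.2 ht⟩
  have hmaps : ∀ i, ∀ q ∈ A.V i, ∀ t, ‖t‖ < δ →
      fermiMap m n ι (A.ν i) (q, t) ∈ thickening δ (range ι) := by
    intro i q hq t ht
    rw [mem_thickening_iff_exists_edist_lt]
    refine ⟨ι q, mem_range_self q, ?_⟩
    rw [edist_comm]
    exact ((hΦ i).edist_le hq ht).trans_lt ((ENNReal.ofReal_lt_ofReal_iff hδ).2 ht)
  have hsurj : ∀ x ∈ thickening δ (range ι), ∃ i, ∃ q ∈ A.V i, ∃ t, ‖t‖ < δ ∧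
      fermiMap m n ι (A.ν i) (q, t) = x := by
    intro x hx
    rw [mem_thickening_iff_exists_edist_lt] at hx
    obtain ⟨_, ⟨q₀, rfl⟩, hx⟩ := hx
    rw [edist_comm, IsRiemannianManifold.out (I := 𝓡 m) (ι q₀) x] at hx
    -- The distance is an infimum of lengths, so the strict inequality yields a `C¹` path from `ι
    -- q₀` to `x` of length less than `δ`, which the path lifting argument keeps in the tube.
    obtain ⟨γ, hγ0, hγ1, hγ, hlen, -⟩ :=
      exists_lt_locally_constant_of_riemannianEDist_lt hx zero_lt_one
    rw [← hγ1]
    exact A.exists_fermiMap_eq hnm.le hι hloc hγ hγ0 (hγ.integral_norm_mfderiv_lt hlen)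
  refine ⟨δ, hδ, ⟨?_, hinj, ?_⟩, Φ, fun i ↦ ⟨(hΦ i).source_eq, (hΦ i).eqOn, (hΦ i).contMDiffOn,
    (hΦ i).contMDiffOn_symm⟩, ?_, fun i ↦ (hΦ i).quasiIsometricOn hε⟩
  · intro X hX
    obtain ⟨i, q, hq, t, ht, rfl⟩ := (A.mem_normalDiscBundle_iff hnm.le hι).1 hX
    exact hmaps i q hq t ht
  · intro x hx
    obtain ⟨i, q, hq, t, ht, rfl⟩ := hsurj x hx
    exact ⟨_, (A.mem_normalDiscBundle_iff hnm.le hι).2 ⟨i, q, hq, t, ht, rfl⟩, rfl⟩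
  · ext x
    rw [mem_iUnion]
    constructor
    · rintro ⟨i, hx⟩
      have hp := (Φ i).map_target hx
      rw [← (Φ i).right_inv hx, (hΦ i).eqOn hp]
      rw [(hΦ i).source_eq] at hp
      exact hmaps i _ hp.1 _ (mem_ball_zero_iff.1 hp.2)
    · intro hx
      obtain ⟨i, q, hq, t, ht, rfl⟩ := hsurj x hx
      refine ⟨i, ?_⟩
      rw [← (hΦ i).eqOn (hsrc i q hq t ht)]
      exact (Φ i).map_source (hsrc i q hq t ht)
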